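/- Let $k$ be a field of characteristic zero, let $X=\operatorname{Spec}\mathcal O$ be a smooth affine variety over $k$ (more generally, let $\mathcal O$ be any smooth commutative $k$-algebra), and let $\mathcal D$ be its ring of differential operators, i.e. the ring generated by functions $f\in\mathcal O$ and vector fields $\theta\in\operatorname{Der}_k(\mathcal O)$ subject to the usual relations. Consider the category of non-negatively graded chain complexes of left $\mathcal D$-modules, symmetric monoidal for $\otimes_{\mathcal O}$ (vector fields act by the Leibniz rule, symmetries carry Koszul signs). Let $\mathcal A$ be a commutative monoid in it (a differential graded $\mathcal D$-algebra) and let $\mathtt{Mod}(\mathcal A)$ be the category of $\mathcal A$-modules in it, with its relative tensor product $\otimes_{\mathcal A}$ and its model structure: weak equivalences are the quasi-isomorphisms, fibrations are the morphisms that are surjective in positive degrees, cofibrations are the morphisms with the left lifting property with respect to trivial fibrations. A commutative square with vertices $A\to B$, $C\to D$ (top and bottom sides) and $A\to C$, $B\to D$ (left and right sides) in $\mathtt{Mod}(\mathcal A)$ is a *model square* if, for a fibrant replacement $B'\to D'\leftarrow C'$ of the cospan $B\to D\leftarrow C$ (an objectwise weakly equivalent cospan of fibrant objects at least one of whose legs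 is a fibration), the universal map $A\to B'\times_{D'}C'$ is a weak equivalence. A *homotopy fiber sequence* $A\to B\to D$ is such a model square in which moreover $C\to 0$ is a weak equivalence. A functor preserves model squares (resp. homotopy fiber sequences) if it maps every model square (resp. homotopy fiber sequence) to one. For $M\in\mathtt{Mod}(\mathcal A)$, the derived tensor product $-\otimes^{\mathbb L}_{\mathcal A}M$ is represented by the endofunctors $$Q(-)\otimes_{\mathcal A}CM,\qquad Q(-)\otimes_{\mathcal A}M,\qquad -\otimes_{\mathcal A}CM$$ of $\mathtt{Mod}(\mathcal A)$, where $Q$ is any functor with cofibrant values equipped with a natural trivial fibration $Q\Rightarrow\mathrm{id}$, and $CM\to M$ is any weak equivalence with $CM$ cofibrant. One says that $-\otimes^{\mathbb L}_{\mathcal A}M$ preserves model squares (and then $M$ is called *flat*), resp. preserves homotopy fiber sequences, if these representing functors do. Then: 1. Every functor $F:\mathtt{Mod}(\mathcal A)\to\mathtt{Mod}(\mathcal A)$ that preserves weak equivalences and homotopy fiber sequences preserves all model squares. 2. For every $M\in\mathtt{Mod}(\mathcal A)$, each functor representing $-\otimes^{\mathbb L}_{\mathcal A}M$ preserves model squares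 if and only if it preserves homotopy fiber sequences. 3. In particular, $M\in\mathtt{Mod}(\mathcal A)$ is flat if and only if $-\otimes^{\mathbb L}_{\mathcal A}M$ preserves homotopy fiber sequences. -/

import Mathlib

open CategoryTheory CategoryTheory.Limits HomotopicalAlgebra
open scoped TensorProduct DirectSum

universe u

namespace DGeom

/-! ### The ring `𝒟` of differential operators and left `𝒟`-modules -/

section DiffOp

variable (k : Type u) [Field k] (O : Type u) [CommRing O] [Algebra k O]

/-- Generators of `𝒟`: functions `f : O` and vector fields `θ : Der_k(O)`. -/
abbrev DiffGen : Type u := O ⊕ Derivation k O O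

/-- The defining relations of `𝒟`: `O` is a subring, `θ ↦ θ` is left `O`-linear,
`θ f - f θ = θ(f)`, and `θ η - η θ = [θ, η]`. -/
inductive DiffRel : FreeAlgebra ℤ (DiffGen k O) → FreeAlgebra ℤ (DiffGen k O) → Prop
  | fun_one : DiffRel (FreeAlgebra.ι ℤ (Sum.inl 1)) 1
  | fun_add (f g : O) : DiffRel (FreeAlgebra.ι ℤ (Sum.inl (f + g)))
      (FreeAlgebra.ι ℤ (Sum.inl f) + FreeAlgebra.ι ℤ (Sum.inl g))
  | fun_mul (f g : O) : DiffRel (FreeAlgebra.ι ℤ (Sum.inl (f * g)))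
      (FreeAlgebra.ι ℤ (Sum.inl f) * FreeAlgebra.ι ℤ (Sum.inl g))
  | der_add (θ η : Derivation k O O) : DiffRel (FreeAlgebra.ι ℤ (Sum.inr (θ + η)))
      (FreeAlgebra.ι ℤ (Sum.inr θ) + FreeAlgebra.ι ℤ (Sum.inr η))
  | der_smul (f : O) (θ : Derivation k O O) : DiffRel (FreeAlgebra.ι ℤ (Sum.inr (f • θ)))
      (FreeAlgebra.ι ℤ (Sum.inl f) * FreeAlgebra.ι ℤ (Sum.inr θ))
  | leibniz (θ : Derivation k O O) (f : O) :
      DiffRel (FreeAlgebra.ι ℤ (Sum.inr θ) * FreeAlgebra.ι ℤ (Sum.inl f))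
        (FreeAlgebra.ι ℤ (Sum.inl f) * FreeAlgebra.ι ℤ (Sum.inr θ) +
          FreeAlgebra.ι ℤ (Sum.inl (θ f)))
  | bracket (θ η : Derivation k O O) :
      DiffRel (FreeAlgebra.ι ℤ (Sum.inr θ) * FreeAlgebra.ι ℤ (Sum.inr η))
        (FreeAlgebra.ι ℤ (Sum.inr η) * FreeAlgebra.ι ℤ (Sum.inr θ) +
          FreeAlgebra.ι ℤ (Sum.inr ⁅θ, η⁆))

/-- The ring `𝒟` of (global sections of the sheaf of) differential operators of the affine
variety `Spec O`, in its standard presentation by functions and vector fields. When `O` is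
smooth over a field `k` of characteristic zero, this is the ring of `k`-linear differential
operators `O → O`. A left `𝒟`-module is the same as an `O`-module with a flat connection. -/
def DiffOp : Type u := RingQuot (DiffRel k O)

noncomputable instance : Ring (DiffOp k O) := inferInstanceAs (Ring (RingQuot (DiffRel k O)))

variable {k O}

namespace DiffOp

/-- The quotient map from the free ring. -/
noncomputable def mk : FreeAlgebra ℤ (DiffGen k O) →+* DiffOp k O :=
  RingQuot.mkRingHom (DiffRel k O)

/-- A vector field, seen as a differential operator. -/
noncomputable def ofDer (θ : Derivation k O O) : DiffOp k O :=
  mk (FreeAlgebra.ι ℤ (Sum.inr θ))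

variable (k) in
/-- A function, seen as a differential operator of order zero. -/
noncomputable def ofFun : O →+* DiffOp k O :=
  RingHom.mk'
    { toFun := fun f => mk (FreeAlgebra.ι ℤ (Sum.inl f))
      map_one' := by
        have := RingQuot.mkRingHom_rel (DiffRel.fun_one (k := k) (O := O))
        exact this.trans (map_one _)
      map_mul' := fun f g => by
        have := RingQuot.mkRingHom_rel (DiffRel.fun_mul (k := k) f g)
        exact this.trans (map_mul _ _ _) }
    (fun f g => by
        have := RingQuot.mkRingHom_rel (DiffRel.fun_add (k := k) f g)
        exact this.trans (map_add _ _ _))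

theorem ofDer_mul_ofFun (θ : Derivation k O O) (f : O) :
    ofDer θ * ofFun k f = ofFun k f * ofDer θ + ofFun k (θ f) := by
  have := RingQuot.mkRingHom_rel (DiffRel.leibniz θ f)
  rw [map_mul, map_add, map_mul] at this
  exact this

theorem ofDer_add (θ η : Derivation k O O) : ofDer (θ + η) = ofDer θ + ofDer η := by
  have := RingQuot.mkRingHom_rel (DiffRel.der_add θ η)
  rw [map_add] at this
  exact this

theorem ofDer_smul (f : O) (θ : Derivation k O O) : ofDer (f • θ) = ofFun k f * ofDer θ := by
  have := RingQuot.mkRingHom_rel (DiffRel.der_smul f θ)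
  rw [map_mul] at this
  exact this

theorem ofDer_bracket (θ η : Derivation k O O) :
    ofDer θ * ofDer η = ofDer η * ofDer θ + ofDer ⁅θ, η⁆ := by
  have := RingQuot.mkRingHom_rel (DiffRel.bracket θ η)
  rw [map_mul, map_add, map_mul] at this
  exact this

/-- `𝒟` is generated, as a ring, by functions and vector fields. -/
theorem induction {C : DiffOp k O → Prop} (hf : ∀ f, C (ofFun k f)) (hd : ∀ θ, C (ofDer θ))
    (hmul : ∀ P Q, C P → C Q → C (P * Q)) (hadd : ∀ P Q, C P → C Q → C (P + Q))
    (hneg : ∀ P, C P → C (-P)) (P : DiffOp k O) : C P := by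
  obtain ⟨x, rfl⟩ := RingQuot.mkRingHom_surjective (DiffRel k O) P
  change C (mk x)
  have h0 : C 0 := by simpa using hf 0
  have h1 : C 1 := by simpa using hf 1
  induction x using FreeAlgebra.induction with
  | grade0 n =>
    rw [eq_intCast, map_intCast]
    induction n using Int.induction_on with
    | zero => simpa using h0
    | succ n ih => push_cast at ih ⊢; exact hadd _ _ ih h1
    | pred n ih => push_cast at ih ⊢; rw [sub_eq_add_neg]; exact hadd _ _ ih (hneg _ h1)
  | grade1 x =>
    cases x with
    | inl f => exact hf f
    | inr θ => exact hd θ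
  | mul a b ha hb => rw [map_mul]; exact hmul _ _ ha hb
  | add a b ha hb => rw [map_add]; exact hadd _ _ ha hb

/-- The universal property of `𝒟`. -/
noncomputable def lift {R : Type*} [Ring R] (φ : O →+* R) (δ : Derivation k O O → R)
    (hadd : ∀ θ η, δ (θ + η) = δ θ + δ η) (hsmul : ∀ f θ, δ (f • θ) = φ f * δ θ)
    (hleib : ∀ θ f, δ θ * φ f = φ f * δ θ + φ (θ f))
    (hbr : ∀ θ η, δ θ * δ η = δ η * δ θ + δ ⁅θ, η⁆) : DiffOp k O →+* R :=
  RingQuot.lift ⟨(FreeAlgebra.lift ℤ (Sum.elim (fun f => φ f) δ)).toRingHom, by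
    intro x y h
    cases h with
    | bracket θ η => simpa using hbr θ η
    | _ => simp [hadd, hsmul, hleib]⟩

section

variable {R : Type*} [Ring R] (φ : O →+* R) (δ : Derivation k O O → R)
    (hadd : ∀ θ η, δ (θ + η) = δ θ + δ η) (hsmul : ∀ f θ, δ (f • θ) = φ f * δ θ)
    (hleib : ∀ θ f, δ θ * φ f = φ f * δ θ + φ (θ f))
    (hbr : ∀ θ η, δ θ * δ η = δ η * δ θ + δ ⁅θ, η⁆)

theorem lift_ofFun (f : O) : lift φ δ hadd hsmul hleib hbr (ofFun k f) = φ f := by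
  refine (RingQuot.lift_mkRingHom_apply _ _ _).trans ?_
  simp

theorem lift_ofDer (θ : Derivation k O O) : lift φ δ hadd hsmul hleib hbr (ofDer θ) = δ θ := by
  refine (RingQuot.lift_mkRingHom_apply _ _ _).trans ?_
  simp

end

end DiffOp


/-! ### The tensor product over `O` of two left `𝒟`-modules -/

noncomputable instance (M : ModuleCat.{u} (DiffOp k O)) : Module O M :=
  Module.compHom M (DiffOp.ofFun k (O := O))

theorem fun_smul (M : ModuleCat.{u} (DiffOp k O)) (f : O) (m : M) :
    f • m = DiffOp.ofFun k f • m := rfl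

/-- A map commuting with functions and with vector fields is `𝒟`-linear. -/
noncomputable def linD {M N : Type u} [AddCommGroup M] [AddCommGroup N] [Module (DiffOp k O) M]
    [Module (DiffOp k O) N] (φ : M →+ N)
    (hf : ∀ (f : O) m, φ (DiffOp.ofFun k f • m) = DiffOp.ofFun k f • φ m)
    (hd : ∀ (θ : Derivation k O O) m, φ (DiffOp.ofDer θ • m) = DiffOp.ofDer θ • φ m) :
    M →ₗ[DiffOp k O] N where
  toFun := φ
  map_add' := φ.map_add
  map_smul' P := by
    induction P using DiffOp.induction with
    | hf f => exact hf f
    | hd θ => exact hd θ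
    | hmul P Q hP hQ =>
      intro m
      simp only [RingHom.id_apply] at hP hQ ⊢
      rw [mul_smul, hP, hQ, mul_smul]
    | hadd P Q hP hQ =>
      intro m
      simp only [RingHom.id_apply] at hP hQ ⊢
      rw [add_smul, map_add, hP, hQ, add_smul]
    | hneg P hP =>
      intro m
      simp only [RingHom.id_apply] at hP ⊢
      rw [neg_smul, map_neg, hP, neg_smul]

/-- A biadditive map from its two additivity properties. -/
def biadd {M N G : Type*} [AddCommGroup M] [AddCommGroup N] [AddCommGroup G] (b : M → N → G)
    (h1 : ∀ m m' n, b (m + m') n = b m n + b m' n)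
    (h2 : ∀ m n n', b m (n + n') = b m n + b m n') : M →+ N →+ G :=
  AddMonoidHom.mk' (fun m => AddMonoidHom.mk' (b m) (h2 m))
    (fun m m' => AddMonoidHom.ext fun n => h1 m m' n)

theorem biadd_apply {M N G : Type*} [AddCommGroup M] [AddCommGroup N] [AddCommGroup G]
    (b : M → N → G) (h1 : ∀ m m' n, b (m + m') n = b m n + b m' n)
    (h2 : ∀ m n n', b m (n + n') = b m n + b m n') (m : M) (n : N) :
    biadd b h1 h2 m n = b m n := rfl

section Tensor

variable (M N : ModuleCat.{u} (DiffOp k O))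

/-- The action of a vector field on `M ⊗_O N`: `θ (m ⊗ n) = θ m ⊗ n + m ⊗ θ n`. -/
noncomputable def derAct (θ : Derivation k O O) : AddMonoid.End (M ⊗[O] N) :=
  TensorProduct.liftAddHom
    (biadd (fun (m : M) (n : N) =>
        (DiffOp.ofDer θ • m) ⊗ₜ[O] n + m ⊗ₜ[O] (DiffOp.ofDer θ • n))
      (fun a b n => by simp only [TensorProduct.add_tmul, smul_add]; abel)
      (fun m a b => by simp only [TensorProduct.tmul_add, smul_add]; abel))
    (fun f m n => by
      simp only [biadd_apply, fun_smul, ← mul_smul, DiffOp.ofDer_mul_ofFun, add_smul,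
        TensorProduct.add_tmul, TensorProduct.tmul_add]
      simp only [mul_smul, ← fun_smul, TensorProduct.smul_tmul]
      abel)

theorem derAct_tmul (θ : Derivation k O O) (m : M) (n : N) :
    derAct M N θ (m ⊗ₜ[O] n) =
      (DiffOp.ofDer θ • m) ⊗ₜ[O] n + m ⊗ₜ[O] (DiffOp.ofDer θ • n) := rfl

theorem end_ext {φ ψ : AddMonoid.End (M ⊗[O] N)}
    (h : ∀ m n, φ (m ⊗ₜ[O] n) = ψ (m ⊗ₜ[O] n)) : φ = ψ := by
  refine AddMonoidHom.ext fun x => ?_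
  induction x using TensorProduct.induction_on with
  | zero => exact (map_zero φ).trans (map_zero ψ).symm
  | tmul m n => exact h m n
  | add x y hx hy => exact (map_add φ x y).trans ((congrArg₂ _ hx hy).trans (map_add ψ x y).symm)

/-- The action of `𝒟` on `M ⊗_O N`. -/
noncomputable def tensorAct : DiffOp k O →+* AddMonoid.End (M ⊗[O] N) :=
  DiffOp.lift (Module.toAddMonoidEnd O (M ⊗[O] N)) (derAct M N)
    (fun θ η => end_ext M N fun m n => by
      change _ = derAct M N θ (m ⊗ₜ[O] n) + derAct M N η (m ⊗ₜ[O] n)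
      simp only [derAct_tmul, DiffOp.ofDer_add, add_smul,
        TensorProduct.add_tmul, TensorProduct.tmul_add]
      abel)
    (fun f θ => end_ext M N fun m n => by
      change _ = f • derAct M N θ (m ⊗ₜ[O] n)
      simp only [derAct_tmul, DiffOp.ofDer_smul, mul_smul, smul_add, ← fun_smul,
        TensorProduct.smul_tmul', TensorProduct.tmul_smul])
    (fun θ f => end_ext M N fun m n => by
      change derAct M N θ (f • (m ⊗ₜ[O] n)) =
        f • derAct M N θ (m ⊗ₜ[O] n) + (θ f) • (m ⊗ₜ[O] n)
      simp only [TensorProduct.smul_tmul',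
        derAct_tmul, smul_add, fun_smul, ← mul_smul, DiffOp.ofDer_mul_ofFun, add_smul,
        TensorProduct.add_tmul]
      abel)
    (fun θ η => end_ext M N fun m n => by
      change derAct M N θ (derAct M N η (m ⊗ₜ[O] n)) =
        derAct M N η (derAct M N θ (m ⊗ₜ[O] n)) + derAct M N ⁅θ, η⁆ (m ⊗ₜ[O] n)
      simp only [derAct_tmul, map_add, ← mul_smul, DiffOp.ofDer_bracket θ η,
        add_smul, TensorProduct.add_tmul, TensorProduct.tmul_add]
      abel)

/-- The tensor product `M ⊗_O N` of two left `𝒟`-modules. -/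
noncomputable def tensor : ModuleCat.{u} (DiffOp k O) :=
  @ModuleCat.of (DiffOp k O) _ (M ⊗[O] N) _ (Module.compHom (M ⊗[O] N) (tensorAct M N))

end Tensor

variable {M N M' N' : ModuleCat.{u} (DiffOp k O)}

/-- The decomposed tensor `m ⊗ n`. -/
noncomputable def tmul (m : M) (n : N) : tensor M N := m ⊗ₜ[O] n

theorem fun_smul_tmul (f : O) (m : M) (n : N) :
    DiffOp.ofFun k f • tmul m n = tmul (DiffOp.ofFun k f • m) n := by
  change tensorAct M N (DiffOp.ofFun k f) (m ⊗ₜ[O] n) = _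
  rw [tensorAct, DiffOp.lift_ofFun]
  rfl

theorem tmul_fun_smul (f : O) (m : M) (n : N) :
    tmul m (DiffOp.ofFun k f • n) = tmul (DiffOp.ofFun k f • m) n :=
  (TensorProduct.smul_tmul (R := O) f m n).symm

theorem der_smul_tmul (θ : Derivation k O O) (m : M) (n : N) :
    DiffOp.ofDer θ • tmul m n = tmul (DiffOp.ofDer θ • m) n + tmul m (DiffOp.ofDer θ • n) := by
  change tensorAct M N (DiffOp.ofDer θ) (m ⊗ₜ[O] n) = _
  rw [tensorAct, DiffOp.lift_ofDer]
  rfl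

theorem tmul_add (m : M) (n n' : N) : tmul m (n + n') = tmul m n + tmul m n' :=
  TensorProduct.tmul_add m n n'

theorem add_tmul (m m' : M) (n : N) : tmul (m + m') n = tmul m n + tmul m' n :=
  TensorProduct.add_tmul m m' n

/-- The universal property of `M ⊗_O N` for biadditive `O`-balanced maps. -/
noncomputable def tensorLift {G : Type*} [AddCommGroup G] (b : M →+ N →+ G)
    (hb : ∀ (f : O) m n, b (DiffOp.ofFun k f • m) n = b m (DiffOp.ofFun k f • n)) :
    tensor M N →+ G :=
  TensorProduct.liftAddHom (R := O) b hb

theorem tensorLift_tmul {G : Type*} [AddCommGroup G] (b : M →+ N →+ G)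
    (hb : ∀ (f : O) m n, b (DiffOp.ofFun k f • m) n = b m (DiffOp.ofFun k f • n)) (m : M) (n : N) :
    tensorLift b hb (tmul m n) = b m n := rfl

theorem tensor_induction {C : tensor M N → Prop} (h0 : C 0) (ht : ∀ m n, C (tmul m n))
    (hadd : ∀ x y, C x → C y → C (x + y)) (x : tensor M N) : C x :=
  TensorProduct.induction_on (R := O) (M := M) (N := N) x h0 ht hadd

/-- The map `φ ⊗ ψ` induced by two `𝒟`-linear maps. -/
noncomputable def tensorMap (φ : M →ₗ[DiffOp k O] M') (ψ : N →ₗ[DiffOp k O] N') :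
    tensor M N →ₗ[DiffOp k O] tensor M' N' :=
  linD (tensorLift
      (biadd (fun m n => tmul (φ m) (ψ n))
        (fun a b n => by rw [map_add, add_tmul]) (fun m a b => by rw [map_add, tmul_add]))
      (fun f m n => by simp only [biadd_apply, map_smul, tmul_fun_smul]))
    (fun f x => by
      induction x using tensor_induction with
      | h0 => simp only [smul_zero, map_zero]
      | ht m n =>
        simp only [fun_smul_tmul, tensorLift_tmul, biadd_apply, map_smul]
      | hadd x y hx hy => rw [smul_add, map_add, hx, hy, map_add, smul_add])
    (fun θ x => by
      induction x using tensor_induction with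
      | h0 => simp only [smul_zero, map_zero]
      | ht m n =>
        simp only [der_smul_tmul, tensorLift_tmul, biadd_apply, map_smul, map_add]
      | hadd x y hx hy => rw [smul_add, map_add, hx, hy, map_add, smul_add])

theorem tensorMap_tmul (φ : M →ₗ[DiffOp k O] M') (ψ : N →ₗ[DiffOp k O] N') (m : M) (n : N) :
    tensorMap φ ψ (tmul m n) = tmul (φ m) (ψ n) := rfl

/-! ### Differential graded `𝒟`-modules, algebras and modules -/

variable (k O) in
/-- Differential non-negatively graded `𝒟`-modules: chain complexes of left `𝒟`-modules. -/
abbrev DGDM : Type (u + 1) := ChainComplex (ModuleCat.{u} (DiffOp k O)) ℕ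

variable (k O) in
/-- A differential non-negatively graded `𝒟`-algebra, i.e. a commutative monoid in the symmetric
monoidal category of differential graded `𝒟`-modules with tensor product over `O` and the Koszul
sign rule. `mul p q n` is the multiplication `A_p × A_q → A_n`; it is zero unless `p + q = n`.
The axioms `mul_fun`, `fun_mul`, `der_mul` say that it is a `𝒟`-linear map on `A_p ⊗_O A_q`,
and `der_one` that `f ↦ f • 1` is a `𝒟`-linear map `O → A_0`. -/
structure DGAlg where
  /-- the underlying complex of `𝒟`-modules -/
  X : DGDM k O
  /-- the multiplication -/
  mul (p q n : ℕ) : X.X p →+ X.X q →+ X.X n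
  /-- the unit -/
  one : X.X 0
  mul_shape : ∀ p q n, p + q ≠ n → mul p q n = 0
  fun_mul : ∀ p q n (f : O) (a : X.X p) (b : X.X q),
    mul p q n (DiffOp.ofFun k f • a) b = DiffOp.ofFun k f • mul p q n a b
  mul_fun : ∀ p q n (f : O) (a : X.X p) (b : X.X q),
    mul p q n a (DiffOp.ofFun k f • b) = DiffOp.ofFun k f • mul p q n a b
  der_mul : ∀ p q n (θ : Derivation k O O) (a : X.X p) (b : X.X q),
    DiffOp.ofDer θ • mul p q n a b =
      mul p q n (DiffOp.ofDer θ • a) b + mul p q n a (DiffOp.ofDer θ • b)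
  der_one : ∀ θ : Derivation k O O, DiffOp.ofDer θ • one = 0
  d_mul : ∀ p q n, p + q = n → ∀ (a : X.X p) (b : X.X q),
    (X.d n (n - 1)).hom (mul p q n a b) =
      mul (p - 1) q (n - 1) ((X.d p (p - 1)).hom a) b +
        (-1 : ℤ) ^ p • mul p (q - 1) (n - 1) a ((X.d q (q - 1)).hom b)
  one_mul : ∀ n (a : X.X n), mul 0 n n one a = a
  mul_assoc : ∀ p q r s t n, p + q = s → q + r = t → s + r = n →
    ∀ (a : X.X p) (b : X.X q) (c : X.X r),
      mul s r n (mul p q s a b) c = mul p t n a (mul q r t b c)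
  mul_comm : ∀ p q n, p + q = n → ∀ (a : X.X p) (b : X.X q),
    mul p q n a b = (-1 : ℤ) ^ (p * q) • mul q p n b a

/-- A (left) module over `A` in the category of differential graded `𝒟`-modules.
`act p q n` is the action `A_p × X_q → X_n`; it is zero unless `p + q = n`. -/
structure DGMod (A : DGAlg k O) where
  /-- the underlying complex of `𝒟`-modules -/
  X : DGDM k O
  /-- the action of `A` -/
  act (p q n : ℕ) : A.X.X p →+ X.X q →+ X.X n
  act_shape : ∀ p q n, p + q ≠ n → act p q n = 0
  fun_act : ∀ p q n (f : O) (a : A.X.X p) (x : X.X q),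
    act p q n (DiffOp.ofFun k f • a) x = DiffOp.ofFun k f • act p q n a x
  act_fun : ∀ p q n (f : O) (a : A.X.X p) (x : X.X q),
    act p q n a (DiffOp.ofFun k f • x) = DiffOp.ofFun k f • act p q n a x
  der_act : ∀ p q n (θ : Derivation k O O) (a : A.X.X p) (x : X.X q),
    DiffOp.ofDer θ • act p q n a x =
      act p q n (DiffOp.ofDer θ • a) x + act p q n a (DiffOp.ofDer θ • x)
  d_act : ∀ p q n, p + q = n → ∀ (a : A.X.X p) (x : X.X q),
    (X.d n (n - 1)).hom (act p q n a x) =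
      act (p - 1) q (n - 1) ((A.X.d p (p - 1)).hom a) x +
        (-1 : ℤ) ^ p • act p (q - 1) (n - 1) a ((X.d q (q - 1)).hom x)
  one_act : ∀ n (x : X.X n), act 0 n n A.one x = x
  act_act : ∀ p q r s t n, p + q = s → q + r = t → s + r = n →
    ∀ (a : A.X.X p) (b : A.X.X q) (x : X.X r),
      act s r n (A.mul p q s a b) x = act p t n a (act q r t b x)

namespace DGMod

variable {A : DGAlg k O}

/-- Morphisms of `A`-modules: chain maps of `𝒟`-modules that commute with the action of `A`. -/
@[ext]
structure Hom (M N : DGMod A) where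
  /-- the underlying chain map -/
  hom : M.X ⟶ N.X
  map_act : ∀ p q n (a : A.X.X p) (x : M.X.X q),
    (hom.f n).hom (M.act p q n a x) = N.act p q n a ((hom.f q).hom x)

noncomputable instance : Category (DGMod A) where
  Hom := Hom
  id M := ⟨𝟙 M.X, fun _ _ _ _ _ => rfl⟩
  comp f g := ⟨f.hom ≫ g.hom, fun p q n a x => by
    have h1 := f.map_act p q n a x
    have h2 := g.map_act p q n a ((f.hom.f q).hom x)
    rw [← h1] at h2
    exact h2⟩
  id_comp f := Hom.ext (Category.id_comp f.hom)
  comp_id f := Hom.ext (Category.comp_id f.hom)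
  assoc f g h := Hom.ext (Category.assoc f.hom g.hom h.hom)

/-- The zero module. -/
noncomputable def zeroMod (A : DGAlg k O) : DGMod A where
  X :=
    { X := fun _ => ModuleCat.of (DiffOp k O) PUnit.{u + 1}
      d := fun _ _ => 0
      shape := fun _ _ _ => rfl
      d_comp_d' := fun _ _ _ _ _ => zero_comp }
  act _ _ _ := 0
  act_shape _ _ _ _ := rfl
  fun_act _ _ _ _ _ _ := Subsingleton.elim (α := PUnit) _ _
  act_fun _ _ _ _ _ _ := Subsingleton.elim (α := PUnit) _ _
  der_act _ _ _ _ _ _ := Subsingleton.elim (α := PUnit) _ _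
  d_act _ _ _ _ _ _ := Subsingleton.elim (α := PUnit) _ _
  one_act _ _ := Subsingleton.elim (α := PUnit) _ _
  act_act _ _ _ _ _ _ _ _ _ _ _ _ := Subsingleton.elim (α := PUnit) _ _

instance (n : ℕ) : Subsingleton ((zeroMod A).X.X n) := inferInstanceAs (Subsingleton PUnit)

theorem zeroMod_isZero : IsZero (zeroMod A) where
  unique_to M := ⟨{
    default := ⟨0, fun p q n a x => by
      have : x = 0 := Subsingleton.elim _ _
      subst this
      simp⟩
    uniq := fun f => Hom.ext (HomologicalComplex.hom_ext _ _ fun n => by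
      refine ModuleCat.hom_ext (LinearMap.ext fun x => ?_)
      have : x = 0 := Subsingleton.elim _ _
      subst this
      simp) }⟩
  unique_from M := ⟨{
    default := ⟨0, fun p q n a x => Subsingleton.elim _ _⟩
    uniq := fun f => Hom.ext (HomologicalComplex.hom_ext _ _ fun n =>
      ModuleCat.hom_ext (LinearMap.ext fun x => Subsingleton.elim _ _)) }⟩

instance : HasZeroObject (DGMod A) := ⟨zeroMod A, zeroMod_isZero⟩

instance : HasInitial (DGMod A) := HasZeroObject.hasInitial

instance : HasTerminal (DGMod A) := HasZeroObject.hasTerminal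

end DGMod

/-! ### The tensor product over `A` -/

section TensorA

/-- The pairs of degrees of total degree `n`. -/
abbrev Idx (n : ℕ) : Type := {x : ℕ × ℕ // x.1 + x.2 = n}

variable (X Y : DGDM k O)

/-- The degree `n` part `⨁_{p + q = n} X_p ⊗_O Y_q` of `X ⊗_O Y`. -/
abbrev Tot (n : ℕ) : Type u := ⨁ i : Idx n, tensor (X.X i.1.1) (Y.X i.1.2)

/-- The inclusion of `X_p ⊗_O Y_q` in degree `n` of `X ⊗_O Y` (zero unless `p + q = n`). -/
noncomputable def totι (p q n : ℕ) : tensor (X.X p) (Y.X q) →ₗ[DiffOp k O] Tot X Y n :=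
  if h : p + q = n then
    DirectSum.lof (DiffOp k O) (Idx n) (fun i => tensor (X.X i.1.1) (Y.X i.1.2)) ⟨(p, q), h⟩
  else 0

variable {X Y}

/-- The element `x ⊗ y` of degree `n` of `X ⊗_O Y`, for `x` of degree `p`, `y` of degree `q`
with `p + q = n`. -/
noncomputable def tt (p q n : ℕ) (x : X.X p) (y : Y.X q) : Tot X Y n := totι X Y p q n (tmul x y)

theorem tt_shape (p q n : ℕ) (h : p + q ≠ n) (x : X.X p) (y : Y.X q) : tt p q n x y = 0 := by
  rw [tt, totι, dif_neg h]; rfl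

theorem tt_add (p q n : ℕ) (x : X.X p) (y y' : Y.X q) :
    tt p q n x (y + y') = tt p q n x y + tt p q n x y' := by
  rw [tt, tmul_add, map_add]; rfl

theorem add_tt (p q n : ℕ) (x x' : X.X p) (y : Y.X q) :
    tt p q n (x + x') y = tt p q n x y + tt p q n x' y := by
  rw [tt, add_tmul, map_add]; rfl

theorem fun_tt (p q n : ℕ) (f : O) (x : X.X p) (y : Y.X q) :
    DiffOp.ofFun k f • tt p q n x y = tt p q n (DiffOp.ofFun k f • x) y := by
  rw [tt, ← map_smul, fun_smul_tmul]; rfl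

theorem tt_fun (p q n : ℕ) (f : O) (x : X.X p) (y : Y.X q) :
    tt p q n x (DiffOp.ofFun k f • y) = tt p q n (DiffOp.ofFun k f • x) y := by
  rw [tt, tmul_fun_smul]; rfl

theorem der_tt (p q n : ℕ) (θ : Derivation k O O) (x : X.X p) (y : Y.X q) :
    DiffOp.ofDer θ • tt p q n x y =
      tt p q n (DiffOp.ofDer θ • x) y + tt p q n x (DiffOp.ofDer θ • y) := by
  rw [tt, ← map_smul, der_smul_tmul, map_add]; rfl

/-- `tt` as a biadditive map. -/
noncomputable def ttHom (X Y : DGDM k O) (p q n : ℕ) : X.X p →+ Y.X q →+ Tot X Y n :=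
  biadd (tt p q n) (add_tt p q n) (tt_add p q n)

theorem tot_induction {n : ℕ} {C : Tot X Y n → Prop} (h0 : C 0)
    (ht : ∀ p q, p + q = n → ∀ x y, C (tt p q n x y)) (hadd : ∀ x y, C x → C y → C (x + y))
    (z : Tot X Y n) : C z := by
  induction z using DirectSum.induction_on with
  | zero => exact h0
  | of i w =>
    obtain ⟨⟨p, q⟩, h⟩ := i
    induction w using tensor_induction with
    | h0 => rw [map_zero]; exact h0
    | ht m n' =>
      have := ht p q h m n'
      rw [tt, totι, dif_pos h] at this
      exact this
    | hadd x y hx hy => rw [map_add]; exact hadd _ _ hx hy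
  | add x y hx hy => exact hadd _ _ hx hy

/-- Additive maps out of the degree `n` part of `X ⊗_O Y`. -/
noncomputable def totLift {G : Type*} [AddCommGroup G] (n : ℕ) (b : ∀ p q, X.X p →+ Y.X q →+ G)
    (hb : ∀ p q (f : O) x y, b p q (DiffOp.ofFun k f • x) y = b p q x (DiffOp.ofFun k f • y)) :
    Tot X Y n →+ G :=
  DirectSum.toAddMonoid fun i => tensorLift (b i.1.1 i.1.2) (hb i.1.1 i.1.2)

theorem totLift_tt {G : Type*} [AddCommGroup G] (n : ℕ) (b : ∀ p q, X.X p →+ Y.X q →+ G)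
    (hb : ∀ p q (f : O) x y, b p q (DiffOp.ofFun k f • x) y = b p q x (DiffOp.ofFun k f • y))
    (p q : ℕ) (h : p + q = n) (x : X.X p) (y : Y.X q) :
    totLift n b hb (tt p q n x y) = b p q x y := by
  rw [tt, totι, dif_pos h]
  exact DirectSum.toAddMonoid_of _ _ _

variable {A : DGAlg k O} (N M : DGMod A)

/-- The relation `(x ◁ a) ⊗ m = x ⊗ (a m)`, where `x ◁ a = (-1)^(|a||x|) a x`. -/
noncomputable def balancing (p r q n : ℕ) (x : N.X.X p) (a : A.X.X r) (m : M.X.X q) :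
    Tot N.X M.X n :=
  (-1 : ℤ) ^ (r * p) • tt (r + p) q n (N.act r p (r + p) a x) m -
    tt p (r + q) n x (M.act r q (r + q) a m)

/-- The `𝒟`-submodule of `N ⊗_O M` by which one divides to get `N ⊗_A M`: the image of
`N ⊗_O A ⊗_O M` under the difference of the two actions of `A`. -/
noncomputable def relSub (n : ℕ) : Submodule (DiffOp k O) (Tot N.X M.X n) :=
  Submodule.span (DiffOp k O)
    {z | ∃ p r q x a m, p + r + q = n ∧ z = balancing N M p r q n x a m}

/-- The degree `n` part of `N ⊗_A M`. -/
abbrev TensA (n : ℕ) : Type u := Tot N.X M.X n ⧸ relSub N M n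

variable {N M}

theorem mem_closure_of_mem_relSub {n : ℕ} {z : Tot N.X M.X n} (hz : z ∈ relSub N M n) :
    z ∈ AddSubgroup.closure
      {z | ∃ p r q x a m, p + r + q = n ∧ z = balancing N M p r q n x a m} := by
  set S := {z | ∃ p r q x a m, p + r + q = n ∧ z = balancing N M p r q n x a m} with hS
  have key : ∀ P : DiffOp k O, ∀ w ∈ AddSubgroup.closure S, P • w ∈ AddSubgroup.closure S := by
    intro P
    induction P using DiffOp.induction with
    | hf f =>
      intro w hw
      induction hw using AddSubgroup.closure_induction with
      | mem w hw =>
        obtain ⟨p, r, q, x, a, m, h, rfl⟩ := hw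
        apply AddSubgroup.subset_closure
        refine ⟨p, r, q, DiffOp.ofFun k f • x, a, m, h, ?_⟩
        simp only [balancing, smul_sub, smul_comm (DiffOp.ofFun k f) ((-1 : ℤ) ^ (r * p)), fun_tt,
          N.act_fun]
      | zero => rw [smul_zero]; exact zero_mem _
      | add x y _ _ hx hy => rw [smul_add]; exact add_mem hx hy
      | neg x _ hx => rw [smul_neg]; exact neg_mem hx
    | hd θ =>
      intro w hw
      induction hw using AddSubgroup.closure_induction with
      | mem w hw =>
        obtain ⟨p, r, q, x, a, m, h, rfl⟩ := hw
        have : DiffOp.ofDer θ • balancing N M p r q n x a m =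
            balancing N M p r q n (DiffOp.ofDer θ • x) a m +
            balancing N M p r q n x (DiffOp.ofDer θ • a) m +
            balancing N M p r q n x a (DiffOp.ofDer θ • m) := by
          simp only [balancing, smul_sub, smul_comm (DiffOp.ofDer θ) ((-1 : ℤ) ^ (r * p)), der_tt,
            N.der_act, M.der_act, tt_add, add_tt, smul_add]
          abel
        rw [this]
        exact add_mem (add_mem (AddSubgroup.subset_closure ⟨_, _, _, _, _, _, h, rfl⟩)
          (AddSubgroup.subset_closure ⟨_, _, _, _, _, _, h, rfl⟩))
          (AddSubgroup.subset_closure ⟨_, _, _, _, _, _, h, rfl⟩)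
      | zero => rw [smul_zero]; exact zero_mem _
      | add x y _ _ hx hy => rw [smul_add]; exact add_mem hx hy
      | neg x _ hx => rw [smul_neg]; exact neg_mem hx
    | hmul P Q hP hQ => intro w hw; rw [mul_smul]; exact hP _ (hQ _ hw)
    | hadd P Q hP hQ => intro w hw; rw [add_smul]; exact add_mem (hP _ hw) (hQ _ hw)
    | hneg P hP => intro w hw; rw [neg_smul]; exact neg_mem (hP _ hw)
  induction hz using Submodule.span_induction with
  | mem w hw => exact AddSubgroup.subset_closure hw
  | zero => exact zero_mem _
  | add x y _ _ hx hy => exact add_mem hx hy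
  | smul P x _ hx => exact key P x hx

/-- The class in `N ⊗_A M` of `x ⊗ m`. -/
noncomputable def ta (p q n : ℕ) (x : N.X.X p) (m : M.X.X q) : TensA N M n :=
  (relSub N M n).mkQ (tt p q n x m)

theorem ta_shape (p q n : ℕ) (h : p + q ≠ n) (x : N.X.X p) (m : M.X.X q) : ta p q n x m = 0 := by
  rw [ta, tt_shape p q n h, map_zero]

theorem ta_add (p q n : ℕ) (x : N.X.X p) (y y' : M.X.X q) :
    ta p q n x (y + y') = ta p q n x y + ta p q n x y' := by
  rw [ta, tt_add, map_add]; rfl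

theorem add_ta (p q n : ℕ) (x x' : N.X.X p) (y : M.X.X q) :
    ta p q n (x + x') y = ta p q n x y + ta p q n x' y := by
  rw [ta, add_tt, map_add]; rfl

/-- `ta` as a biadditive map. -/
noncomputable def taHom (N M : DGMod A) (p q n : ℕ) : N.X.X p →+ M.X.X q →+ TensA N M n :=
  biadd (ta p q n) (add_ta p q n) (ta_add p q n)

theorem taHom_apply (p q n : ℕ) (x : N.X.X p) (m : M.X.X q) :
    taHom N M p q n x m = ta p q n x m := rfl

theorem ta_zero (p q n : ℕ) (x : N.X.X p) : ta (M := M) p q n x 0 = 0 :=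
  map_zero (taHom N M p q n x)

theorem zero_ta (p q n : ℕ) (m : M.X.X q) : ta (N := N) p q n 0 m = 0 := by
  rw [← taHom_apply, map_zero]; rfl

theorem ta_zsmul (p q n : ℕ) (c : ℤ) (x : N.X.X p) (m : M.X.X q) :
    ta p q n x (c • m) = c • ta p q n x m :=
  map_zsmul (taHom N M p q n x) c m

theorem zsmul_ta (p q n : ℕ) (c : ℤ) (x : N.X.X p) (m : M.X.X q) :
    ta p q n (c • x) m = c • ta p q n x m := by
  rw [← taHom_apply, map_zsmul]; rfl

theorem fun_ta (p q n : ℕ) (f : O) (x : N.X.X p) (y : M.X.X q) :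
    DiffOp.ofFun k f • ta p q n x y = ta p q n (DiffOp.ofFun k f • x) y := by
  rw [ta, ← map_smul, fun_tt]; rfl

theorem ta_fun (p q n : ℕ) (f : O) (x : N.X.X p) (y : M.X.X q) :
    ta p q n x (DiffOp.ofFun k f • y) = ta p q n (DiffOp.ofFun k f • x) y := by
  rw [ta, tt_fun]; rfl

theorem der_ta (p q n : ℕ) (θ : Derivation k O O) (x : N.X.X p) (y : M.X.X q) :
    DiffOp.ofDer θ • ta p q n x y =
      ta p q n (DiffOp.ofDer θ • x) y + ta p q n x (DiffOp.ofDer θ • y) := by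
  rw [ta, ← map_smul, der_tt, map_add]; rfl

theorem ta_balanced (p r q s t n : ℕ) (hs : r + p = s) (ht : r + q = t)
    (x : N.X.X p) (a : A.X.X r) (m : M.X.X q) :
    (-1 : ℤ) ^ (r * p) • ta s q n (N.act r p s a x) m = ta p t n x (M.act r q t a m) := by
  subst hs ht
  by_cases h : p + r + q = n
  · rw [ta, ta, ← map_zsmul, ← sub_eq_zero, ← map_sub]
    rw [Submodule.mkQ_apply, Submodule.Quotient.mk_eq_zero]
    exact Submodule.subset_span ⟨p, r, q, x, a, m, h, rfl⟩
  · rw [ta_shape _ _ _ (by omega), ta_shape _ _ _ (by omega), smul_zero]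

theorem ta_induction {n : ℕ} {C : TensA N M n → Prop} (h0 : C 0)
    (ht : ∀ p q, p + q = n → ∀ x y, C (ta p q n x y)) (hadd : ∀ x y, C x → C y → C (x + y))
    (z : TensA N M n) : C z := by
  obtain ⟨w, rfl⟩ := (relSub N M n).mkQ_surjective z
  induction w using tot_induction with
  | h0 => rw [map_zero]; exact h0
  | ht p q h x y => exact ht p q h x y
  | hadd x y hx hy => rw [map_add]; exact hadd _ _ hx hy

/-- The universal property of `N ⊗_A M` for additive maps. -/
noncomputable def taLift {G : Type*} [AddCommGroup G] (n : ℕ) (b : ∀ p q, N.X.X p →+ M.X.X q →+ G)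
    (hb : ∀ p q (f : O) x y, b p q (DiffOp.ofFun k f • x) y = b p q x (DiffOp.ofFun k f • y))
    (hA : ∀ p r q, p + r + q = n → ∀ x (a : A.X.X r) m,
      (-1 : ℤ) ^ (r * p) • b (r + p) q (N.act r p (r + p) a x) m =
        b p (r + q) x (M.act r q (r + q) a m)) :
    TensA N M n →+ G :=
  QuotientAddGroup.lift (relSub N M n).toAddSubgroup (totLift n b hb) (by
    intro z hz
    refine (AddSubgroup.closure_le _).2 ?_ (mem_closure_of_mem_relSub hz)
    rintro w ⟨p, r, q, x, a, m, h, rfl⟩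
    change totLift n b hb _ = 0
    rw [balancing, map_sub, map_zsmul, totLift_tt n b hb _ _ (by omega),
      totLift_tt n b hb _ _ (by omega), hA p r q h, sub_self])

theorem taLift_ta {G : Type*} [AddCommGroup G] (n : ℕ) (b : ∀ p q, N.X.X p →+ M.X.X q →+ G)
    (hb : ∀ p q (f : O) x y, b p q (DiffOp.ofFun k f • x) y = b p q x (DiffOp.ofFun k f • y))
    (hA : ∀ p r q, p + r + q = n → ∀ x (a : A.X.X r) m,
      (-1 : ℤ) ^ (r * p) • b (r + p) q (N.act r p (r + p) a x) m =
        b p (r + q) x (M.act r q (r + q) a m))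
    (p q : ℕ) (h : p + q = n) (x : N.X.X p) (m : M.X.X q) :
    taLift n b hb hA (ta p q n x m) = b p q x m :=
  totLift_tt n b hb p q h x m

/-- Two additive maps out of `N ⊗_A M` agreeing on decomposed tensors agree. -/
theorem ta_ext {G : Type*} [AddCommGroup G] {n : ℕ} {φ ψ : TensA N M n →+ G}
    (h : ∀ p q, p + q = n → ∀ x m, φ (ta p q n x m) = ψ (ta p q n x m)) : φ = ψ := by
  refine AddMonoidHom.ext fun z => ?_
  induction z using ta_induction with
  | h0 => rw [map_zero, map_zero]
  | ht p q hpq x y => exact h p q hpq x y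
  | hadd x y hx hy => rw [map_add, map_add, hx, hy]

/-- A `𝒟`-linear map out of `N ⊗_A M`. -/
noncomputable def taLiftD {G : Type u} [AddCommGroup G] [Module (DiffOp k O) G] (n : ℕ)
    (b : ∀ p q, N.X.X p →+ M.X.X q →+ G)
    (hf : ∀ p q (f : O) x y, b p q (DiffOp.ofFun k f • x) y = DiffOp.ofFun k f • b p q x y)
    (hf' : ∀ p q (f : O) x y, b p q x (DiffOp.ofFun k f • y) = DiffOp.ofFun k f • b p q x y)
    (hd : ∀ p q (θ : Derivation k O O) x y, DiffOp.ofDer θ • b p q x y =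
      b p q (DiffOp.ofDer θ • x) y + b p q x (DiffOp.ofDer θ • y))
    (hA : ∀ p r q, p + r + q = n → ∀ x (a : A.X.X r) m,
      (-1 : ℤ) ^ (r * p) • b (r + p) q (N.act r p (r + p) a x) m =
        b p (r + q) x (M.act r q (r + q) a m)) :
    TensA N M n →ₗ[DiffOp k O] G :=
  linD (taLift n b (fun p q f x y => by rw [hf, hf']) hA)
    (fun f z => by
      induction z using ta_induction with
      | h0 => simp only [smul_zero, map_zero]
      | ht p q h x y => rw [fun_ta, taLift_ta _ _ _ _ _ _ h, taLift_ta _ _ _ _ _ _ h, hf]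
      | hadd x y hx hy => rw [smul_add, map_add, hx, hy, map_add, smul_add])
    (fun θ z => by
      induction z using ta_induction with
      | h0 => simp only [smul_zero, map_zero]
      | ht p q h x y =>
        rw [der_ta, map_add, taLift_ta _ _ _ _ _ _ h, taLift_ta _ _ _ _ _ _ h,
          taLift_ta _ _ _ _ _ _ h, hd]
      | hadd x y hx hy => rw [smul_add, map_add, hx, hy, map_add, smul_add])

theorem taLiftD_ta {G : Type u} [AddCommGroup G] [Module (DiffOp k O) G] (n : ℕ)
    (b : ∀ p q, N.X.X p →+ M.X.X q →+ G)
    (hf : ∀ p q (f : O) x y, b p q (DiffOp.ofFun k f • x) y = DiffOp.ofFun k f • b p q x y)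
    (hf' : ∀ p q (f : O) x y, b p q x (DiffOp.ofFun k f • y) = DiffOp.ofFun k f • b p q x y)
    (hd : ∀ p q (θ : Derivation k O O) x y, DiffOp.ofDer θ • b p q x y =
      b p q (DiffOp.ofDer θ • x) y + b p q x (DiffOp.ofDer θ • y))
    (hA : ∀ p r q, p + r + q = n → ∀ x (a : A.X.X r) m,
      (-1 : ℤ) ^ (r * p) • b (r + p) q (N.act r p (r + p) a x) m =
        b p (r + q) x (M.act r q (r + q) a m))
    (p q : ℕ) (h : p + q = n) (x : N.X.X p) (m : M.X.X q) :
    taLiftD n b hf hf' hd hA (ta p q n x m) = b p q x m :=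
  taLift_ta n b (fun p q f x y => by rw [hf, hf']) hA p q h x m

/-- `d (x ⊗ m) = d x ⊗ m + (-1)^|x| x ⊗ d m`. -/
noncomputable def taDiffFun (N M : DGMod A) (j p q : ℕ) : N.X.X p →+ M.X.X q →+ TensA N M j :=
  biadd (fun x m => ta (p - 1) q j ((N.X.d p (p - 1)).hom x) m +
      (-1 : ℤ) ^ p • ta p (q - 1) j x ((M.X.d q (q - 1)).hom m))
    (fun a b m => by simp only [map_add, add_ta, smul_add]; abel)
    (fun x a b => by simp only [map_add, ta_add, smul_add]; abel)

theorem taDiffFun_apply (j p q : ℕ) (x : N.X.X p) (m : M.X.X q) :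
    taDiffFun N M j p q x m = ta (p - 1) q j ((N.X.d p (p - 1)).hom x) m +
      (-1 : ℤ) ^ p • ta p (q - 1) j x ((M.X.d q (q - 1)).hom m) := rfl

theorem dgd_zero (X : DGDM k O) (x : X.X 0) : (X.d 0 (0 - 1)).hom x = 0 := by
  rw [X.shape 0 (0 - 1) (by simp)]; rfl

theorem dgd_dgd (X : DGDM k O) (i j l : ℕ) (x : X.X i) : (X.d j l).hom ((X.d i j).hom x) = 0 := by
  have := X.d_comp_d i j l
  exact congrArg (fun φ => φ.hom x) this

theorem taDiff_balanced (j p r q : ℕ) (x : N.X.X p) (a : A.X.X r) (m : M.X.X q) :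
    (-1 : ℤ) ^ (r * p) • taDiffFun N M j (r + p) q (N.act r p (r + p) a x) m =
      taDiffFun N M j p (r + q) x (M.act r q (r + q) a m) := by
  rw [taDiffFun_apply, taDiffFun_apply, N.d_act r p _ rfl, M.d_act r q _ rfl]
  simp only [add_ta, ta_add, zsmul_ta, ta_zsmul, smul_add]
  have e1 : (-1 : ℤ) ^ (r * p) •
      ta (r + p - 1) q j (N.act (r - 1) p (r + p - 1) ((A.X.d r (r - 1)).hom a) x) m =
      (-1 : ℤ) ^ p •
        ta p (r + q - 1) j x (M.act (r - 1) q (r + q - 1) ((A.X.d r (r - 1)).hom a) m) := by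
    rcases r with _ | r
    · simp only [dgd_zero, map_zero, AddMonoidHom.zero_apply, ta_zero, zero_ta, smul_zero]
    · rw [← ta_balanced p (r + 1 - 1) q (r + 1 + p - 1) _ _ (by omega) (by omega), smul_smul,
        ← pow_add]
      congr 1
      rw [Nat.add_sub_cancel]
      ring
  have e2 : (-1 : ℤ) ^ (r * p) • (-1 : ℤ) ^ r •
      ta (r + p - 1) q j (N.act r (p - 1) (r + p - 1) a ((N.X.d p (p - 1)).hom x)) m =
      ta (p - 1) (r + q) j ((N.X.d p (p - 1)).hom x) (M.act r q (r + q) a m) := by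
    rcases p with _ | p
    · simp only [dgd_zero, map_zero, zero_ta, smul_zero]
    · rw [← ta_balanced (p + 1 - 1) r q (r + (p + 1) - 1) _ _ (by omega) rfl, smul_smul,
        ← pow_add]
      congr 1
      rw [Nat.add_sub_cancel, mul_add, mul_one, add_assoc, pow_add, ← two_mul, pow_mul (-1) 2 r]
      simp
  have e3 : (-1 : ℤ) ^ (r * p) • (-1 : ℤ) ^ (r + p) •
      ta (r + p) (q - 1) j (N.act r p (r + p) a x) ((M.X.d q (q - 1)).hom m) =
      (-1 : ℤ) ^ p • (-1 : ℤ) ^ r •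
        ta p (r + q - 1) j x (M.act r (q - 1) (r + q - 1) a ((M.X.d q (q - 1)).hom m)) := by
    rcases q with _ | q
    · simp only [dgd_zero, map_zero, ta_zero, smul_zero]
    · rw [← ta_balanced p r (q + 1 - 1) (r + p) (r + (q + 1) - 1) _ rfl (by omega)]
      simp only [smul_smul, ← pow_add]
      congr 2
      ring
  rw [e1, e2, e3]
  abel

/-- The differential of `N ⊗_A M`. -/
noncomputable def taDiff (N M : DGMod A) (i j : ℕ) :
    TensA N M i →ₗ[DiffOp k O] TensA N M j :=
  taLiftD i (taDiffFun N M j)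
    (fun p q f x y => by
      simp only [taDiffFun_apply, map_smul, smul_add, fun_ta,
        smul_comm (DiffOp.ofFun k f) ((-1 : ℤ) ^ p)])
    (fun p q f x y => by
      simp only [taDiffFun_apply, map_smul, smul_add, fun_ta, ta_fun,
        smul_comm (DiffOp.ofFun k f) ((-1 : ℤ) ^ p)])
    (fun p q θ x y => by
      simp only [taDiffFun_apply, map_smul, smul_add, der_ta,
        smul_comm (DiffOp.ofDer θ) ((-1 : ℤ) ^ p)]
      abel)
    (fun p r q _ x a m => taDiff_balanced j p r q x a m)

theorem taDiff_ta (i j p q : ℕ) (h : p + q = i) (x : N.X.X p) (m : M.X.X q) :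
    taDiff N M i j (ta p q i x m) = ta (p - 1) q j ((N.X.d p (p - 1)).hom x) m +
      (-1 : ℤ) ^ p • ta p (q - 1) j x ((M.X.d q (q - 1)).hom m) :=
  taLiftD_ta i _ _ _ _ _ p q h x m

theorem taDiff_shape (i j : ℕ) (h : j + 1 ≠ i) : taDiff N M i j = 0 := by
  refine LinearMap.toAddMonoidHom_injective (ta_ext fun p q hpq x m => ?_)
  refine (taDiff_ta i j p q hpq x m).trans ?_
  have h1 : ta (M := M) (p - 1) q j ((N.X.d p (p - 1)).hom x) m = 0 := by
    rcases p with _ | p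
    · rw [dgd_zero, zero_ta]
    · exact ta_shape _ _ _ (by omega) _ _
  have h2 : ta (N := N) p (q - 1) j x ((M.X.d q (q - 1)).hom m) = 0 := by
    rcases q with _ | q
    · rw [dgd_zero, ta_zero]
    · exact ta_shape _ _ _ (by omega) _ _
  rw [h1, h2, smul_zero, add_zero]
  rfl

theorem taDiff_taDiff (i j l : ℕ) (h : j + 1 = i) (z : TensA N M i) :
    taDiff N M j l (taDiff N M i j z) = 0 := by
  induction z using ta_induction with
  | h0 => simp only [map_zero]
  | hadd x y hx hy => rw [map_add, map_add, hx, hy, add_zero]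
  | ht p q hpq x m =>
    rw [taDiff_ta i j p q hpq, map_add, map_zsmul]
    rcases p with _ | p
    · rcases q with _ | q
      · omega
      · rw [dgd_zero, zero_ta, map_zero, taDiff_ta j l _ _ (by omega), dgd_zero, dgd_dgd, zero_ta,
          ta_zero]
        simp only [smul_zero, add_zero]
    · rw [taDiff_ta j l _ _ (by omega), dgd_dgd, zero_ta]
      rcases q with _ | q
      · simp only [dgd_zero, ta_zero, map_zero, smul_zero, add_zero]
      · rw [taDiff_ta j l _ _ (by omega), dgd_dgd, ta_zero]
        simp only [Nat.add_sub_cancel, smul_zero, add_zero, zero_add, pow_succ, mul_neg, mul_one,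
          neg_smul, add_neg_cancel]

/-- `a (x ⊗ m) = (a x) ⊗ m`. -/
noncomputable def taActFun (N M : DGMod A) (s n : ℕ) (a : A.X.X s) (p q : ℕ) :
    N.X.X p →+ M.X.X q →+ TensA N M n :=
  biadd (fun x m => ta (s + p) q n (N.act s p (s + p) a x) m)
    (fun x y m => by rw [map_add, add_ta]) (fun x m m' => by rw [ta_add])

/-- The action of an element of `A` on `N ⊗_A M`. -/
noncomputable def taActElt (N M : DGMod A) (s t n : ℕ) (a : A.X.X s) :
    TensA N M t →+ TensA N M n :=
  taLift t (taActFun N M s n a)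
    (fun p q f x y => by simp only [taActFun, biadd_apply, N.act_fun, ta_fun])
    (fun p r q h x b m => by
      simp only [taActFun, biadd_apply]
      rw [← ta_balanced (s + p) r q (r + (s + p)) _ _ rfl rfl,
        ← N.act_act s r p (s + r) (r + p) _ rfl rfl (by omega),
        A.mul_comm s r _ rfl, map_zsmul, AddMonoidHom.zsmul_apply,
        N.act_act r s p (s + r) (s + p) (s + (r + p)) (by omega) rfl (by omega), zsmul_ta, smul_smul]
      have : s + (r + p) = r + (s + p) := by omega
      rw [this, ← pow_add]
      congr 1
      ring)

theorem taActElt_ta (s t n p q : ℕ) (h : p + q = t) (a : A.X.X s) (x : N.X.X p) (m : M.X.X q) :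
    taActElt N M s t n a (ta p q t x m) = ta (s + p) q n (N.act s p (s + p) a x) m :=
  taLift_ta t _ _ _ p q h x m

/-- The action of `A` on `N ⊗_A M`. -/
noncomputable def taAct (N M : DGMod A) (s t n : ℕ) :
    A.X.X s →+ TensA N M t →+ TensA N M n :=
  AddMonoidHom.mk' (taActElt N M s t n) (fun a b => ta_ext fun p q h x m => by
    rw [AddMonoidHom.add_apply, taActElt_ta s t n p q h, taActElt_ta s t n p q h,
      taActElt_ta s t n p q h, map_add, AddMonoidHom.add_apply, add_ta])

theorem taAct_ta (s t n p q r : ℕ) (h : p + q = t) (hr : s + p = r) (a : A.X.X s) (x : N.X.X p)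
    (m : M.X.X q) :
    taAct N M s t n a (ta p q t x m) = ta r q n (N.act s p r a x) m := by
  subst hr
  exact taActElt_ta s t n p q h a x m

theorem taAct_shape (s t n : ℕ) (h : s + t ≠ n) : taAct N M s t n = 0 := by
  refine AddMonoidHom.ext fun a => ta_ext fun p q hpq x m => ?_
  refine (taAct_ta s t n p q _ hpq rfl a x m).trans ?_
  exact ta_shape _ _ _ (by omega) _ _

theorem fun_taAct (s t n : ℕ) (f : O) (a : A.X.X s) (z : TensA N M t) :
    taAct N M s t n (DiffOp.ofFun k f • a) z = DiffOp.ofFun k f • taAct N M s t n a z := by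
  induction z using ta_induction with
  | h0 => simp only [map_zero, smul_zero]
  | hadd x y hx hy => rw [map_add, map_add, hx, hy, smul_add]
  | ht p q h x m =>
    rw [taAct_ta s t n p q _ h rfl, taAct_ta s t n p q _ h rfl, N.fun_act, fun_ta]

theorem taAct_fun (s t n : ℕ) (f : O) (a : A.X.X s) (z : TensA N M t) :
    taAct N M s t n a (DiffOp.ofFun k f • z) = DiffOp.ofFun k f • taAct N M s t n a z := by
  induction z using ta_induction with
  | h0 => simp only [map_zero, smul_zero]
  | hadd x y hx hy => rw [map_add, smul_add, map_add, hx, hy, smul_add]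
  | ht p q h x m =>
    rw [fun_ta, taAct_ta s t n p q _ h rfl, taAct_ta s t n p q _ h rfl, N.act_fun, fun_ta]

theorem der_taAct (s t n : ℕ) (θ : Derivation k O O) (a : A.X.X s) (z : TensA N M t) :
    DiffOp.ofDer θ • taAct N M s t n a z =
      taAct N M s t n (DiffOp.ofDer θ • a) z + taAct N M s t n a (DiffOp.ofDer θ • z) := by
  induction z using ta_induction with
  | h0 => simp only [map_zero, smul_zero, add_zero]
  | hadd x y hx hy =>
    simp only [map_add, smul_add, hx, hy]
    abel
  | ht p q h x m =>
    rw [der_ta, map_add]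
    simp only [taAct_ta s t n p q _ h rfl]
    rw [der_ta, N.der_act, add_ta]
    abel

theorem d_taAct (s t n : ℕ) (hn : s + t = n) (a : A.X.X s) (z : TensA N M t) :
    taDiff N M n (n - 1) (taAct N M s t n a z) =
      taAct N M (s - 1) t (n - 1) ((A.X.d s (s - 1)).hom a) z +
        (-1 : ℤ) ^ s • taAct N M s (t - 1) (n - 1) a (taDiff N M t (t - 1) z) := by
  induction z using ta_induction with
  | h0 => simp only [map_zero, smul_zero, add_zero]
  | hadd x y hx hy =>
    simp only [map_add, smul_add, hx, hy]
    abel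
  | ht p q h x m =>
    rw [taAct_ta s t n p q _ h rfl, taDiff_ta _ _ _ _ (by omega), taDiff_ta _ _ _ _ h, map_add,
      map_zsmul, N.d_act s p _ rfl, add_ta, zsmul_ta, smul_add, smul_smul, ← pow_add, add_assoc]
    have e1 : ta (M := M) (s + p - 1) q (n - 1)
          (N.act (s - 1) p (s + p - 1) ((A.X.d s (s - 1)).hom a) x) m =
        taAct N M (s - 1) t (n - 1) ((A.X.d s (s - 1)).hom a) (ta p q t x m) := by
      rcases s with _ | s
      · simp only [dgd_zero, map_zero, AddMonoidHom.zero_apply, zero_ta]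
      · rw [taAct_ta _ _ _ p q (s + 1 + p - 1) h (by omega)]
    have e2 : ta (M := M) (s + p - 1) q (n - 1)
          (N.act s (p - 1) (s + p - 1) a ((N.X.d p (p - 1)).hom x)) m =
        taAct N M s (t - 1) (n - 1) a (ta (p - 1) q (t - 1) ((N.X.d p (p - 1)).hom x) m) := by
      rcases p with _ | p
      · simp only [dgd_zero, map_zero, zero_ta]
      · rw [taAct_ta _ _ _ _ q (s + (p + 1) - 1) (by omega) (by omega)]
    have e3 : ta (N := N) (s + p) (q - 1) (n - 1) (N.act s p (s + p) a x)
          ((M.X.d q (q - 1)).hom m) =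
        taAct N M s (t - 1) (n - 1) a (ta p (q - 1) (t - 1) x ((M.X.d q (q - 1)).hom m)) := by
      rcases q with _ | q
      · simp only [dgd_zero, map_zero, ta_zero]
      · rw [taAct_ta _ _ _ _ _ (s + p) (by omega) rfl]
    rw [e1, e2, e3]

theorem one_taAct (n : ℕ) (z : TensA N M n) : taAct N M 0 n n A.one z = z := by
  induction z using ta_induction with
  | h0 => simp only [map_zero]
  | hadd x y hx hy => rw [map_add, hx, hy]
  | ht p q h x m => rw [taAct_ta 0 n n p q p h (zero_add p), N.one_act]

theorem taAct_taAct (p q r s t n : ℕ) (hs : p + q = s) (ht : q + r = t) (_hn : s + r = n)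
    (a : A.X.X p) (b : A.X.X q) (z : TensA N M r) :
    taAct N M s r n (A.mul p q s a b) z = taAct N M p t n a (taAct N M q r t b z) := by
  induction z using ta_induction with
  | h0 => simp only [map_zero]
  | hadd x y hx hy => rw [map_add, map_add, map_add, hx, hy]
  | ht i j h x m =>
    rw [taAct_ta s r n i j (s + i) h rfl, taAct_ta q r t i j (q + i) h rfl,
      taAct_ta p t n (q + i) j (s + i) (by omega) (by omega),
      N.act_act p q i s (q + i) (s + i) hs rfl rfl]

/-- The tensor product `N ⊗_A M` of two `A`-modules. -/
noncomputable def tensorObj (N M : DGMod A) : DGMod A where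
  X :=
    { X := fun n => ModuleCat.of (DiffOp k O) (TensA N M n)
      d := fun i j => ModuleCat.ofHom (taDiff N M i j)
      shape := fun i j h => by
        rw [taDiff_shape i j h]; rfl
      d_comp_d' := fun i j l h _ =>
        ModuleCat.hom_ext (LinearMap.ext fun z => taDiff_taDiff i j l h z) }
  act := taAct N M
  act_shape := taAct_shape
  fun_act := fun_taAct
  act_fun := taAct_fun
  der_act := der_taAct
  d_act := d_taAct
  one_act := one_taAct
  act_act := taAct_taAct

/-- The map `f ⊗ M` in degree `n`, for a morphism `f : N ⟶ N'` of `A`-modules. -/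
noncomputable def taMap {N N' : DGMod A} (f : N ⟶ N') (M : DGMod A) (n : ℕ) :
    TensA N M n →ₗ[DiffOp k O] TensA N' M n :=
  taLiftD n
    (fun p q => biadd (fun x m => ta p q n ((f.hom.f p).hom x) m)
      (fun x y m => by rw [map_add, add_ta]) (fun x m m' => by rw [ta_add]))
    (fun p q f x y => by simp only [biadd_apply, map_smul, fun_ta])
    (fun p q f x y => by simp only [biadd_apply, fun_ta, ta_fun])
    (fun p q θ x y => by simp only [biadd_apply, map_smul, der_ta])
    (fun p r q h x a m => by
      simp only [biadd_apply]
      rw [f.map_act, ta_balanced p r q _ _ n rfl rfl])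

theorem taMap_ta {N N' : DGMod A} (f : N ⟶ N') (n p q : ℕ) (h : p + q = n) (x : N.X.X p)
    (m : M.X.X q) : taMap f M n (ta p q n x m) = ta p q n ((f.hom.f p).hom x) m :=
  taLiftD_ta n _ _ _ _ _ p q h x m

theorem hom_d {N N' : DGMod A} (f : N ⟶ N') (i j : ℕ) (x : N.X.X i) :
    (f.hom.f j).hom ((N.X.d i j).hom x) = (N'.X.d i j).hom ((f.hom.f i).hom x) :=
  congrArg (fun φ => φ.hom x) (f.hom.comm i j).symm

theorem taMap_taDiff {N N' : DGMod A} (f : N ⟶ N') (i j : ℕ) (z : TensA N M i) :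
    taDiff N' M i j (taMap f M i z) = taMap f M j (taDiff N M i j z) := by
  by_cases hij : j + 1 = i
  · induction z using ta_induction with
    | h0 => simp only [map_zero]
    | hadd x y hx hy => simp only [map_add, hx, hy]
    | ht p q h x m =>
      rw [taMap_ta f i p q h, taDiff_ta i j p q h, taDiff_ta i j p q h, map_add, map_zsmul,
        ← hom_d]
      have e1 : taMap f M j (ta (p - 1) q j ((N.X.d p (p - 1)).hom x) m) =
          ta (p - 1) q j ((f.hom.f (p - 1)).hom ((N.X.d p (p - 1)).hom x)) m := by
        rcases p with _ | p
        · simp only [dgd_zero, map_zero, zero_ta]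
        · exact taMap_ta f j _ q (by omega) _ m
      have e2 : taMap f M j (ta p (q - 1) j x ((M.X.d q (q - 1)).hom m)) =
          ta p (q - 1) j ((f.hom.f p).hom x) ((M.X.d q (q - 1)).hom m) := by
        rcases q with _ | q
        · simp only [dgd_zero, map_zero, ta_zero]
        · exact taMap_ta f j p _ (by omega) x _
      rw [e1, e2]
  · rw [taDiff_shape i j hij, taDiff_shape i j hij, LinearMap.zero_apply, LinearMap.zero_apply,
      map_zero]

theorem taMap_taAct {N N' : DGMod A} (f : N ⟶ N') (s t n : ℕ) (a : A.X.X s) (z : TensA N M t) :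
    taMap f M n (taAct N M s t n a z) = taAct N' M s t n a (taMap f M t z) := by
  by_cases hn : s + t = n
  · induction z using ta_induction with
    | h0 => simp only [map_zero]
    | hadd x y hx hy => simp only [map_add, hx, hy]
    | ht p q h x m =>
      rw [taMap_ta f t p q h, taAct_ta s t n p q _ h rfl, taAct_ta s t n p q _ h rfl,
        taMap_ta f n _ q (by omega), f.map_act]
  · rw [taAct_shape s t n hn, taAct_shape s t n hn]
    simp only [AddMonoidHom.zero_apply, map_zero]

/-- The morphism `f ⊗_A M`. -/
noncomputable def tensorObjMap {N N' : DGMod A} (f : N ⟶ N') (M : DGMod A) :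
    tensorObj N M ⟶ tensorObj N' M where
  hom :=
    { f := fun n => ModuleCat.ofHom (taMap f M n)
      comm' := fun i j _ => ModuleCat.hom_ext (LinearMap.ext fun z => taMap_taDiff f i j z) }
  map_act := taMap_taAct f

/-- The functor `- ⊗_A M`. -/
noncomputable def tensorFunctor (M : DGMod A) : DGMod A ⥤ DGMod A where
  obj N := tensorObj N M
  map f := tensorObjMap f M
  map_id N := DGMod.Hom.ext (HomologicalComplex.hom_ext _ _ fun n =>
    ModuleCat.hom_ext (LinearMap.toAddMonoidHom_injective (ta_ext fun p q h x m =>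
      taMap_ta (𝟙 N) n p q h x m)))
  map_comp {N N' N''} f g := DGMod.Hom.ext (HomologicalComplex.hom_ext _ _ fun n =>
    ModuleCat.hom_ext (LinearMap.toAddMonoidHom_injective (ta_ext fun p q h x m => by
      refine (taMap_ta (f ≫ g) n p q h x m).trans ?_
      refine Eq.symm ((congrArg (taMap g M n) (taMap_ta f n p q h x m)).trans ?_)
      exact taMap_ta g n p q h _ m)))

end TensorA

/-! ### The model structure on `A`-modules -/

namespace DGMod

variable {A : DGAlg k O}

/-- Weak equivalences are the quasi-isomorphisms. -/
noncomputable instance : CategoryWithWeakEquivalences (DGMod A) where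
  weakEquivalences _ _ f := QuasiIso f.hom

/-- Fibrations are the morphisms that are surjective in positive degrees. -/
noncomputable instance : CategoryWithFibrations (DGMod A) where
  fibrations _ _ f := ∀ n, 0 < n → Function.Surjective (f.hom.f n).hom

/-- Cofibrations are the morphisms with the left lifting property with respect to trivial
fibrations. -/
noncomputable instance : CategoryWithCofibrations (DGMod A) where
  cofibrations := (trivialFibrations (DGMod A)).llp

end DGMod

end DiffOp

/-! ### Model squares and homotopy fiber sequences -/

section ModelSquares

variable {C : Type*} [Category C] [CategoryWithWeakEquivalences C] [CategoryWithFibrations C]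

/-- A fibrant replacement of a cospan `Y ⟶ W ⟵ Z` (for one of the model structures on cospans with
objectwise weak equivalences, whose fibrant objects are the objectwise fibrant cospans in which
the first leg, resp. the second leg, resp. both legs are fibrations). -/
structure FibrantCospanReplacement [HasTerminal C] {Y Z W : C} (r : Y ⟶ W) (b : Z ⟶ W) where
  /-- the replacement of `Y` -/
  Y' : C
  /-- the replacement of `Z` -/
  Z' : C
  /-- the replacement of `W` -/
  W' : C
  /-- the first leg -/
  r' : Y' ⟶ W'
  /-- the second leg -/
  b' : Z' ⟶ W'
  /-- the weak equivalence from `Y` -/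
  y : Y ⟶ Y'
  /-- the weak equivalence from `Z` -/
  z : Z ⟶ Z'
  /-- the weak equivalence from `W` -/
  w : W ⟶ W'
  comm_r : y ≫ r' = r ≫ w
  comm_b : z ≫ b' = b ≫ w
  weq_y : WeakEquivalence y
  weq_z : WeakEquivalence z
  weq_w : WeakEquivalence w
  fibrant_Y : IsFibrant Y'
  fibrant_Z : IsFibrant Z'
  fibrant_W : IsFibrant W'
  fib_leg : Fibration r' ∨ Fibration b'

/-- The square with top side `t : X ⟶ Y`, left side `l : X ⟶ Z`, right side `r : Y ⟶ W` and
bottom side `b : Z ⟶ W` is a model square: it commutes, and for some fibrant replacement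
`Y' ⟶ W' ⟵ Z'` of the cospan `Y ⟶ W ⟵ Z` the universal map from `X` to the pullback
`Y' ×_{W'} Z'` is a weak equivalence. -/
def IsModelSquare [HasTerminal C] {X Y Z W : C} (t : X ⟶ Y) (l : X ⟶ Z) (r : Y ⟶ W)
    (b : Z ⟶ W) : Prop :=
  t ≫ r = l ≫ b ∧
    ∃ (R : FibrantCospanReplacement r b) (P : C) (fst : P ⟶ R.Y') (snd : P ⟶ R.Z')
      (_ : IsPullback fst snd R.r' R.b') (u : X ⟶ P),
      u ≫ fst = t ≫ R.y ∧ u ≫ snd = l ≫ R.z ∧ WeakEquivalence u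

/-- A model square whose lower left corner is weakly equivalent to the zero object, via the unique
map: this is a homotopy fiber sequence `X ⟶ Y ⟶ W`. -/
def IsHomotopyFiberSequence [HasTerminal C] {X Y Z W : C} (t : X ⟶ Y) (l : X ⟶ Z) (r : Y ⟶ W)
    (b : Z ⟶ W) : Prop :=
  IsModelSquare t l r b ∧ WeakEquivalence (terminal.from Z)

variable [HasTerminal C] {C' : Type*} [Category C'] [CategoryWithWeakEquivalences C']
  [CategoryWithFibrations C'] [HasTerminal C']

/-- `F` preserves all weak equivalences. -/
def PreservesWeakEquivalences (F : C ⥤ C') : Prop :=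
  ∀ ⦃X Y : C⦄ (f : X ⟶ Y), WeakEquivalence f → WeakEquivalence (F.map f)

/-- `F` maps model squares to model squares. -/
def PreservesModelSquares (F : C ⥤ C') : Prop :=
  ∀ ⦃X Y Z W : C⦄ (t : X ⟶ Y) (l : X ⟶ Z) (r : Y ⟶ W) (b : Z ⟶ W),
    IsModelSquare t l r b → IsModelSquare (F.map t) (F.map l) (F.map r) (F.map b)

/-- `F` maps homotopy fiber sequences to homotopy fiber sequences. -/
def PreservesHomotopyFiberSequences (F : C ⥤ C') : Prop :=
  ∀ ⦃X Y Z W : C⦄ (t : X ⟶ Y) (l : X ⟶ Z) (r : Y ⟶ W) (b : Z ⟶ W),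
    IsHomotopyFiberSequence t l r b →
      IsHomotopyFiberSequence (F.map t) (F.map l) (F.map r) (F.map b)

end ModelSquares

/-! ### The derived tensor product and flat modules -/

section Flat

/-- A cofibrant F-replacement functor: an endofunctor `Q` with cofibrant values and a natural
trivial fibration `q : Q ⟶ id`. -/
structure CofibrantReplacementFunctor (C : Type*) [Category C] [CategoryWithWeakEquivalences C]
    [CategoryWithFibrations C] [CategoryWithCofibrations C] [HasInitial C] where
  /-- the endofunctor -/
  Q : C ⥤ C
  /-- the natural trivial fibration -/
  q : Q ⟶ 𝟭 C
  cofibrant : ∀ X, IsCofibrant (Q.obj X)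
  fibration : ∀ X, Fibration (q.app X)
  weakEquivalence : ∀ X, WeakEquivalence (q.app X)

variable {k : Type u} [Field k] {O : Type u} [CommRing O] [Algebra k O] {A : DGAlg k O}

/-- The endofunctors of `Mod(A)` that represent the derived tensor product `- ⊗^𝕃_A M`:
`Q(-) ⊗_A CM`, `Q(-) ⊗_A M` and `- ⊗_A CM`, where `Q` is a cofibrant F-replacement functor and
`c : CM ⟶ M` is a cofibrant replacement of `M`. -/
inductive RepresentsDerivedTensor (M : DGMod A) : (DGMod A ⥤ DGMod A) → Prop
  | both (Q : CofibrantReplacementFunctor (DGMod A)) (CM : DGMod A) (c : CM ⟶ M)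
      (hC : IsCofibrant CM) (hc : WeakEquivalence c) :
      RepresentsDerivedTensor M (Q.Q ⋙ tensorFunctor CM)
  | left (Q : CofibrantReplacementFunctor (DGMod A)) :
      RepresentsDerivedTensor M (Q.Q ⋙ tensorFunctor M)
  | right (CM : DGMod A) (c : CM ⟶ M) (hC : IsCofibrant CM) (hc : WeakEquivalence c) :
      RepresentsDerivedTensor M (tensorFunctor CM)

/-- `M` is flat: the derived tensor product `- ⊗^𝕃_A M` preserves model squares, i.e. the
functors representing it do. -/
def IsFlat (M : DGMod A) : Prop :=
  ∀ F : DGMod A ⥤ DGMod A, RepresentsDerivedTensor M F → PreservesModelSquares F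

/-- The derived tensor product `- ⊗^𝕃_A M` preserves homotopy fiber sequences, i.e. the functors
representing it do. -/
def DerivedTensorPreservesHomotopyFiberSequences (M : DGMod A) : Prop :=
  ∀ F : DGMod A ⥤ DGMod A, RepresentsDerivedTensor M F → PreservesHomotopyFiberSequences F

end Flat

end DGeom

/-!
The statement reduces to chases with elements, because weak equivalences and model squares of
`A`-modules can be tested on cycles and boundaries. Every `A`-module is fibrant, and a model square
is the same as a commutative square that is homotopy cartesian in an elementary sense
(`IsHomotopyCartesian`): the upper left corner maps isomorphically, in homology, to the homotopy
pullback of the other three. To pass from this to the definition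
(`IsHomotopyCartesian.isModelSquare`) one replaces a leg `Y ⟶ W` by `Y × pathObj W ⟶ W`, where
`pathObj W` is contractible and maps onto `W` in positive degrees.

*Functors that preserve fiber sequences.* By invariance under weak equivalences, it is enough to
treat a strict pullback `X = Y ×_W Z` along a fibration `Y ⟶ W`. The fibers of `X ⟶ Z` and of
`Y ⟶ W` coincide, which compares two long exact homology sequences. As complexes are bounded below
and fibrations need not be surjective in degree zero, this comparison is not sufficient for the
square to be homotopy cartesian. What is missing is supplied by a further fiber sequence,
`X ⟶ Y × Z ⟶ W`, given by the difference of the two maps. To exploit it, one shows that in homology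
the functor is additive on products and respects signs
(`isHomotopyCartesian_map_of_isPullback`).

*Derived tensor products.* Conversely, a functor that preserves model squares, weak equivalences,
and the zero object up to weak equivalence preserves homotopy fiber sequences. It remains to see
that `Q(-) ⊗_A M` and `- ⊗_A C` with `C` cofibrant preserve weak equivalences.

* A weak equivalence `f : N ⟶ N'` with cofibrant target factors through the trivial fibration
  `N × pathObj N' ⟶ N'`, which has a section. As `pathObj N' ⊗_A M` is contractible, `f ⊗_A M` has a
  right inverse in homology, which is again induced by a weak equivalence; if `N` is cofibrant as
  well, the same argument for this one shows that `f ⊗_A M` is a weak equivalence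
  (`weakEquivalence_tensorObjMap_of_isCofibrant`).
* A cofibrant module `C` is, as a graded module, a retract of `A ⊗_O V`, where the `V_q` are free
  left `𝒟`-modules: lift the canonical morphism `C ⟶ coneObj C` along the trivial fibration
  `coneObj (A ⊗_O V) ⟶ coneObj C` (`exists_section_of_isCofibrant`). As `N ⊗_A (A ⊗_O V)` is
  `N ⊗_O V`, the functor `- ⊗_A C` is exact provided that free `𝒟`-modules are flat over `O`. It
  then preserves weak equivalences, by induction on the degree (`weakEquivalence_tensorObjMap`).
* The ring `𝒟` is projective as a left `O`-module (`DiffOp.projective`). Smoothness yields functions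
  `x_i` and vector fields `∂_i` with `θ = ∑ θ(x_i) ∂_i` for each vector field `θ`. Let `𝒟` act on
  the polynomials `O[ξ]` by letting `θ` act as `θ + ∑ θ(x_i) ξ_i`. The map `P ↦ P(1)` from `𝒟` to
  `O[ξ]`, followed by `f ξ^α ↦ f ∂^α`, is the identity up to terms of lower order, hence
  bijective; so `𝒟` is a direct summand of `O[ξ]`.
-/

namespace DGeom

/-! ### Cycles, boundaries and quasi-isomorphisms in terms of elements -/

section Elements

variable {k : Type u} [Field k] {O : Type u} [CommRing O] [Algebra k O]

/-- `x` is a cycle. In degree `0` the differential `X_0 → X_{0-1}` of a chain complex is zero, so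
that every element is a cycle. -/
def IsCycle (X : DGDM k O) (n : ℕ) (x : X.X n) : Prop := (X.d n (n - 1)).hom x = 0

/-- `x` is a boundary. -/
def IsBoundary (X : DGDM k O) (n : ℕ) (x : X.X n) : Prop :=
  ∃ y : X.X (n + 1), (X.d (n + 1) n).hom y = x

variable {X Y : DGDM k O}

theorem IsBoundary.isCycle {n : ℕ} {x : X.X n} (h : IsBoundary X n x) : IsCycle X n x := by
  obtain ⟨y, rfl⟩ := h
  exact dgd_dgd X (n + 1) n (n - 1) y

theorem isCycle_d (n : ℕ) (y : X.X (n + 1)) : IsCycle X n ((X.d (n + 1) n).hom y) :=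
  IsBoundary.isCycle ⟨y, rfl⟩

theorem isBoundary_d (n : ℕ) (y : X.X (n + 1)) : IsBoundary X n ((X.d (n + 1) n).hom y) :=
  ⟨y, rfl⟩

theorem isCycle_zero (n : ℕ) : IsCycle X n 0 := map_zero _

theorem IsCycle.add {n : ℕ} {x y : X.X n} (hx : IsCycle X n x) (hy : IsCycle X n y) :
    IsCycle X n (x + y) := by
  rw [IsCycle, map_add, show (X.d n (n - 1)).hom x = 0 from hx,
    show (X.d n (n - 1)).hom y = 0 from hy, add_zero]

theorem IsCycle.neg {n : ℕ} {x : X.X n} (hx : IsCycle X n x) : IsCycle X n (-x) := by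
  rw [IsCycle, map_neg, show (X.d n (n - 1)).hom x = 0 from hx, neg_zero]

theorem IsCycle.sub {n : ℕ} {x y : X.X n} (hx : IsCycle X n x) (hy : IsCycle X n y) :
    IsCycle X n (x - y) := by
  rw [sub_eq_add_neg]
  exact hx.add hy.neg

theorem isBoundary_zero (n : ℕ) : IsBoundary X n 0 := ⟨0, map_zero _⟩

theorem IsBoundary.add {n : ℕ} {x y : X.X n} (hx : IsBoundary X n x) (hy : IsBoundary X n y) :
    IsBoundary X n (x + y) := by
  obtain ⟨a, rfl⟩ := hx
  obtain ⟨b, rfl⟩ := hy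
  exact ⟨a + b, map_add _ _ _⟩

theorem IsBoundary.neg {n : ℕ} {x : X.X n} (hx : IsBoundary X n x) : IsBoundary X n (-x) := by
  obtain ⟨a, rfl⟩ := hx
  exact ⟨-a, map_neg _ _⟩

theorem IsBoundary.sub {n : ℕ} {x y : X.X n} (hx : IsBoundary X n x) (hy : IsBoundary X n y) :
    IsBoundary X n (x - y) := by
  rw [sub_eq_add_neg]
  exact hx.add hy.neg

theorem chainMap_d (f : X ⟶ Y) (i j : ℕ) (x : X.X i) :
    (f.f j).hom ((X.d i j).hom x) = (Y.d i j).hom ((f.f i).hom x) :=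
  congrArg (fun φ => φ.hom x) (f.comm i j).symm

theorem IsCycle.map (f : X ⟶ Y) {n : ℕ} {x : X.X n} (hx : IsCycle X n x) :
    IsCycle Y n ((f.f n).hom x) := by
  rw [IsCycle, ← chainMap_d, show (X.d n (n - 1)).hom x = 0 from hx, map_zero]

theorem IsBoundary.map (f : X ⟶ Y) {n : ℕ} {x : X.X n} (hx : IsBoundary X n x) :
    IsBoundary Y n ((f.f n).hom x) := by
  obtain ⟨y, rfl⟩ := hx
  exact ⟨(f.f (n + 1)).hom y, (chainMap_d f _ _ y).symm⟩

theorem next_down (n : ℕ) : (ComplexShape.down ℕ).next n = n - 1 := by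
  cases n <;> simp

theorem exists_cycles_eq {n : ℕ} {x : X.X n} (hx : IsCycle X n x) :
    ∃ z : X.cycles n, (X.iCycles n).hom z = x :=
  (ShortComplex.moduleCat_exact_iff _).1 (ShortComplex.exact_of_f_is_kernel
    (ShortComplex.mk (X.iCycles n) (X.d n (n - 1)) (X.iCycles_d n _))
    (X.cyclesIsKernel n (n - 1) (next_down n))) x hx

theorem iCycles_isCycle {n : ℕ} (z : X.cycles n) : IsCycle X n ((X.iCycles n).hom z) :=
  congrArg (fun φ : X.cycles n ⟶ X.X (n - 1) => φ.hom z) (X.iCycles_d n (n - 1))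

theorem iCycles_injective (n : ℕ) : Function.Injective (X.iCycles n).hom :=
  (ModuleCat.mono_iff_injective _).1 inferInstance

theorem homologyπ_surjective (n : ℕ) : Function.Surjective (X.homologyπ n).hom :=
  (ModuleCat.epi_iff_surjective _).1 inferInstance

theorem homologyπ_eq_zero_iff {n : ℕ} (z : X.cycles n) :
    (X.homologyπ n).hom z = 0 ↔ IsBoundary X n ((X.iCycles n).hom z) := by
  have h := (ShortComplex.moduleCat_exact_iff _).1 (ShortComplex.exact_of_g_is_cokernel
    (ShortComplex.mk (X.toCycles (n + 1) n) (X.homologyπ n) (X.toCycles_comp_homologyπ _ _))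
    (X.homologyIsCokernel (n + 1) n (by simp)))
  constructor
  · intro hz
    obtain ⟨y, hy⟩ := h z hz
    refine ⟨y, ?_⟩
    rw [← hy]
    exact (congrArg (fun φ => φ.hom y) (X.toCycles_i (n + 1) n)).symm
  · rintro ⟨y, hy⟩
    have : z = (X.toCycles (n + 1) n).hom y := by
      apply iCycles_injective n
      rw [← hy]
      exact (congrArg (fun φ => φ.hom y) (X.toCycles_i (n + 1) n)).symm
    rw [this]
    exact congrArg (fun φ => φ.hom y) (X.toCycles_comp_homologyπ (n + 1) n)

theorem quasiIso_iff_elements (f : X ⟶ Y) :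
    QuasiIso f ↔ ∀ n,
      (∀ x, IsCycle X n x → IsBoundary Y n ((f.f n).hom x) → IsBoundary X n x) ∧
      (∀ y, IsCycle Y n y → ∃ x, IsCycle X n x ∧ IsBoundary Y n ((f.f n).hom x - y)) := by
  rw [quasiIso_iff]
  refine forall_congr' fun n => ?_
  rw [quasiIsoAt_iff_isIso_homologyMap, ConcreteCategory.isIso_iff_bijective]
  have hπ : ∀ z : X.cycles n, (HomologicalComplex.homologyMap f n).hom ((X.homologyπ n).hom z) =
      (Y.homologyπ n).hom ((HomologicalComplex.cyclesMap f n).hom z) := fun z =>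
    congrArg (fun φ => φ.hom z) (HomologicalComplex.homologyπ_naturality f n)
  have hi : ∀ z : X.cycles n, (Y.iCycles n).hom ((HomologicalComplex.cyclesMap f n).hom z) =
      (f.f n).hom ((X.iCycles n).hom z) := fun z =>
    congrArg (fun φ => φ.hom z) (HomologicalComplex.cyclesMap_i f n)
  refine and_congr ?_ ?_
  · change Function.Injective (HomologicalComplex.homologyMap f n).hom ↔ _
    rw [injective_iff_map_eq_zero]
    constructor
    · intro H x hx hb
      obtain ⟨z, rfl⟩ := exists_cycles_eq hx
      rw [← homologyπ_eq_zero_iff]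
      apply H
      rw [hπ, homologyπ_eq_zero_iff, hi]
      exact hb
    · intro H c hc
      obtain ⟨z, rfl⟩ := homologyπ_surjective n c
      rw [homologyπ_eq_zero_iff]
      rw [hπ, homologyπ_eq_zero_iff, hi] at hc
      exact H _ (iCycles_isCycle z) hc
  · change Function.Surjective (HomologicalComplex.homologyMap f n).hom ↔ _
    constructor
    · intro H y hy
      obtain ⟨w, rfl⟩ := exists_cycles_eq hy
      obtain ⟨c, hc⟩ := H ((Y.homologyπ n).hom w)
      obtain ⟨z, rfl⟩ := homologyπ_surjective n c
      refine ⟨_, iCycles_isCycle z, ?_⟩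
      rw [← hi, ← map_sub, ← homologyπ_eq_zero_iff, map_sub, ← hπ, hc, sub_self]
    · intro H c
      obtain ⟨w, rfl⟩ := homologyπ_surjective n c
      obtain ⟨x, hx, hb⟩ := H _ (iCycles_isCycle w)
      obtain ⟨z, rfl⟩ := exists_cycles_eq hx
      refine ⟨(X.homologyπ n).hom z, ?_⟩
      rw [hπ, ← sub_eq_zero, ← map_sub, homologyπ_eq_zero_iff, map_sub, hi]
      exact hb

/-- A complex is acyclic if its cycles are boundaries. -/
def Acyclic (X : DGDM k O) : Prop := ∀ n x, IsCycle X n x → IsBoundary X n x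

end Elements

namespace DGMod

variable {k : Type u} [Field k] {O : Type u} [CommRing O] [Algebra k O] {A : DGAlg k O}

/-- The component of degree `n` of a morphism of `A`-modules. -/
noncomputable abbrev app {M N : DGMod A} (f : M ⟶ N) (n : ℕ) :
    M.X.X n →ₗ[DiffOp k O] N.X.X n := (f.hom.f n).hom

/-- The differential of an `A`-module. -/
noncomputable abbrev d (M : DGMod A) (i j : ℕ) : M.X.X i →ₗ[DiffOp k O] M.X.X j :=
  (M.X.d i j).hom

variable {M N P : DGMod A}

theorem app_d (f : M ⟶ N) (i j : ℕ) (x : M.X.X i) :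
    app f j (M.d i j x) = N.d i j (app f i x) := hom_d f i j x

theorem app_comp (f : M ⟶ N) (g : N ⟶ P) (n : ℕ) (x : M.X.X n) :
    app (f ≫ g) n x = app g n (app f n x) := rfl

theorem app_id (n : ℕ) (x : M.X.X n) : app (𝟙 M) n x = x := rfl

theorem app_congr {f g : M ⟶ N} (h : f = g) (n : ℕ) (x : M.X.X n) : app f n x = app g n x := by
  rw [h]

theorem app_app_of_comp_eq {f : M ⟶ N} {g : N ⟶ P} {h : M ⟶ P} (e : f ≫ g = h) (n : ℕ)
    (x : M.X.X n) : app g n (app f n x) = app h n x := by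
  rw [← app_comp, e]

theorem hom_ext_app {f g : M ⟶ N} (h : ∀ n x, app f n x = app g n x) : f = g :=
  Hom.ext (HomologicalComplex.hom_ext _ _ fun n => ModuleCat.hom_ext (LinearMap.ext (h n)))

theorem d_eq_zero_of_ne (M : DGMod A) {i j : ℕ} (h : j + 1 ≠ i) (x : M.X.X i) :
    M.d i j x = 0 :=
  congrArg (fun φ => φ.hom x) (M.X.shape i j h)

/-- A morphism of `A`-modules from its components. -/
noncomputable def mkHom (φ : ∀ n, M.X.X n →ₗ[DiffOp k O] N.X.X n)
    (hd : ∀ n x, N.d (n + 1) n (φ (n + 1) x) = φ n (M.d (n + 1) n x))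
    (ha : ∀ p q n, p + q = n → ∀ (a : A.X.X p) (x : M.X.X q),
      φ n (M.act p q n a x) = N.act p q n a (φ q x)) : M ⟶ N where
  hom :=
    { f := fun n => ModuleCat.ofHom (φ n)
      comm' := fun i j hij => by
        obtain rfl : j + 1 = i := hij
        exact ModuleCat.hom_ext (LinearMap.ext fun x => hd j x) }
  map_act p q n a x := by
    by_cases h : p + q = n
    · exact ha p q n h a x
    · rw [M.act_shape p q n h, N.act_shape p q n h]
      simp

theorem weakEquivalence_iff_elements (f : M ⟶ N) :
    WeakEquivalence f ↔ ∀ n,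
      (∀ x, IsCycle M.X n x → IsBoundary N.X n (app f n x) → IsBoundary M.X n x) ∧
      (∀ y, IsCycle N.X n y → ∃ x, IsCycle M.X n x ∧ IsBoundary N.X n (app f n x - y)) := by
  rw [weakEquivalence_iff]
  exact quasiIso_iff_elements f.hom

theorem weakEquivalence_comp_iff (f : M ⟶ N) (g : N ⟶ P) (h : WeakEquivalence g) :
    WeakEquivalence (f ≫ g) ↔ WeakEquivalence f := by
  have : QuasiIso g.hom := h.mem
  rw [weakEquivalence_iff, weakEquivalence_iff]
  exact quasiIso_iff_comp_right f.hom g.hom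

theorem weakEquivalence_comp_iff' (f : M ⟶ N) (g : N ⟶ P) (h : WeakEquivalence f) :
    WeakEquivalence (f ≫ g) ↔ WeakEquivalence g := by
  have : QuasiIso f.hom := h.mem
  rw [weakEquivalence_iff, weakEquivalence_iff]
  exact quasiIso_iff_comp_left f.hom g.hom

theorem fibration_iff_surjective (f : M ⟶ N) :
    Fibration f ↔ ∀ n, 0 < n → Function.Surjective (app f n) := fibration_iff f

theorem weakEquivalence_of_isIso (f : M ⟶ N) [IsIso f] : WeakEquivalence f := by
  rw [weakEquivalence_iff_elements]
  have e : ∀ n x, app f n (app (inv f) n x) = x := fun n x =>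
    (app_app_of_comp_eq (IsIso.inv_hom_id f) n x)
  have e' : ∀ n x, app (inv f) n (app f n x) = x := fun n x =>
    (app_app_of_comp_eq (IsIso.hom_inv_id f) n x)
  refine fun n => ⟨fun x _ h => ?_, fun y hy => ⟨app (inv f) n y, hy.map (inv f).hom, ?_⟩⟩
  · rw [← e' n x]
    exact h.map (inv f).hom
  · rw [e, sub_self]
    exact isBoundary_zero n

theorem subsingleton_of_isZero (h : IsZero M) (n : ℕ) : Subsingleton (M.X.X n) := by
  refine ⟨fun x y => ?_⟩
  have h0 : ∀ z, z = app (h.iso zeroMod_isZero).inv n (app (h.iso zeroMod_isZero).hom n z) :=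
    fun z => (app_app_of_comp_eq (h.iso zeroMod_isZero).hom_inv_id n z).symm
  rw [h0 x, h0 y]
  exact congrArg _ (Subsingleton.elim _ _)

instance (n : ℕ) : Subsingleton ((⊤_ (DGMod A)).X.X n) :=
  subsingleton_of_isZero (IsZero.of_iso zeroMod_isZero
    (terminalIsTerminal.uniqueUpToIso zeroMod_isZero.isTerminal)) n

theorem isFibrant (M : DGMod A) : IsFibrant M := by
  rw [isFibrant_iff, fibration_iff_surjective]
  exact fun n _ y => ⟨0, Subsingleton.elim _ _⟩

theorem weakEquivalence_terminal_iff (M : DGMod A) :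
    WeakEquivalence (terminal.from M) ↔ Acyclic M.X := by
  rw [weakEquivalence_iff_elements]
  constructor
  · intro h n x hx
    refine (h n).1 x hx ?_
    rw [Subsingleton.elim (app _ n x) 0]
    exact isBoundary_zero n
  · intro h n
    refine ⟨fun x hx _ => h n x hx, fun y _ => ⟨0, isCycle_zero n, ?_⟩⟩
    rw [Subsingleton.elim (_ - y) 0]
    exact isBoundary_zero n

theorem acyclic_zeroMod : Acyclic (zeroMod A).X := fun n x _ => by
  rw [Subsingleton.elim x 0]
  exact isBoundary_zero n

end DGMod

/-! ### Pullbacks, sums and negatives in the category of `A`-modules -/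

namespace DGMod

variable {k : Type u} [Field k] {O : Type u} [CommRing O] [Algebra k O] {A : DGAlg k O}

section Additive

variable {M N P : DGMod A}

/-- The sum of two morphisms. -/
noncomputable def addHom (f g : M ⟶ N) : M ⟶ N :=
  mkHom (fun n => app f n + app g n)
    (fun n x => by simp only [LinearMap.add_apply, map_add, app_d])
    (fun p q n _ a x => by
      simp only [LinearMap.add_apply, map_add]
      rw [← f.map_act, ← g.map_act])

/-- The negative of the identity. -/
noncomputable def negId (M : DGMod A) : M ⟶ M :=
  mkHom (fun _ => -LinearMap.id)
    (fun n x => by simp only [LinearMap.neg_apply, LinearMap.id_apply, map_neg])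
    (fun p q n _ a x => by simp only [LinearMap.neg_apply, LinearMap.id_apply, map_neg])

variable (M N) in
/-- The zero morphism. -/
noncomputable def zeroHom : M ⟶ N :=
  mkHom (fun _ => 0) (fun n x => by simp only [LinearMap.zero_apply, map_zero])
    (fun p q n _ a x => by simp only [LinearMap.zero_apply, map_zero])

end Additive

section Pullback

variable {Y Z W : DGMod A}

/-- The pullback of two morphisms of `A`-modules, in degree `n`. -/
noncomputable def pbSub (f : Y ⟶ W) (g : Z ⟶ W) (n : ℕ) :
    Submodule (DiffOp k O) (Y.X.X n × Z.X.X n) :=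
  LinearMap.eqLocus (app f n ∘ₗ LinearMap.fst _ _ _) (app g n ∘ₗ LinearMap.snd _ _ _)

theorem mem_pbSub {f : Y ⟶ W} {g : Z ⟶ W} {n : ℕ} {x : Y.X.X n × Z.X.X n} :
    x ∈ pbSub f g n ↔ app f n x.1 = app g n x.2 := Iff.rfl

/-- The differential of the pullback. -/
noncomputable def pbD (f : Y ⟶ W) (g : Z ⟶ W) (i j : ℕ) :
    pbSub f g i →ₗ[DiffOp k O] pbSub f g j :=
  (((Y.d i j).prodMap (Z.d i j)).domRestrict (pbSub f g i)).codRestrict (pbSub f g j)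
    (fun x => by
      have h := mem_pbSub.1 x.2
      change app f j (Y.d i j x.1.1) = app g j (Z.d i j x.1.2)
      rw [app_d, app_d, h])

/-- The action of `A` on the pullback. -/
noncomputable def pbAct (f : Y ⟶ W) (g : Z ⟶ W) (p q n : ℕ) :
    A.X.X p →+ pbSub f g q →+ pbSub f g n :=
  biadd
    (fun a x => ⟨(Y.act p q n a x.1.1, Z.act p q n a x.1.2), by
      have h := mem_pbSub.1 x.2
      change app f n (Y.act p q n a x.1.1) = app g n (Z.act p q n a x.1.2)
      rw [app, app, f.map_act, g.map_act]
      exact congrArg _ h⟩)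
    (fun a b x => Subtype.ext (Prod.ext (congrArg (fun φ => φ x.1.1) (map_add (Y.act p q n) a b))
      (congrArg (fun φ => φ x.1.2) (map_add (Z.act p q n) a b))))
    (fun a x y => Subtype.ext (Prod.ext (map_add (Y.act p q n a) _ _)
      (map_add (Z.act p q n a) _ _)))

theorem pbSub_ext {f : Y ⟶ W} {g : Z ⟶ W} {n : ℕ} {x y : pbSub f g n} (h1 : x.1.1 = y.1.1)
    (h2 : x.1.2 = y.1.2) : x = y := Subtype.ext (Prod.ext h1 h2)

/-- The complex underlying the pullback of two morphisms of `A`-modules. -/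
noncomputable def pbX (f : Y ⟶ W) (g : Z ⟶ W) : DGDM k O where
  X n := ModuleCat.of (DiffOp k O) (pbSub f g n)
  d i j := ModuleCat.ofHom (pbD f g i j)
  shape _ _ h := ModuleCat.hom_ext (LinearMap.ext fun x =>
    pbSub_ext (d_eq_zero_of_ne Y h x.1.1) (d_eq_zero_of_ne Z h x.1.2))
  d_comp_d' i j l _ _ := ModuleCat.hom_ext (LinearMap.ext fun x =>
    pbSub_ext (dgd_dgd Y.X i j l x.1.1) (dgd_dgd Z.X i j l x.1.2))

/-- The pullback of two morphisms of `A`-modules. -/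
noncomputable def pb (f : Y ⟶ W) (g : Z ⟶ W) : DGMod A where
  X := pbX f g
  act := pbAct f g
  act_shape p q n h := AddMonoidHom.ext fun a => AddMonoidHom.ext fun x =>
    pbSub_ext (congrArg (fun φ => φ a x.1.1) (Y.act_shape p q n h))
      (congrArg (fun φ => φ a x.1.2) (Z.act_shape p q n h))
  fun_act p q n f a x := pbSub_ext (Y.fun_act p q n f a x.1.1) (Z.fun_act p q n f a x.1.2)
  act_fun p q n f a x := pbSub_ext (Y.act_fun p q n f a x.1.1) (Z.act_fun p q n f a x.1.2)
  der_act p q n f a x := pbSub_ext (Y.der_act p q n f a x.1.1) (Z.der_act p q n f a x.1.2)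
  d_act p q n h a x := pbSub_ext (Y.d_act p q n h a x.1.1) (Z.d_act p q n h a x.1.2)
  one_act n x := pbSub_ext (Y.one_act n x.1.1) (Z.one_act n x.1.2)
  act_act p q r s t n hs ht hn a b x := pbSub_ext
    (Y.act_act p q r s t n hs ht hn a b x.1.1) (Z.act_act p q r s t n hs ht hn a b x.1.2)

/-- The first projection of the pullback. -/
noncomputable def pbFst (f : Y ⟶ W) (g : Z ⟶ W) : pb f g ⟶ Y :=
  mkHom (M := pb f g) (fun n => LinearMap.fst _ _ _ ∘ₗ (pbSub f g n).subtype)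
    (fun _ _ => rfl) (fun _ _ _ _ _ _ => rfl)

/-- The second projection of the pullback. -/
noncomputable def pbSnd (f : Y ⟶ W) (g : Z ⟶ W) : pb f g ⟶ Z :=
  mkHom (M := pb f g) (fun n => LinearMap.snd _ _ _ ∘ₗ (pbSub f g n).subtype)
    (fun _ _ => rfl) (fun _ _ _ _ _ _ => rfl)

/-- The morphism to the pullback given by two compatible morphisms. -/
noncomputable def pbLift {f : Y ⟶ W} {g : Z ⟶ W} {M : DGMod A} (y : M ⟶ Y) (z : M ⟶ Z)
    (h : y ≫ f = z ≫ g) : M ⟶ pb f g :=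
  mkHom (N := pb f g)
    (fun n => ((app y n).prod (app z n)).codRestrict (pbSub f g n) (fun x => app_congr h n x))
    (fun _ x => pbSub_ext (app_d y _ _ x).symm (app_d z _ _ x).symm)
    (fun p q n _ a x => pbSub_ext (y.map_act p q n a x) (z.map_act p q n a x))

variable {f : Y ⟶ W} {g : Z ⟶ W}

theorem pb_ext {n : ℕ} {x x' : (pb f g).X.X n} (h1 : app (pbFst f g) n x = app (pbFst f g) n x')
    (h2 : app (pbSnd f g) n x = app (pbSnd f g) n x') : x = x' :=
  pbSub_ext h1 h2

theorem exists_pb {n : ℕ} (y : Y.X.X n) (z : Z.X.X n) (h : app f n y = app g n z) :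
    ∃ x : (pb f g).X.X n, app (pbFst f g) n x = y ∧ app (pbSnd f g) n x = z :=
  ⟨⟨(y, z), h⟩, rfl, rfl⟩

variable (f g) in
theorem isPullback_pb : IsPullback (pbFst f g) (pbSnd f g) f g where
  w := hom_ext_app fun _ x => mem_pbSub.1 x.2
  isLimit' := ⟨PullbackCone.IsLimit.mk _ (fun s => pbLift s.fst s.snd s.condition)
    (fun _ => rfl) (fun _ => rfl) (fun _ _ h1 h2 => hom_ext_app fun n x =>
      pb_ext (app_app_of_comp_eq h1 n x) (app_app_of_comp_eq h2 n x))⟩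

variable {P : DGMod A} {fst : P ⟶ Y} {snd : P ⟶ Z}

theorem isPullback_ext (H : IsPullback fst snd f g) {n : ℕ} {x x' : P.X.X n}
    (h1 : app fst n x = app fst n x') (h2 : app snd n x = app snd n x') : x = x' := by
  let e := H.isoIsPullback Y Z (isPullback_pb f g)
  have hx : ∀ z, app e.inv n (app e.hom n z) = z :=
    fun z => app_app_of_comp_eq e.hom_inv_id n z
  rw [← hx x, ← hx x']
  refine congrArg _ (pb_ext ?_ ?_)
  · rw [← app_comp, ← app_comp, H.isoIsPullback_hom_fst, h1]
  · rw [← app_comp, ← app_comp, H.isoIsPullback_hom_snd, h2]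

theorem isPullback_exists (H : IsPullback fst snd f g) {n : ℕ} (y : Y.X.X n) (z : Z.X.X n)
    (h : app f n y = app g n z) : ∃ x : P.X.X n, app fst n x = y ∧ app snd n x = z := by
  let e := H.isoIsPullback Y Z (isPullback_pb f g)
  obtain ⟨w, rfl, rfl⟩ := exists_pb y z h
  refine ⟨app e.inv n w, ?_, ?_⟩
  · rw [← app_comp, H.isoIsPullback_inv_fst]
  · rw [← app_comp, H.isoIsPullback_inv_snd]

theorem isIso_of_bijective {M N : DGMod A} (f : M ⟶ N)
    (h : ∀ n, Function.Bijective (app f n)) : IsIso f := by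
  let e : ∀ n, M.X.X n ≃ₗ[DiffOp k O] N.X.X n := fun n => LinearEquiv.ofBijective (app f n) (h n)
  have he : ∀ n x, e n x = app f n x := fun _ _ => rfl
  let g : N ⟶ M := mkHom (fun n => (e n).symm.toLinearMap)
    (fun n x => by
      apply (e n).injective
      simp only [LinearEquiv.coe_coe, LinearEquiv.apply_symm_apply]
      rw [he, app_d, ← he, LinearEquiv.apply_symm_apply])
    (fun p q n _ a x => by
      apply (e n).injective
      simp only [LinearEquiv.coe_coe, LinearEquiv.apply_symm_apply]
      rw [he, app, f.map_act]
      exact congrArg _ ((e q).apply_symm_apply x).symm)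
  exact ⟨g, hom_ext_app fun n x => (e n).symm_apply_apply x,
    hom_ext_app fun n x => (e n).apply_symm_apply x⟩

theorem isPullback_of_elements (w : fst ≫ f = snd ≫ g)
    (hinj : ∀ n (x : P.X.X n), app fst n x = 0 → app snd n x = 0 → x = 0)
    (hex : ∀ n (y : Y.X.X n) (z : Z.X.X n), app f n y = app g n z →
      ∃ x : P.X.X n, app fst n x = y ∧ app snd n x = z) : IsPullback fst snd f g := by
  have : IsIso (pbLift fst snd w) := isIso_of_bijective _ fun n => by
    constructor
    · rw [injective_iff_map_eq_zero]
      intro x hx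
      exact hinj n x (congrArg (fun w : pbSub f g n => w.1.1) hx)
        (congrArg (fun w : pbSub f g n => w.1.2) hx)
    · intro w
      obtain ⟨x, h1, h2⟩ := hex n w.1.1 w.1.2 w.2
      exact ⟨x, pbSub_ext h1 h2⟩
  exact IsPullback.of_iso (isPullback_pb f g) (asIso (pbLift fst snd w)).symm (Iso.refl _)
    (Iso.refl _) (Iso.refl _) ((Iso.eq_inv_comp _).2 (hom_ext_app fun _ _ => rfl))
    ((Iso.eq_inv_comp _).2 (hom_ext_app fun _ _ => rfl)) rfl rfl

end Pullback

end DGMod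

/-! ### Homotopy cartesian squares in terms of elements -/

namespace DGMod

variable {k : Type u} [Field k] {O : Type u} [CommRing O] [Algebra k O] {A : DGAlg k O}

variable {X Y Z W : DGMod A}

/-- An elementary form of the condition that the map from `X` to the homotopy pullback of
`Y ⟶ W ⟵ Z` is a quasi-isomorphism. An element of degree `n` of this homotopy pullback is a triple
`(y, z, w)` of degrees `n`, `n`, `n + 1`, with differential `(dy, dz, r y - b z - d w)`; the
conditions say that `x ↦ (t x, l x, 0)` is injective, resp. surjective, in homology. -/
structure IsHomotopyCartesian (t : X ⟶ Y) (l : X ⟶ Z) (r : Y ⟶ W) (b : Z ⟶ W) : Prop where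
  comm : t ≫ r = l ≫ b
  inj : ∀ n (x : X.X.X n) (y : Y.X.X (n + 1)) (z : Z.X.X (n + 1)) (w : W.X.X (n + 2)),
    IsCycle X.X n x → app t n x = Y.d (n + 1) n y → app l n x = Z.d (n + 1) n z →
    app r (n + 1) y - app b (n + 1) z = W.d (n + 2) (n + 1) w → IsBoundary X.X n x
  surj : ∀ n (y : Y.X.X n) (z : Z.X.X n) (w : W.X.X (n + 1)),
    IsCycle Y.X n y → IsCycle Z.X n z → app r n y - app b n z = W.d (n + 1) n w →
    ∃ (x : X.X.X n) (y' : Y.X.X (n + 1)) (z' : Z.X.X (n + 1)), IsCycle X.X n x ∧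
      app t n x = y + Y.d (n + 1) n y' ∧ app l n x = z + Z.d (n + 1) n z' ∧
      IsBoundary W.X (n + 1) (w + app r (n + 1) y' - app b (n + 1) z')

theorem IsHomotopyCartesian.flip {t : X ⟶ Y} {l : X ⟶ Z} {r : Y ⟶ W} {b : Z ⟶ W}
    (h : IsHomotopyCartesian t l r b) : IsHomotopyCartesian l t b r where
  comm := h.comm.symm
  inj n x z y w hx hz hy hw := h.inj n x y z (-w) hx hy hz (by rw [map_neg, ← hw, neg_sub])
  surj n z y w hz hy hw := by
    obtain ⟨x, y', z', hx, h1, h2, h3⟩ :=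
      h.surj n y z (-w) hy hz (by rw [map_neg, ← hw, neg_sub])
    refine ⟨x, z', y', hx, h2, h1, ?_⟩
    have := h3.neg
    convert this using 1
    abel

/-- A strict pullback along a fibration is homotopy cartesian. -/
theorem isHomotopyCartesian_of_isPullback {t : X ⟶ Y} {l : X ⟶ Z} {r : Y ⟶ W} {b : Z ⟶ W}
    (h : IsPullback t l r b) (hr : Fibration r) : IsHomotopyCartesian t l r b where
  comm := h.w
  inj n x y z w _ hy hz hw := by
    obtain ⟨v, rfl⟩ := (fibration_iff_surjective r).1 hr (n + 2) (by omega) w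
    obtain ⟨x', h1, h2⟩ := isPullback_exists h (y - Y.d _ _ v) z (by
      rw [map_sub, app_d, ← hw]
      abel)
    refine ⟨x', isPullback_ext h ?_ ?_⟩
    · change app t n (X.d _ _ x') = _
      rw [app_d, h1, hy, map_sub, sub_eq_self]
      exact dgd_dgd Y.X _ _ _ v
    · change app l n (X.d _ _ x') = _
      rw [app_d, h2, hz]
  surj n y z w hy hz hw := by
    obtain ⟨v, rfl⟩ := (fibration_iff_surjective r).1 hr (n + 1) (by omega) w
    obtain ⟨x, h1, h2⟩ := isPullback_exists h (y - Y.d _ _ v) z (by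
      rw [map_sub, app_d, ← hw]
      abel)
    refine ⟨x, -v, 0, ?_, ?_, ?_, ?_⟩
    · refine isPullback_ext h ?_ ?_
      · change app t _ (X.d _ _ x) = app t _ 0
        rw [app_d, h1, map_zero]
        exact hy.sub (isCycle_d n v)
      · change app l _ (X.d _ _ x) = app l _ 0
        rw [app_d, h2, map_zero]
        exact hz
    · rw [h1, map_neg, sub_eq_add_neg]
    · rw [h2, map_zero, add_zero]
    · rw [map_neg, map_zero, sub_zero, add_neg_cancel]
      exact isBoundary_zero _

/-- Homotopy cartesian squares are stable under objectwise weak equivalences. -/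
theorem IsHomotopyCartesian.of_weakEquivalence {t : X ⟶ Y} {l : X ⟶ Z} {r : Y ⟶ W} {b : Z ⟶ W}
    {X' Y' Z' W' : DGMod A} {t' : X' ⟶ Y'} {l' : X' ⟶ Z'} {r' : Y' ⟶ W'} {b' : Z' ⟶ W'}
    (h : IsHomotopyCartesian t' l' r' b') (comm : t ≫ r = l ≫ b)
    (x : X ⟶ X') (y : Y ⟶ Y') (z : Z ⟶ Z') (w : W ⟶ W')
    (ht : x ≫ t' = t ≫ y) (hl : x ≫ l' = l ≫ z) (hr : y ≫ r' = r ≫ w) (hb : z ≫ b' = b ≫ w)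
    (wx : WeakEquivalence x) (wy : WeakEquivalence y) (wz : WeakEquivalence z)
    (ww : WeakEquivalence w) : IsHomotopyCartesian t l r b := by
  rw [weakEquivalence_iff_elements] at wx wy wz ww
  have ht' : ∀ n a, app t' n (app x n a) = app y n (app t n a) := fun n a => app_congr ht n a
  have hl' : ∀ n a, app l' n (app x n a) = app z n (app l n a) := fun n a => app_congr hl n a
  have hr' : ∀ n a, app r' n (app y n a) = app w n (app r n a) := fun n a => app_congr hr n a
  have hb' : ∀ n a, app b' n (app z n a) = app w n (app b n a) := fun n a => app_congr hb n a
  have hc : ∀ n a, app r n (app t n a) = app b n (app l n a) := fun n a => app_congr comm n a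
  refine ⟨comm, ?_, ?_⟩
  · intro n a β γ δ ha hβ hγ hδ
    refine (wx n).1 a ha (h.inj n (app x n a) (app y _ β) (app z _ γ) (app w _ δ)
      (ha.map x.hom) ?_ ?_ ?_)
    · rw [ht', hβ, app_d]
    · rw [hl', hγ, app_d]
    · rw [hr', hb', ← map_sub, hδ, app_d]
  · intro n β γ δ hβ hγ hδ
    obtain ⟨a', β₁, γ₁, ha', h1, h2, ⟨ε, h3⟩⟩ := h.surj n (app y n β) (app z n γ) (app w _ δ)
      (hβ.map y.hom) (hγ.map z.hom) (by rw [hr', hb', ← map_sub, hδ, app_d])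
    obtain ⟨a, ha, ⟨ā, hā⟩⟩ := (wx n).2 a' ha'
    -- The chains `β₂`, `γ₂` bounding `t a - β`, `l a - γ` are chosen such that they correspond,
    -- up to boundaries, to the ones that are given in the second square.
    have key : ∀ {V V' : DGMod A} (v : V ⟶ V') (_ : ∀ n,
        (∀ x, IsCycle V.X n x → IsBoundary V'.X n (app v n x) → IsBoundary V.X n x) ∧
        (∀ y, IsCycle V'.X n y → ∃ x, IsCycle V.X n x ∧ IsBoundary V'.X n (app v n x - y)))
        (c : V.X.X n) (c' : V'.X.X (n + 1)), IsCycle V.X n c →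
        app v n c = V'.d (n + 1) n c' →
        ∃ (e : V.X.X (n + 1)) (e' : V'.X.X (n + 2)), V.d (n + 1) n e = c ∧
          app v (n + 1) e = c' + V'.d _ _ e' := by
      intro V V' v hv c c' hc hcc
      obtain ⟨e, rfl⟩ := (hv n).1 c hc ⟨c', hcc.symm⟩
      obtain ⟨e₂, he₂, ⟨e', he'⟩⟩ := (hv (n + 1)).2 (app v (n + 1) e - c') (by
        change V'.d (n + 1) n _ = 0
        rw [map_sub, ← app_d, sub_eq_zero]
        exact hcc)
      refine ⟨e - e₂, -e', ?_, ?_⟩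
      · rw [map_sub, show V.d (n + 1) n e₂ = 0 from he₂, sub_zero]
      · rw [map_sub, map_neg]
        change _ = c' + -(V'.X.d _ _).hom e'
        rw [he']
        abel
    have hā' : app x n a = a' + X'.d _ _ ā := by
      change app x n a = a' + (X'.X.d _ _).hom ā
      rw [hā]
      abel
    obtain ⟨β₂, β₃, hβ₂, hβ₃⟩ := key y wy (app t n a - β) (β₁ + app t' _ ā)
      ((ha.map t.hom).sub hβ) (by
        rw [map_sub, ← ht', hā', map_add, h1, app_d, map_add]
        abel)
    obtain ⟨γ₂, γ₃, hγ₂, hγ₃⟩ := key z wz (app l n a - γ) (γ₁ + app l' _ ā)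
      ((ha.map l.hom).sub hγ) (by
        rw [map_sub, ← hl', hā', map_add, h2, app_d, map_add]
        abel)
    refine ⟨a, β₂, γ₂, ha, by rw [hβ₂]; abel, by rw [hγ₂]; abel, ?_⟩
    refine (ww (n + 1)).1 _ ?_ ?_
    · change W.d (n + 1) n _ = 0
      rw [map_sub, map_add, ← hδ, ← app_d, ← app_d, hβ₂, hγ₂, map_sub, map_sub, hc]
      abel
    · refine ⟨ε + app r' _ β₃ - app b' _ γ₃, ?_⟩
      change W'.d _ _ _ = _
      have h3' : W'.d _ _ ε = app w (n + 1) δ + app r' (n + 1) β₁ - app b' (n + 1) γ₁ := h3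
      have hc' : app r' (n + 1) (app t' (n + 1) ā) = app b' (n + 1) (app l' (n + 1) ā) :=
        app_congr h.comm _ ā
      rw [map_sub, map_add, h3', map_sub, map_add, ← hr', ← hb', hβ₃, hγ₃, map_add, map_add,
        map_add, map_add, hc', app_d, app_d]
      abel

/-- A fibrant replacement that consists of identities. -/
noncomputable def idReplacement (r : Y ⟶ W) (b : Z ⟶ W) (h : Fibration r ∨ Fibration b) :
    FibrantCospanReplacement r b where
  Y' := Y
  Z' := Z
  W' := W
  r' := r
  b' := b
  y := 𝟙 Y
  z := 𝟙 Z
  w := 𝟙 W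
  comm_r := by rw [Category.id_comp, Category.comp_id]
  comm_b := by rw [Category.id_comp, Category.comp_id]
  weq_y := weakEquivalence_of_isIso _
  weq_z := weakEquivalence_of_isIso _
  weq_w := weakEquivalence_of_isIso _
  fibrant_Y := isFibrant _
  fibrant_Z := isFibrant _
  fibrant_W := isFibrant _
  fib_leg := h

theorem isModelSquare_of_isPullback {t : X ⟶ Y} {l : X ⟶ Z} {r : Y ⟶ W} {b : Z ⟶ W}
    (h : IsPullback t l r b) (hr : Fibration r) : IsModelSquare t l r b :=
  ⟨h.w, idReplacement r b (Or.inl hr), X, t, l, h, 𝟙 X,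
    (Category.id_comp _).trans (Category.comp_id _).symm,
    (Category.id_comp _).trans (Category.comp_id _).symm, weakEquivalence_of_isIso _⟩

theorem isHomotopyFiberSequence_of_isPullback {t : X ⟶ Y} {l : X ⟶ zeroMod A} {r : Y ⟶ W}
    {b : zeroMod A ⟶ W} (h : IsPullback t l r b) (hr : Fibration r) :
    IsHomotopyFiberSequence t l r b :=
  ⟨isModelSquare_of_isPullback h hr, (weakEquivalence_terminal_iff _).2 acyclic_zeroMod⟩

theorem isHomotopyCartesian_of_isModelSquare {t : X ⟶ Y} {l : X ⟶ Z} {r : Y ⟶ W} {b : Z ⟶ W}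
    (h : IsModelSquare t l r b) : IsHomotopyCartesian t l r b := by
  obtain ⟨w, R, P, fst, snd, hP, u, h1, h2, hu⟩ := h
  have H : IsHomotopyCartesian fst snd R.r' R.b' := R.fib_leg.elim
    (fun hr => isHomotopyCartesian_of_isPullback hP hr)
    (fun hb => (isHomotopyCartesian_of_isPullback hP.flip hb).flip)
  exact H.of_weakEquivalence w u R.y R.z R.w h1 h2 R.comm_r R.comm_b hu R.weq_y R.weq_z R.weq_w

end DGMod

/-! ### Functors that preserve homotopy fiber sequences -/

namespace DGMod

variable {k : Type u} [Field k] {O : Type u} [CommRing O] [Algebra k O] {A : DGAlg k O}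

section Prod

variable (M N : DGMod A)

/-- The product of two `A`-modules. -/
noncomputable abbrev prd : DGMod A := pb (zeroHom M (zeroMod A)) (zeroHom N (zeroMod A))

/-- The first projection. -/
noncomputable abbrev prdFst : prd M N ⟶ M := pbFst _ _

/-- The second projection. -/
noncomputable abbrev prdSnd : prd M N ⟶ N := pbSnd _ _

theorem toZero_ext {M : DGMod A} (f g : M ⟶ zeroMod A) : f = g :=
  zeroMod_isZero.eq_of_tgt f g

variable {M N}

/-- The morphism to the product with two given components. -/
noncomputable abbrev prdLift {P : DGMod A} (f : P ⟶ M) (g : P ⟶ N) : P ⟶ prd M N :=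
  pbLift f g (toZero_ext _ _)

theorem exists_prd {n : ℕ} (x : M.X.X n) (y : N.X.X n) :
    ∃ z : (prd M N).X.X n, app (prdFst M N) n z = x ∧ app (prdSnd M N) n z = y :=
  exists_pb x y (Subsingleton.elim _ _)

variable (M N)

/-- The inclusion of the first factor. -/
noncomputable abbrev prdInl : M ⟶ prd M N := prdLift (𝟙 M) (zeroHom M N)

/-- The inclusion of the second factor. -/
noncomputable abbrev prdInr : N ⟶ prd M N := prdLift (zeroHom N M) (𝟙 N)

variable {M N}

/-- The morphism from the product, regarded as a sum, with two given components. -/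
noncomputable def prdDesc {P : DGMod A} (f : M ⟶ P) (g : N ⟶ P) : prd M N ⟶ P :=
  addHom (prdFst M N ≫ f) (prdSnd M N ≫ g)

theorem app_prdDesc {P : DGMod A} (f : M ⟶ P) (g : N ⟶ P) (n : ℕ) (z : (prd M N).X.X n) :
    app (prdDesc f g) n z = app f n (app (prdFst M N) n z) + app g n (app (prdSnd M N) n z) := rfl

theorem inl_prdDesc {P : DGMod A} (f : M ⟶ P) (g : N ⟶ P) : prdInl M N ≫ prdDesc f g = f :=
  hom_ext_app fun n x => by
    change app f n x + app g n 0 = _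
    rw [map_zero, add_zero]

theorem inr_prdDesc {P : DGMod A} (f : M ⟶ P) (g : N ⟶ P) : prdInr M N ≫ prdDesc f g = g :=
  hom_ext_app fun n x => by
    change app f n 0 + app g n x = _
    rw [map_zero, zero_add]

variable (M N)

theorem isPullback_prdInl :
    IsPullback (prdInl M N) (zeroHom M _) (prdSnd M N) (zeroHom (zeroMod A) N) :=
  isPullback_of_elements (hom_ext_app fun _ _ => rfl)
    (fun n _ h _ => congrArg (app (prdFst M N) n) h)
    (fun n y _ h => ⟨app (prdFst M N) n y, pb_ext rfl h.symm, Subsingleton.elim _ _⟩)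

theorem fibration_prdSnd : Fibration (prdSnd M N) := by
  rw [fibration_iff_surjective]
  intro n _ y
  obtain ⟨z, _, hz⟩ := exists_prd (M := M) 0 y
  exact ⟨z, hz⟩

end Prod

section Functor

variable {F : DGMod A ⥤ DGMod A}

/-- A functor that preserves homotopy fiber sequences maps strict fibers of fibrations to
homotopy fibers. -/
theorem isHomotopyCartesian_map_fiber (hF : PreservesHomotopyFiberSequences F)
    {K Y W : DGMod A} {i : K ⟶ Y} {l : K ⟶ zeroMod A}
    {r : Y ⟶ W} {b : zeroMod A ⟶ W} (h : IsPullback i l r b) (hr : Fibration r) :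
    IsHomotopyCartesian (F.map i) (F.map l) (F.map r) (F.map b) :=
  isHomotopyCartesian_of_isModelSquare
    (hF _ _ _ _ (isHomotopyFiberSequence_of_isPullback h hr)).1

theorem acyclic_map_zeroMod (hF : PreservesHomotopyFiberSequences F)
    : Acyclic (F.obj (zeroMod A)).X := by
  rw [← weakEquivalence_terminal_iff]
  have h : IsPullback (𝟙 (zeroMod A)) (𝟙 (zeroMod A)) (𝟙 (zeroMod A)) (𝟙 (zeroMod A)) :=
    IsPullback.of_horiz_isIso ⟨rfl⟩
  refine (hF _ _ _ _ (isHomotopyFiberSequence_of_isPullback h ?_)).2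
  rw [fibration_iff_surjective]
  exact fun n _ y => ⟨y, rfl⟩

theorem isBoundary_map_zeroHom (hF : PreservesHomotopyFiberSequences F)
    {M N : DGMod A} {n : ℕ} {x : (F.obj M).X.X n}
    (hx : IsCycle (F.obj M).X n x) :
    IsBoundary (F.obj N).X n (app (F.map (zeroHom M N)) n x) := by
  have e : zeroHom M (zeroMod A) ≫ zeroHom (zeroMod A) N = zeroHom M N := rfl
  rw [← e, F.map_comp, app_comp]
  exact (acyclic_map_zeroMod hF n _ (hx.map (F.map _).hom)).map (F.map _).hom

theorem exists_cycle_fiber (hF : PreservesHomotopyFiberSequences F)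
    {K Y W : DGMod A} {i : K ⟶ Y} {l : K ⟶ zeroMod A}
    {r : Y ⟶ W} {b : zeroMod A ⟶ W} (h : IsPullback i l r b) (hr : Fibration r) {n : ℕ}
    {y : (F.obj Y).X.X n} (hy : IsCycle (F.obj Y).X n y)
    (hb : IsBoundary (F.obj W).X n (app (F.map r) n y)) :
    ∃ x, IsCycle (F.obj K).X n x ∧ IsBoundary (F.obj Y).X n (app (F.map i) n x - y) := by
  obtain ⟨w, hw⟩ := hb
  obtain ⟨x, y', _, hx, h1, _⟩ := (isHomotopyCartesian_map_fiber hF h hr).surj n y 0 w hy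
    (isCycle_zero n) (by rw [map_zero, sub_zero]; exact hw.symm)
  exact ⟨x, hx, y', by rw [h1, add_sub_cancel_left]⟩

/-- The homology of `F (M × N)` embeds into that of `F M × F N`. -/
theorem isBoundary_map_prd (hF : PreservesHomotopyFiberSequences F)
    {M N : DGMod A} {n : ℕ} {x : (F.obj (prd M N)).X.X n}
    (hx : IsCycle _ n x) (h1 : IsBoundary _ n (app (F.map (prdFst M N)) n x))
    (h2 : IsBoundary _ n (app (F.map (prdSnd M N)) n x)) : IsBoundary _ n x := by
  obtain ⟨y, hy, hb⟩ := exists_cycle_fiber hF (isPullback_prdInl M N) (fibration_prdSnd M N) hx h2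
  have hy' : IsBoundary _ n y := by
    have e : app (F.map (prdFst M N)) n (app (F.map (prdInl M N)) n y) = y := by
      rw [← app_comp, ← F.map_comp, show prdInl M N ≫ prdFst M N = 𝟙 M from rfl, F.map_id, app_id]
    have := (hb.map (F.map (prdFst M N)).hom).add h1
    rw [map_sub, sub_add_cancel] at this
    exact e ▸ this
  have := (hy'.map (F.map (prdInl M N)).hom).sub hb
  rwa [sub_sub_cancel] at this

/-- In homology, `F (-1) = -1`. Indeed `(1, -1)` and `F ι₁ + F ι₂ F (-1)` have the same
components, and the sum map `N × N → N` kills `(1, -1)`. -/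
theorem isBoundary_map_negId (hF : PreservesHomotopyFiberSequences F)
    {N : DGMod A} {n : ℕ} {x : (F.obj N).X.X n}
    (hx : IsCycle _ n x) : IsBoundary _ n (app (F.map (negId N)) n x + x) := by
  have hx' : IsCycle _ n (app (F.map (negId N)) n x) := hx.map (F.map (negId N)).hom
  have h0 : ∀ {M : DGMod A} {y : (F.obj M).X.X n}, IsCycle _ n y →
      IsBoundary _ n (app (F.map (zeroHom M N)) n y) := fun hy => isBoundary_map_zeroHom hF hy
  have hb : IsBoundary _ n (app (F.map (prdInl N N)) n x +
      app (F.map (prdInr N N)) n (app (F.map (negId N)) n x) -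
        app (F.map (prdLift (𝟙 N) (negId N))) n x) := by
    refine isBoundary_map_prd hF (((hx.map (F.map _).hom).add (hx'.map (F.map _).hom)).sub
      (hx.map (F.map _).hom)) ?_ ?_
    · simp only [map_sub, map_add, ← app_comp, ← F.map_comp]
      rw [show prdInl N N ≫ prdFst N N = 𝟙 N from rfl,
        show prdLift (𝟙 N) (negId N) ≫ prdFst N N = 𝟙 N from rfl, add_sub_cancel_left,
        show (negId N ≫ prdInr N N) ≫ prdFst N N = zeroHom N N from rfl]
      exact h0 hx
    · simp only [map_sub, map_add, ← app_comp, ← F.map_comp]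
      rw [show (negId N ≫ prdInr N N) ≫ prdSnd N N = negId N from rfl,
        show prdLift (𝟙 N) (negId N) ≫ prdSnd N N = negId N from rfl, add_sub_cancel_right,
        show prdInl N N ≫ prdSnd N N = zeroHom N N from rfl]
      exact h0 hx
  have e : prdLift (𝟙 N) (negId N) ≫ prdDesc (𝟙 N) (𝟙 N) = zeroHom N N :=
    hom_ext_app fun n x => add_neg_cancel x
  have := (hb.map (F.map (prdDesc (𝟙 N) (𝟙 N))).hom).add (h0 hx)
  rw [← e] at this
  simp only [F.map_comp, map_sub, map_add] at this
  rw [app_comp, sub_add_cancel] at this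
  simp only [← app_comp] at this
  simp only [← F.map_comp] at this
  rw [inl_prdDesc, Category.assoc, inr_prdDesc, Category.comp_id, F.map_id, app_id] at this
  rwa [add_comm]

variable {X Y Z W : DGMod A}

/-- The central step: `F` maps the strict pullback `X` of a fibration `r : Y ⟶ W` along
`b : Z ⟶ W` to a homotopy cartesian square. The squares with the fibers of `r` and of `l` do not
suffice, as connected complexes do not see what happens at the lower end of their long exact
sequences; the missing surjectivity comes from the fiber sequence `X ⟶ Y × Z ⟶ W`. -/
theorem isHomotopyCartesian_map_of_isPullback (hF : PreservesHomotopyFiberSequences F)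
    {t : X ⟶ Y} {l : X ⟶ Z} {r : Y ⟶ W} {b : Z ⟶ W}
    (h : IsPullback t l r b) (hr : Fibration r) :
    IsHomotopyCartesian (F.map t) (F.map l) (F.map r) (F.map b) := by
  -- The fiber `K` of `r` is also the fiber of `l`.
  obtain ⟨K, i, i', z, hi, hK, hK'⟩ : ∃ (K : DGMod A) (i : K ⟶ Y) (i' : K ⟶ X)
      (z : K ⟶ zeroMod A), i' ≫ t = i ∧ IsPullback i z r (zeroHom _ W) ∧
        IsPullback i' z l (zeroHom _ Z) := by
    have H := isPullback_pb r (zeroHom (zeroMod A) W)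
    have e : zeroHom (zeroMod A) Z ≫ b = zeroHom (zeroMod A) W := zeroMod_isZero.eq_of_src _ _
    refine ⟨_, _, h.lift (pbFst r _) (pbSnd r _ ≫ zeroHom _ Z) ?_, _, h.lift_fst _ _ _, H, ?_⟩
    · rw [Category.assoc, e, H.w]
    · refine IsPullback.of_right ?_ (h.lift_snd _ _ _) h
      rw [h.lift_fst, e]
      exact H
  have hl : Fibration l := by
    rw [fibration_iff_surjective] at hr ⊢
    intro n hn c
    obtain ⟨y, hy⟩ := hr n hn (app b n c)
    obtain ⟨x, _, hx⟩ := isPullback_exists h y c hy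
    exact ⟨x, hx⟩
  have HK := isHomotopyCartesian_map_fiber hF hK hr
  have HK' := isHomotopyCartesian_map_fiber hF hK' hl
  have hi' : ∀ n x, app (F.map t) n (app (F.map i') n x) = app (F.map i) n x := fun n x => by
    rw [← app_comp, ← F.map_comp, hi]
  have hc : ∀ n x, app (F.map r) n (app (F.map t) n x) = app (F.map b) n (app (F.map l) n x) :=
    fun n x => by rw [← app_comp, ← app_comp, ← F.map_comp, ← F.map_comp, h.w]
  have hz : ∀ n x, app (F.map l) n (app (F.map i') n x) =
      app (F.map (zeroHom _ Z)) n (app (F.map z) n x) := fun n x => by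
    rw [← app_comp, ← app_comp, ← F.map_comp, ← F.map_comp, hK'.w]
  have hzb : ∀ n x, app (F.map b) n (app (F.map (zeroHom _ Z)) n x) =
      app (F.map (zeroHom (zeroMod A) W)) n x := fun n x => by
    rw [← app_comp, ← F.map_comp]
    congr 3
    exact zeroMod_isZero.eq_of_src _ _
  refine ⟨by rw [← F.map_comp, ← F.map_comp, h.w], ?_, ?_⟩
  · intro n α β γ δ hα hβ hγ hδ
    obtain ⟨κ, α', ζ, hκ, h1, h2, ⟨γ', h3⟩⟩ := HK'.surj n α 0 γ hα (isCycle_zero n) (by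
      rw [map_zero, sub_zero, hγ])
    rw [zero_add] at h2
    have h3' : app (F.map (zeroHom (zeroMod A) Z)) (n + 1) ζ =
        γ + app (F.map l) (n + 1) α' - (F.obj Z).d _ _ γ' := by
      change _ = _ - ((F.obj Z).X.d _ _).hom γ'
      rw [h3, sub_sub_cancel]
    have hκb : IsBoundary _ n κ := by
      refine HK.inj n κ (β + app (F.map t) _ α') ζ (δ + app (F.map b) _ γ') hκ ?_ h2 ?_
      · rw [← hi', h1, map_add, map_add, app_d, hβ]
      · rw [← hzb, h3', map_add, map_add, ← hδ, hc, map_sub, map_add, app_d]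
        abel
    have := hκb.map (F.map i').hom
    have e : α = app (F.map i') n κ - (F.obj X).d (n + 1) n α' := by rw [h1]; abel
    rw [e]
    exact this.sub (isBoundary_d n α')
  · intro n β γ δ hβ hγ hδ
    -- First `β` and `γ` are lifted, by means of the fiber sequence `X ⟶ Y × Z ⟶ W`.
    obtain ⟨α, hα, ⟨β', hβ'⟩, ⟨γ', hγ'⟩⟩ : ∃ α, IsCycle _ n α ∧
        IsBoundary _ n (app (F.map t) n α - β) ∧ IsBoundary _ n (app (F.map l) n α - γ) := by
      have hj : IsPullback (prdLift t (l ≫ negId Z)) (zeroHom X _) (prdDesc r b)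
          (zeroHom (zeroMod A) W) := by
        refine isPullback_of_elements (hom_ext_app fun n x => ?_) (fun n x h1 _ => ?_)
          (fun n y z hyz => ?_)
        · change app r n (app t n x) + app b n (-app l n x) = 0
          rw [map_neg, ← app_comp, ← app_comp, h.w, add_neg_cancel]
        · refine isPullback_ext h ?_ ?_
          · rw [map_zero]
            exact congrArg (app (prdFst Y Z) n) h1
          · rw [map_zero]
            exact neg_eq_zero.1 (congrArg (app (prdSnd Y Z) n) h1)
        · obtain ⟨x, h1, h2⟩ := isPullback_exists h (app (prdFst Y Z) n y)
            (-app (prdSnd Y Z) n y) (by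
              rw [map_neg]
              exact eq_neg_of_add_eq_zero_left hyz)
          refine ⟨x, pb_ext h1 ?_, Subsingleton.elim _ _⟩
          change -app l n x = _
          rw [h2, neg_neg]
      have hq : Fibration (prdDesc r b) := by
        rw [fibration_iff_surjective] at hr ⊢
        intro n hn c
        obtain ⟨y, rfl⟩ := hr n hn c
        exact ⟨app (prdInl Y Z) n y, app_app_of_comp_eq (inl_prdDesc r b) n y⟩
      obtain ⟨α, hα, hb⟩ := exists_cycle_fiber hF hj hq
        (y := app (F.map (prdInl Y Z)) n β - app (F.map (prdInr Y Z)) n γ)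
        ((hβ.map (F.map _).hom).sub (hγ.map (F.map _).hom)) ⟨δ, by
          rw [map_sub, ← app_comp, ← app_comp, ← F.map_comp, ← F.map_comp, inl_prdDesc,
            inr_prdDesc, hδ]⟩
      refine ⟨α, hα, ?_, ?_⟩
      · have h1 := (hb.map (F.map (prdFst Y Z)).hom).sub (isBoundary_map_zeroHom hF (N := Y) hγ)
        rw [map_sub, map_sub] at h1
        simp only [← app_comp, ← F.map_comp] at h1
        rw [show prdLift t (l ≫ negId Z) ≫ prdFst Y Z = t from rfl,
          show prdInl Y Z ≫ prdFst Y Z = 𝟙 Y from rfl,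
          show prdInr Y Z ≫ prdFst Y Z = zeroHom Z Y from rfl, F.map_id, app_id] at h1
        convert h1 using 1
        abel
      · have h1 := (hb.map (F.map (prdSnd Y Z)).hom).add (isBoundary_map_zeroHom hF (N := Z) hβ)
        rw [map_sub, map_sub] at h1
        simp only [← app_comp, ← F.map_comp] at h1
        rw [show prdLift t (l ≫ negId Z) ≫ prdSnd Y Z = l ≫ negId Z from rfl,
          show prdInl Y Z ≫ prdSnd Y Z = zeroHom Y Z from rfl,
          show prdInr Y Z ≫ prdSnd Y Z = 𝟙 Z from rfl, F.map_id, app_id, F.map_comp,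
          app_comp] at h1
        have h2 := isBoundary_map_negId hF (hα.map (F.map l).hom)
        convert h2.sub h1 using 1
        abel
    -- The remaining error, a cycle in `F W`, is compensated by an element of `F K`.
    have hε : IsCycle _ (n + 1) (δ + app (F.map r) _ β' - app (F.map b) _ γ') := by
      change (F.obj W).d (n + 1) n _ = 0
      have e1 : (F.obj Y).d (n + 1) n β' = app (F.map t) n α - β := hβ'
      have e2 : (F.obj Z).d (n + 1) n γ' = app (F.map l) n α - γ := hγ'
      rw [map_sub, map_add, ← app_d, ← app_d, ← hδ, e1, e2, map_sub, map_sub, hc]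
      abel
    obtain ⟨κ, β₂, ζ, hκ, h1, h2, h3⟩ := HK.surj n 0 0
      (δ + app (F.map r) _ β' - app (F.map b) _ γ') (isCycle_zero n) (isCycle_zero n) (by
        rw [map_zero, map_zero, sub_zero]
        exact hε.symm)
    rw [zero_add] at h1 h2
    refine ⟨α + app (F.map i') n κ, β' + β₂, γ' + app (F.map (zeroHom _ Z)) _ ζ,
      hα.add (hκ.map (F.map i').hom), ?_, ?_, ?_⟩
    · rw [map_add, hi', h1, map_add]
      change _ = β + (((F.obj Y).X.d _ _).hom β' + _)
      rw [hβ']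
      abel
    · rw [map_add, hz, h2, map_add, app_d]
      change _ = γ + (((F.obj Z).X.d _ _).hom γ' + _)
      rw [hγ']
      abel
    · rw [map_add, map_add, hzb]
      convert h3 using 1
      abel

theorem isHomotopyCartesian_map_of_isModelSquare (hF : PreservesHomotopyFiberSequences F)
    (hw : PreservesWeakEquivalences F) {t : X ⟶ Y}
    {l : X ⟶ Z} {r : Y ⟶ W} {b : Z ⟶ W} (h : IsModelSquare t l r b) :
    IsHomotopyCartesian (F.map t) (F.map l) (F.map r) (F.map b) := by
  obtain ⟨w, R, P, fst, snd, hP, u, h1, h2, hu⟩ := h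
  have H : IsHomotopyCartesian (F.map fst) (F.map snd) (F.map R.r') (F.map R.b') := R.fib_leg.elim
    (fun hr => isHomotopyCartesian_map_of_isPullback hF hP hr)
    (fun hb => (isHomotopyCartesian_map_of_isPullback hF hP.flip hb).flip)
  refine H.of_weakEquivalence ?_ (F.map u) (F.map R.y) (F.map R.z) (F.map R.w) ?_ ?_ ?_ ?_
    (hw _ hu) (hw _ R.weq_y) (hw _ R.weq_z) (hw _ R.weq_w)
  · rw [← F.map_comp, ← F.map_comp, w]
  · rw [← F.map_comp, ← F.map_comp, h1]
  · rw [← F.map_comp, ← F.map_comp, h2]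
  · rw [← F.map_comp, ← F.map_comp, R.comm_r]
  · rw [← F.map_comp, ← F.map_comp, R.comm_b]

end Functor

end DGMod

/-! ### Graded modules and the contractible modules that they cogenerate -/

section Graded

variable {k : Type u} [Field k] {O : Type u} [CommRing O] [Algebra k O]

/-- A graded module over the graded algebra underlying `A`, in the category of `𝒟`-modules: an
`A`-module without a differential. -/
structure GrMod (A : DGAlg k O) where
  /-- the components -/
  X : ℕ → ModuleCat.{u} (DiffOp k O)
  /-- the action of `A` -/
  act (p q n : ℕ) : A.X.X p →+ X q →+ X n
  act_shape : ∀ p q n, p + q ≠ n → act p q n = 0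
  fun_act : ∀ p q n (f : O) (a : A.X.X p) (x : X q),
    act p q n (DiffOp.ofFun k f • a) x = DiffOp.ofFun k f • act p q n a x
  act_fun : ∀ p q n (f : O) (a : A.X.X p) (x : X q),
    act p q n a (DiffOp.ofFun k f • x) = DiffOp.ofFun k f • act p q n a x
  der_act : ∀ p q n (θ : Derivation k O O) (a : A.X.X p) (x : X q),
    DiffOp.ofDer θ • act p q n a x =
      act p q n (DiffOp.ofDer θ • a) x + act p q n a (DiffOp.ofDer θ • x)
  one_act : ∀ n (x : X n), act 0 n n A.one x = x
  act_act : ∀ p q r s t n, p + q = s → q + r = t → s + r = n →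
    ∀ (a : A.X.X p) (b : A.X.X q) (x : X r),
      act s r n (A.mul p q s a b) x = act p t n a (act q r t b x)

variable {A : DGAlg k O}

/-- The graded module underlying an `A`-module. -/
def DGMod.toGr (M : DGMod A) : GrMod A where
  X := M.X.X
  act := M.act
  act_shape := M.act_shape
  fun_act := M.fun_act
  act_fun := M.act_fun
  der_act := M.der_act
  one_act := M.one_act
  act_act := M.act_act

namespace GrMod

/-- Morphisms of graded modules. -/
structure Hom (Y Y' : GrMod A) where
  /-- the components -/
  app (n : ℕ) : Y.X n →ₗ[DiffOp k O] Y'.X n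
  map_act : ∀ p q n, p + q = n → ∀ (a : A.X.X p) (x : Y.X q),
    app n (Y.act p q n a x) = Y'.act p q n a (app q x)

/-- The shifted module, with components `D_{n + 1}` and Koszul signs in the action. -/
noncomputable def shift (D : DGMod A) : GrMod A where
  X n := D.X.X (n + 1)
  act p q n := (-1 : ℤ) ^ p • D.act p (q + 1) (n + 1)
  act_shape p q n h := by rw [D.act_shape p (q + 1) (n + 1) (by omega), smul_zero]
  fun_act p q n f a x := by
    simp only [AddMonoidHom.zsmul_apply, D.fun_act, smul_comm (DiffOp.ofFun k f) ((-1 : ℤ) ^ p)]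
  act_fun p q n f a x := by
    simp only [AddMonoidHom.zsmul_apply, D.act_fun, smul_comm (DiffOp.ofFun k f) ((-1 : ℤ) ^ p)]
  der_act p q n θ a x := by
    simp only [AddMonoidHom.zsmul_apply, D.der_act, smul_comm (DiffOp.ofDer θ) ((-1 : ℤ) ^ p),
      smul_add]
  one_act n x := by rw [pow_zero, one_smul, D.one_act]
  act_act p q r s t n hs ht hn a b x := by
    simp only [AddMonoidHom.zsmul_apply, map_zsmul]
    rw [D.act_act p q (r + 1) s (t + 1) (n + 1) hs (by omega) (by omega), smul_smul, ← pow_add,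
      add_comm q p, hs]

variable (Y : GrMod A)

/-- The component `Y_n × Y_{n - 1}` of the module `coneObj Y`. The second factor is encoded as a
product over all `j` with `j + 1 = n`, so that it vanishes for `n = 0`. -/
abbrev ConeX (n : ℕ) : Type u := Y.X n × (∀ j : {j : ℕ // j + 1 = n}, Y.X j.1)

/-- The component of degree `j` of the second entry of an element of `ConeX Y i`; it is zero
unless `j + 1 = i`. -/
noncomputable def sndAt (i j : ℕ) : ConeX Y i →ₗ[DiffOp k O] Y.X j :=
  if h : j + 1 = i then
    (LinearMap.proj (R := DiffOp k O) (φ := fun j : {j : ℕ // j + 1 = i} => Y.X j.1)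
      ⟨j, h⟩) ∘ₗ LinearMap.snd (DiffOp k O) (Y.X i) _
  else 0

variable {Y}

theorem sndAt_of_eq {i j : ℕ} (h : j + 1 = i) (x : ConeX Y i) : sndAt Y i j x = x.2 ⟨j, h⟩ := by
  rw [sndAt, dif_pos h]; rfl

theorem sndAt_of_ne {i j : ℕ} (h : j + 1 ≠ i) (x : ConeX Y i) : sndAt Y i j x = 0 := by
  rw [sndAt, dif_neg h]; rfl

theorem coneX_ext {n : ℕ} {x y : ConeX Y n} (h1 : x.1 = y.1)
    (h2 : ∀ j, j + 1 = n → sndAt Y n j x = sndAt Y n j y) : x = y :=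
  Prod.ext h1 (funext fun j => by
    have := h2 j.1 j.2
    rwa [sndAt_of_eq j.2, sndAt_of_eq j.2] at this)

variable (Y)

/-- The differential `(x, y) ↦ (y, 0)`. -/
noncomputable def coneD (i j : ℕ) : ConeX Y i →ₗ[DiffOp k O] ConeX Y j :=
  LinearMap.inl _ _ _ ∘ₗ sndAt Y i j

/-- The action `a (x, y) = (a x, (d a) x + (-1)^|a| a y)`. -/
noncomputable def coneAct (p q n : ℕ) : A.X.X p →+ ConeX Y q →+ ConeX Y n :=
  biadd (fun a x => (Y.act p q n a x.1, fun j => Y.act (p - 1) q j ((A.X.d p (p - 1)).hom a) x.1 +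
      (-1 : ℤ) ^ p • Y.act p (q - 1) j a (sndAt Y q (q - 1) x)))
    (fun a b x => by
      refine Prod.ext ?_ (funext fun j => ?_)
      · simp only [map_add, AddMonoidHom.add_apply, Prod.mk_add_mk]
      · simp only [map_add, AddMonoidHom.add_apply, smul_add, Prod.snd_add, Pi.add_apply]
        abel)
    (fun a x y => by
      refine Prod.ext ?_ (funext fun j => ?_)
      · simp only [map_add, Prod.fst_add]
      · simp only [map_add, smul_add, Prod.snd_add, Prod.fst_add, Pi.add_apply]
        abel)

variable {Y}

theorem coneAct_fst (p q n : ℕ) (a : A.X.X p) (x : ConeX Y q) :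
    (coneAct Y p q n a x).1 = Y.act p q n a x.1 := rfl

theorem sndAt_coneAct {p q n j : ℕ} (h : j + 1 = n) (a : A.X.X p) (x : ConeX Y q) :
    sndAt Y n j (coneAct Y p q n a x) =
      Y.act (p - 1) q j ((A.X.d p (p - 1)).hom a) x.1 +
        (-1 : ℤ) ^ p • Y.act p (q - 1) j a (sndAt Y q (q - 1) x) := sndAt_of_eq h _

theorem sndAt_zero (j : ℕ) (x : ConeX Y 0) : sndAt Y 0 j x = 0 := sndAt_of_ne (by omega) x

theorem sndAt_coneAct' {p q n : ℕ} (h : p + q = n) (a : A.X.X p) (x : ConeX Y q) :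
    sndAt Y n (n - 1) (coneAct Y p q n a x) =
      Y.act (p - 1) q (n - 1) ((A.X.d p (p - 1)).hom a) x.1 +
        (-1 : ℤ) ^ p • Y.act p (q - 1) (n - 1) a (sndAt Y q (q - 1) x) := by
  rcases n with _ | n
  · obtain rfl : p = 0 := by omega
    obtain rfl : q = 0 := by omega
    rw [sndAt_zero, sndAt_zero, dgd_zero]
    simp
  · exact sndAt_coneAct rfl a x

theorem coneD_fst (i j : ℕ) (x : ConeX Y i) : (coneD Y i j x).1 = sndAt Y i j x := rfl

theorem sndAt_coneD (i j l : ℕ) (x : ConeX Y i) : sndAt Y j l (coneD Y i j x) = 0 := by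
  by_cases h : l + 1 = j
  · rw [sndAt_of_eq h]; rfl
  · exact sndAt_of_ne h _

theorem coneAct_shape (p q n : ℕ) (h : p + q ≠ n) : coneAct Y p q n = 0 := by
  refine AddMonoidHom.ext fun a => AddMonoidHom.ext fun x => coneX_ext ?_ fun j hj => ?_
  · rw [coneAct_fst, Y.act_shape p q n h]; rfl
  · rw [sndAt_coneAct hj]
    simp only [AddMonoidHom.zero_apply, map_zero]
    rcases p with _ | p
    · rw [dgd_zero]
      rcases q with _ | q
      · rw [sndAt_zero]; simp
      · rw [Y.act_shape 0 (q + 1 - 1) j (by omega)]; simp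
    · rw [Y.act_shape (p + 1 - 1) q j (by omega)]
      rcases q with _ | q
      · rw [sndAt_zero]; simp
      · rw [Y.act_shape (p + 1) (q + 1 - 1) j (by omega)]; simp

theorem fun_coneAct (p q n : ℕ) (f : O) (a : A.X.X p) (x : ConeX Y q) :
    coneAct Y p q n (DiffOp.ofFun k f • a) x = DiffOp.ofFun k f • coneAct Y p q n a x := by
  refine coneX_ext (Y.fun_act p q n f a x.1) fun j hj => ?_
  simp only [sndAt_coneAct hj, map_smul, Y.fun_act, smul_add,
    smul_comm (DiffOp.ofFun k f) ((-1 : ℤ) ^ p)]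

theorem coneAct_fun (p q n : ℕ) (f : O) (a : A.X.X p) (x : ConeX Y q) :
    coneAct Y p q n a (DiffOp.ofFun k f • x) = DiffOp.ofFun k f • coneAct Y p q n a x := by
  refine coneX_ext (Y.act_fun p q n f a x.1) fun j hj => ?_
  simp only [sndAt_coneAct hj, map_smul, Y.act_fun, smul_add, Prod.smul_fst,
    smul_comm (DiffOp.ofFun k f) ((-1 : ℤ) ^ p)]

theorem der_coneAct (p q n : ℕ) (θ : Derivation k O O) (a : A.X.X p) (x : ConeX Y q) :
    DiffOp.ofDer θ • coneAct Y p q n a x =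
      coneAct Y p q n (DiffOp.ofDer θ • a) x + coneAct Y p q n a (DiffOp.ofDer θ • x) := by
  refine coneX_ext (Y.der_act p q n θ a x.1) fun j hj => ?_
  simp only [sndAt_coneAct hj, map_smul, map_add, Y.der_act, smul_add, Prod.smul_fst,
    smul_comm (DiffOp.ofDer θ) ((-1 : ℤ) ^ p)]
  abel

theorem coneD_coneAct (p q n : ℕ) (h : p + q = n) (a : A.X.X p) (x : ConeX Y q) :
    coneD Y n (n - 1) (coneAct Y p q n a x) =
      coneAct Y (p - 1) q (n - 1) ((A.X.d p (p - 1)).hom a) x +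
        (-1 : ℤ) ^ p • coneAct Y p (q - 1) (n - 1) a (coneD Y q (q - 1) x) := by
  refine coneX_ext (sndAt_coneAct' h a x) fun j hj => ?_
  rw [sndAt_coneD, map_add, map_zsmul, sndAt_coneAct hj, sndAt_coneAct hj, sndAt_coneD, coneD_fst,
    dgd_dgd]
  rcases p with _ | p
  · simp only [dgd_zero]
    simp
  · simp [pow_succ]

theorem one_coneAct (n : ℕ) (x : ConeX Y n) : coneAct Y 0 n n A.one x = x := by
  refine coneX_ext (Y.one_act n x.1) fun j hj => ?_
  subst hj
  rw [sndAt_coneAct rfl, dgd_zero]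
  simp only [map_zero, AddMonoidHom.zero_apply, pow_zero, one_smul, zero_add]
  exact Y.one_act j _

theorem coneAct_coneAct (p q r s t n : ℕ) (hs : p + q = s) (ht : q + r = t) (hn : s + r = n)
    (a : A.X.X p) (b : A.X.X q) (x : ConeX Y r) :
    coneAct Y s r n (A.mul p q s a b) x = coneAct Y p t n a (coneAct Y q r t b x) := by
  refine coneX_ext (Y.act_act p q r s t n hs ht hn a b x.1) fun j hj => ?_
  rw [sndAt_coneAct hj, sndAt_coneAct hj, sndAt_coneAct' ht, coneAct_fst, A.d_mul p q s hs]
  simp only [map_add, map_zsmul, AddMonoidHom.add_apply, AddMonoidHom.zsmul_apply, smul_add,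
    smul_smul]
  have e1 : Y.act (s - 1) r j (A.mul (p - 1) q (s - 1) ((A.X.d p (p - 1)).hom a) b) x.1 =
      Y.act (p - 1) t j ((A.X.d p (p - 1)).hom a) (Y.act q r t b x.1) := by
    rcases p with _ | p
    · simp only [dgd_zero, map_zero, AddMonoidHom.zero_apply]
    · exact Y.act_act _ _ _ _ _ _ (by omega) ht (by omega) _ _ _
  have e2 : Y.act (s - 1) r j (A.mul p (q - 1) (s - 1) a ((A.X.d q (q - 1)).hom b)) x.1 =
      Y.act p (t - 1) j a (Y.act (q - 1) r (t - 1) ((A.X.d q (q - 1)).hom b) x.1) := by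
    rcases q with _ | q
    · simp only [dgd_zero, map_zero, AddMonoidHom.zero_apply]
    · exact Y.act_act _ _ _ _ _ _ (by omega) (by omega) (by omega) _ _ _
  have e3 : Y.act s (r - 1) j (A.mul p q s a b) (sndAt Y r (r - 1) x) =
      Y.act p (t - 1) j a (Y.act q (r - 1) (t - 1) b (sndAt Y r (r - 1) x)) := by
    rcases r with _ | r
    · simp only [sndAt_zero, map_zero]
    · exact Y.act_act _ _ _ _ _ _ hs (by omega) (by omega) _ _ _
  rw [e1, e2, e3, ← pow_add, hs, add_assoc]

variable (Y)

/-- The complex underlying `coneObj Y`. -/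
noncomputable def coneCx : DGDM k O where
  X n := ModuleCat.of (DiffOp k O) (ConeX Y n)
  d i j := ModuleCat.ofHom (coneD Y i j)
  shape i j h := ModuleCat.hom_ext (LinearMap.ext fun x =>
    coneX_ext (sndAt_of_ne h x) fun l _ => (sndAt_coneD i j l x).trans (map_zero _).symm)
  d_comp_d' i j l _ _ := ModuleCat.hom_ext (LinearMap.ext fun x =>
    coneX_ext (sndAt_coneD i j l x) fun m _ =>
      (sndAt_coneD j l m (coneD Y i j x)).trans (map_zero _).symm)

/-- The `A`-module cogenerated by a graded module `Y`: its elements of degree `n` are the pairs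
`(x, y)` in `Y_n × Y_{n - 1}`, and `d (x, y) = (y, 0)`. Morphisms `C ⟶ coneObj Y` correspond to
morphisms of graded modules `C → Y`. It is the cone of the identity of `Y`, in coordinates that
make sense without a differential on `Y`. -/
noncomputable def coneObj : DGMod A where
  X := coneCx Y
  act := coneAct Y
  act_shape := coneAct_shape
  fun_act := fun_coneAct
  act_fun := coneAct_fun
  der_act := der_coneAct
  d_act := coneD_coneAct
  one_act := one_coneAct
  act_act := coneAct_coneAct

/-- The contraction `(x, y) ↦ (0, x)` of `coneObj Y`. -/
noncomputable def coneH (n : ℕ) : ConeX Y n →ₗ[DiffOp k O] ConeX Y (n + 1) :=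
  LinearMap.inr _ _ _ ∘ₗ (LinearMap.pi fun j : {j : ℕ // j + 1 = n + 1} =>
    (Nat.succ.inj j.2).symm ▸ LinearMap.id) ∘ₗ LinearMap.fst _ _ _

variable {Y}

theorem coneH_fst (n : ℕ) (x : ConeX Y n) : (coneH Y n x).1 = 0 := rfl

theorem sndAt_coneH (n : ℕ) (x : ConeX Y n) : sndAt Y (n + 1) n (coneH Y n x) = x.1 :=
  sndAt_of_eq rfl _

theorem coneD_coneH_zero (x : ConeX Y 0) : coneD Y 1 0 (coneH Y 0 x) = x :=
  coneX_ext (sndAt_coneH 0 x) fun j hj => by omega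

theorem coneD_coneH (n : ℕ) (x : ConeX Y (n + 1)) :
    coneD Y (n + 2) (n + 1) (coneH Y (n + 1) x) + coneH Y n (coneD Y (n + 1) n x) = x := by
  refine coneX_ext ?_ fun j hj => ?_
  · rw [Prod.fst_add, coneD_fst, sndAt_coneH, coneH_fst, add_zero]
  · obtain rfl : j = n := by omega
    rw [map_add, sndAt_coneD, sndAt_coneH, coneD_fst, zero_add]

theorem coneH_coneAct (r p s : ℕ) (h : r + p = s) (a : A.X.X r) (x : ConeX Y p) :
    coneH Y s (coneAct Y r p s a x) =
      (-1 : ℤ) ^ r • coneAct Y r (p + 1) (s + 1) a (coneH Y p x) := by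
  refine coneX_ext ?_ fun j hj => ?_
  · rw [Prod.smul_fst, coneAct_fst, coneH_fst, coneH_fst, map_zero, smul_zero]
  · obtain rfl : j = s := by omega
    rw [map_zsmul, sndAt_coneH, sndAt_coneAct rfl, coneH_fst, map_zero, zero_add, coneAct_fst,
      Nat.add_sub_cancel, sndAt_coneH, smul_smul, ← pow_add, ← two_mul, pow_mul]
    simp

theorem acyclic_coneObj : Acyclic (coneObj Y).X := by
  intro n x hx
  rcases n with _ | n
  · exact ⟨coneH Y 0 x, coneD_coneH_zero x⟩
  · refine ⟨coneH Y (n + 1) x, ?_⟩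
    have h0 : coneD Y (n + 1) n x = 0 := hx
    have := coneD_coneH n x
    rw [h0, map_zero, add_zero] at this
    exact this

/-- The components `c ↦ (s c, s (d c))` of `toCone s`. -/
noncomputable def toConeLin {C : DGMod A} (s : Hom C.toGr Y) (n : ℕ) :
    C.X.X n →ₗ[DiffOp k O] ConeX Y n :=
  LinearMap.prod (s.app n) (LinearMap.pi fun j => (s.app j.1).comp (M₂ := C.X.X j.1) (C.d n j.1))

theorem toConeLin_fst {C : DGMod A} (s : Hom C.toGr Y) (n : ℕ) (x : C.X.X n) :
    (toConeLin s n x).1 = s.app n x := rfl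

theorem sndAt_toConeLin {C : DGMod A} (s : Hom C.toGr Y) (n j : ℕ) (x : C.X.X n) :
    sndAt Y n j (toConeLin s n x) = s.app j (C.d n j x) := by
  by_cases h : j + 1 = n
  · exact sndAt_of_eq h _
  · rw [sndAt_of_ne h, DGMod.d_eq_zero_of_ne C h]
    exact (map_zero (s.app j)).symm

/-- The morphism of `A`-modules to `coneObj Y` that corresponds to a morphism to `Y` of graded
modules. -/
noncomputable def toCone {C : DGMod A} (s : Hom C.toGr Y) : C ⟶ coneObj Y :=
  DGMod.mkHom (N := coneObj Y) (toConeLin s)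
    (fun n x => by
      change coneD Y (n + 1) n (toConeLin s (n + 1) x) = toConeLin s n (C.d (n + 1) n x)
      refine coneX_ext (sndAt_toConeLin s _ _ x) fun j _ => ?_
      rw [sndAt_coneD, sndAt_toConeLin, show C.d n j (C.d (n + 1) n x) = 0 from
        dgd_dgd C.X _ _ _ x]
      exact (map_zero (s.app j)).symm)
    (fun p q n h a x => by
      change toConeLin s n (C.act p q n a x) = coneAct Y p q n a (toConeLin s q x)
      refine coneX_ext (s.map_act p q n h a x) fun j hj => ?_
      obtain rfl : j = n - 1 := by omega
      rw [sndAt_coneAct hj, sndAt_toConeLin, sndAt_toConeLin,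
        show C.d n (n - 1) (C.act p q n a x) = _ from C.d_act p q n h a x, toConeLin_fst]
      refine (map_add (s.app (n - 1)) _ _).trans ?_
      congr 1
      · rcases p with _ | p
        · simp only [dgd_zero, map_zero, AddMonoidHom.zero_apply]
          exact map_zero (s.app _)
        · exact s.map_act _ _ _ (by omega) _ _
      · refine (map_zsmul (s.app (n - 1)) _ _).trans ?_
        rcases q with _ | q
        · rw [dgd_zero, map_zero]
          congr 1
          exact (map_zero (s.app _)).trans ((congrArg _ (map_zero (s.app _))).trans
            (map_zero _)).symm
        · exact congrArg _ (s.map_act _ _ _ (by omega) _ _))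

/-- The first component of a morphism to `coneObj Y`. -/
noncomputable def fromCone {C : DGMod A} (φ : C ⟶ coneObj Y) : Hom C.toGr Y where
  app n := LinearMap.fst (DiffOp k O) (Y.X n) (∀ j : {j : ℕ // j + 1 = n}, Y.X j.1) ∘ₗ
    DGMod.app φ n
  map_act p q n _ a x := congrArg Prod.fst (φ.map_act p q n a x)

/-- The components of `coneMap ψ`. -/
noncomputable def coneLin {Y' : GrMod A} (ψ : Hom Y Y') (n : ℕ) :
    ConeX Y n →ₗ[DiffOp k O] ConeX Y' n :=
  (ψ.app n).prodMap (LinearMap.pi fun j => ψ.app j.1 ∘ₗ LinearMap.proj j)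

theorem coneLin_fst {Y' : GrMod A} (ψ : Hom Y Y') (n : ℕ) (x : ConeX Y n) :
    (coneLin ψ n x).1 = ψ.app n x.1 := rfl

theorem sndAt_coneLin {Y' : GrMod A} (ψ : Hom Y Y') (n j : ℕ) (x : ConeX Y n) :
    sndAt Y' n j (coneLin ψ n x) = ψ.app j (sndAt Y n j x) := by
  by_cases h : j + 1 = n
  · rw [sndAt_of_eq h, sndAt_of_eq h]; rfl
  · rw [sndAt_of_ne h, sndAt_of_ne h, map_zero]

/-- The functoriality of `coneObj`. -/
noncomputable def coneMap {Y' : GrMod A} (ψ : Hom Y Y') : coneObj Y ⟶ coneObj Y' :=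
  DGMod.mkHom (M := coneObj Y) (N := coneObj Y') (coneLin ψ)
    (fun n (x : ConeX Y (n + 1)) => by
      change coneD Y' (n + 1) n (coneLin ψ (n + 1) x) = coneLin ψ n (coneD Y (n + 1) n x)
      refine coneX_ext (sndAt_coneLin ψ _ _ x) fun j _ => ?_
      rw [sndAt_coneD, sndAt_coneLin, sndAt_coneD, map_zero])
    (fun p q n h a (x : ConeX Y q) => by
      change coneLin ψ n (coneAct Y p q n a x) = coneAct Y' p q n a (coneLin ψ q x)
      refine coneX_ext (ψ.map_act p q n h a x.1) fun j hj => ?_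
      rw [sndAt_coneAct hj, sndAt_coneLin, sndAt_coneLin, sndAt_coneAct hj, coneLin_fst, map_add,
        map_zsmul]
      congr 1
      · rcases p with _ | p
        · simp only [dgd_zero, map_zero, AddMonoidHom.zero_apply]
        · exact ψ.map_act _ _ _ (by omega) _ _
      · rcases q with _ | q
        · rw [sndAt_zero]
          simp only [map_zero]
        · exact congrArg _ (ψ.map_act _ _ _ (by omega) _ _))

theorem coneMap_surjective {Y' : GrMod A} (ψ : Hom Y Y')
    (h : ∀ n, Function.Surjective (ψ.app n)) (n : ℕ) :
    Function.Surjective (DGMod.app (coneMap ψ) n) := by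
  intro x
  obtain ⟨y, hy⟩ := h n x.1
  choose z hz using fun j : {j : ℕ // j + 1 = n} => h j.1 (x.2 j)
  exact ⟨(y, z), Prod.ext hy (funext hz)⟩

end GrMod

namespace DGMod

open GrMod

variable (D : DGMod A)

/-- A contractible module with a fibration to `D`, the analogue of the space of paths in `D` with
fixed end point. -/
noncomputable def pathObj : DGMod A := coneObj (shift D)

/-- The second component, in `D_n`, of an element of degree `n` of `pathObj D`. -/
noncomputable def pathSnd : ∀ n, ConeX (shift D) n →ₗ[DiffOp k O] D.X.X n
  | 0 => 0
  | n + 1 => sndAt (shift D) (n + 1) n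

/-- The components `(y, x) ↦ d y + x` of `pathEval D`. -/
noncomputable def pathLin (n : ℕ) : ConeX (shift D) n →ₗ[DiffOp k O] D.X.X n :=
  LinearMap.comp (M₁ := ConeX (shift D) n) (M₂ := D.X.X (n + 1)) (D.d (n + 1) n)
    (LinearMap.fst (DiffOp k O) ((shift D).X n) _) + pathSnd D n

theorem pathLin_apply (n : ℕ) (x : ConeX (shift D) n) :
    pathLin D n x = D.d (n + 1) n x.1 + pathSnd D n x := rfl

/-- The fibration `(y, x) ↦ d y + x`. -/
noncomputable def pathEval : pathObj D ⟶ D :=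
  mkHom (M := pathObj D) (pathLin D)
    (fun n (x : ConeX (shift D) (n + 1)) => by
      change D.d (n + 1) n (pathLin D (n + 1) x) = pathLin D n (coneD (shift D) (n + 1) n x)
      have h : pathSnd D n (coneD (shift D) (n + 1) n x) = 0 := by
        rcases n with _ | n
        · rfl
        · exact sndAt_coneD _ _ _ x
      rw [pathLin_apply, pathLin_apply, h, map_add, add_zero,
        show D.d (n + 1) n (D.d (n + 2) (n + 1) x.1) = 0 from dgd_dgd D.X _ _ _ _, zero_add]
      rfl)
    (fun p q n h a (x : ConeX (shift D) q) => by
      change pathLin D n (coneAct (shift D) p q n a x) = D.act p q n a (pathLin D q x)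
      have h1 : D.d (n + 1) n (D.act p (q + 1) (n + 1) a x.1) =
          D.act (p - 1) (q + 1) n ((A.X.d p (p - 1)).hom a) x.1 +
            (-1 : ℤ) ^ p • D.act p q n a (D.d (q + 1) q x.1) :=
        D.d_act p (q + 1) (n + 1) (by omega) a x.1
      rw [pathLin_apply, pathLin_apply]
      change D.d (n + 1) n ((-1 : ℤ) ^ p • D.act p (q + 1) (n + 1) a x.1) +
        pathSnd D n (coneAct (shift D) p q n a x) = _
      rw [map_zsmul, h1, smul_add, smul_smul, ← pow_add, ← two_mul, pow_mul, neg_one_sq, one_pow,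
        one_smul, map_add]
      have h2 : (-1 : ℤ) ^ p • D.act (p - 1) (q + 1) n ((A.X.d p (p - 1)).hom a) x.1 +
          pathSnd D n (coneAct (shift D) p q n a x) = D.act p q n a (pathSnd D q x) := by
        rcases n with _ | n
        · obtain rfl : p = 0 := by omega
          obtain rfl : q = 0 := by omega
          rw [dgd_zero]
          simp only [pathSnd, map_zero, LinearMap.zero_apply, add_zero, pow_zero, one_smul]
          rfl
        · have e : pathSnd D (n + 1) (coneAct (shift D) p q (n + 1) a x) =
              (-1 : ℤ) ^ (p - 1) •
                D.act (p - 1) (q + 1) (n + 1) ((A.X.d p (p - 1)).hom a) x.1 +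
              (-1 : ℤ) ^ p • (-1 : ℤ) ^ p •
                D.act p (q - 1 + 1) (n + 1) a (sndAt (shift D) q (q - 1) x) :=
            sndAt_coneAct rfl a x
          rw [e, smul_smul, ← pow_add, ← two_mul, pow_mul, neg_one_sq, one_pow, one_smul]
          have h3 : D.act p (q - 1 + 1) (n + 1) a (sndAt (shift D) q (q - 1) x) =
              D.act p q (n + 1) a (pathSnd D q x) := by
            rcases q with _ | q
            · rw [sndAt_zero]
              exact (map_zero (D.act p 1 (n + 1) a)).trans (map_zero (D.act p 0 (n + 1) a)).symm
            · rfl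
          have h4 : (-1 : ℤ) ^ (p - 1) •
              D.act (p - 1) (q + 1) (n + 1) ((A.X.d p (p - 1)).hom a) x.1 =
              -((-1 : ℤ) ^ p • D.act (p - 1) (q + 1) (n + 1) ((A.X.d p (p - 1)).hom a) x.1) := by
            rcases p with _ | p
            · have hz : D.act (0 - 1) (q + 1) (n + 1) ((A.X.d 0 (0 - 1)).hom a) x.1 = 0 := by
                rw [dgd_zero, map_zero]
                rfl
              rw [hz, smul_zero, neg_zero]
            · rw [Nat.add_sub_cancel, pow_succ, mul_neg, mul_one, neg_smul, neg_neg]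
          rw [h3, h4, ← add_assoc, add_neg_cancel, zero_add]
      rw [← h2]
      abel)

theorem fibration_pathEval : Fibration (pathEval D) := by
  rw [fibration_iff_surjective]
  rintro (_ | n) hn x
  · omega
  · refine ⟨coneH (shift D) n (x, 0), ?_⟩
    have h1 : pathSnd D (n + 1) (coneH (shift D) n (x, 0)) = x := sndAt_coneH n _
    change pathLin D (n + 1) (coneH (shift D) n (x, 0)) = x
    rw [pathLin_apply, h1, coneH_fst]
    exact (congrArg (· + x) (map_zero (D.d (n + 2) (n + 1)))).trans (zero_add x)

theorem acyclic_pathObj : Acyclic (pathObj D).X := acyclic_coneObj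

variable {D}

theorem weakEquivalence_prdInl {M N : DGMod A} (hN : Acyclic N.X) :
    WeakEquivalence (prdInl M N) := by
  rw [weakEquivalence_iff_elements]
  refine fun n => ⟨fun x _ hb => hb.map (prdFst M N).hom, fun y hy =>
    ⟨app (prdFst M N) n y, hy.map (prdFst M N).hom, ?_⟩⟩
  obtain ⟨z, hz⟩ := hN n _ (hy.map (prdSnd M N).hom)
  refine ⟨-app (prdInr M N) _ z, pb_ext ?_ ?_⟩
  · change app (prdFst M N) n ((prd M N).d _ _ _) = _
    rw [app_d]
    change M.d _ _ (-0) = app (prdFst M N) n y - app (prdFst M N) n y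
    rw [neg_zero, map_zero, sub_self]
  · change app (prdSnd M N) n ((prd M N).d _ _ _) = _
    rw [app_d]
    change N.d _ _ (-z) = 0 - app (prdSnd M N) n y
    rw [map_neg, zero_sub]
    exact congrArg Neg.neg hz

theorem fibration_prdDesc_pathEval {Y W : DGMod A} (r : Y ⟶ W) :
    Fibration (prdDesc r (pathEval W)) := by
  have h := fibration_pathEval W
  rw [fibration_iff_surjective] at h ⊢
  intro n hn x
  obtain ⟨y, rfl⟩ := h n hn x
  exact ⟨app (prdInr Y (pathObj W)) n y, app_app_of_comp_eq (inr_prdDesc r _) n y⟩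

/-- The elementary form of homotopy cartesian squares agrees with the model square condition: one
replaces the leg `r : Y ⟶ W` by the fibration `Y × pathObj W ⟶ W`. -/
theorem IsHomotopyCartesian.isModelSquare {X Y Z W : DGMod A} {t : X ⟶ Y} {l : X ⟶ Z}
    {r : Y ⟶ W} {b : Z ⟶ W} (h : IsHomotopyCartesian t l r b) : IsModelSquare t l r b := by
  set E := pathObj W
  obtain ⟨r', hr'⟩ : ∃ r' : prd Y E ⟶ W, r' = prdDesc r (pathEval W) := ⟨_, rfl⟩
  have e : prdInl Y E ≫ r' = r := hr' ▸ inl_prdDesc r _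
  let R : FibrantCospanReplacement r b :=
    { Y' := prd Y E
      Z' := Z
      W' := W
      r' := r'
      b' := b
      y := prdInl Y E
      z := 𝟙 Z
      w := 𝟙 W
      comm_r := by rw [e, Category.comp_id]
      comm_b := by rw [Category.id_comp, Category.comp_id]
      weq_y := weakEquivalence_prdInl (acyclic_pathObj W)
      weq_z := weakEquivalence_of_isIso _
      weq_w := weakEquivalence_of_isIso _
      fibrant_Y := isFibrant _
      fibrant_Z := isFibrant _
      fibrant_W := isFibrant _
      fib_leg := Or.inl (hr' ▸ fibration_prdDesc_pathEval r) }
  have hcomm : (t ≫ prdInl Y E) ≫ r' = l ≫ b := by rw [Category.assoc, e, h.comm]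
  refine ⟨h.comm, R, pb r' b, pbFst r' b, pbSnd r' b, isPullback_pb r' b, pbLift _ _ hcomm, rfl,
    (Category.comp_id _).symm, ?_⟩
  set u := pbLift _ _ hcomm
  have hu1 : ∀ n x, app (prdFst Y E) n (app (pbFst r' b) n (app u n x)) = app t n x :=
    fun _ _ => rfl
  have hu2 : ∀ n x, app (prdSnd Y E) n (app (pbFst r' b) n (app u n x)) = 0 := fun _ _ => rfl
  have hu3 : ∀ n x, app (pbSnd r' b) n (app u n x) = app l n x := fun _ _ => rfl
  have hw : ∀ n (x : (pb r' b).X.X n), app r n (app (prdFst Y E) n (app (pbFst r' b) n x)) +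
      app (pathEval W) n (app (prdSnd Y E) n (app (pbFst r' b) n x)) =
        app b n (app (pbSnd r' b) n x) := fun n x => by
    have := app_congr (isPullback_pb r' b).w n x
    simp only [app_comp] at this
    have hr2 : ∀ z, app r' n z = app r n (app (prdFst Y E) n z) +
        app (pathEval W) n (app (prdSnd Y E) n z) := fun z => by rw [hr', app_prdDesc]
    rw [← this, hr2]
  have hsurj := (fibration_iff_surjective _).1 (fibration_pathEval W)
  rw [weakEquivalence_iff_elements]
  refine fun n => ⟨fun x hx ⟨y, hy⟩ => ?_, fun y hy => ?_⟩
  · have hy' : (pb r' b).d (n + 1) n y = app u n x := hy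
    obtain ⟨ε, hε⟩ := acyclic_pathObj W (n + 1) (app (prdSnd Y E) _ (app (pbFst r' b) _ y)) (by
      change E.d (n + 1) n _ = 0
      rw [← app_d, ← app_d, hy', hu2])
    refine h.inj n x (app (prdFst Y E) _ (app (pbFst r' b) _ y)) (app (pbSnd r' b) _ y)
      (-app (pathEval W) _ ε) hx ?_ ?_ ?_
    · rw [← app_d, ← app_d, hy', hu1]
    · rw [← app_d, hy', hu3]
    · rw [← hw, map_neg, ← app_d]
      change _ = -app (pathEval W) (n + 1) ((E.X.d _ _).hom ε)
      rw [hε]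
      abel
  · obtain ⟨ε, hε⟩ := acyclic_pathObj W n (app (prdSnd Y E) n (app (pbFst r' b) n y))
      ((hy.map (pbFst r' b).hom).map (prdSnd Y E).hom)
    have hε' : E.d (n + 1) n ε = app (prdSnd Y E) n (app (pbFst r' b) n y) := hε
    obtain ⟨x, y', z', hx, h1, h2, ⟨v, h3⟩⟩ := h.surj n
      (app (prdFst Y E) n (app (pbFst r' b) n y)) (app (pbSnd r' b) n y)
      (-app (pathEval W) _ ε) ((hy.map (pbFst r' b).hom).map (prdFst Y E).hom)
      (hy.map (pbSnd r' b).hom) (by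
        rw [← hw, map_neg, ← app_d, hε']
        abel)
    obtain ⟨v, rfl⟩ := hsurj (n + 2) (by omega) v
    have h3' : app (pathEval W) (n + 1) (E.d (n + 2) (n + 1) v) =
        -app (pathEval W) _ ε + app r _ y' - app b _ z' := (app_d (pathEval W) _ _ v).trans h3
    obtain ⟨p, hp1, hp2⟩ := exists_prd (M := Y) (N := E) y' (-ε - E.d (n + 2) (n + 1) v)
    obtain ⟨q, hq1, hq2⟩ := exists_pb (f := r') (g := b) p z' (by
      rw [hr', app_prdDesc, hp1, hp2, map_sub, map_neg, h3']
      abel)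
    refine ⟨x, hx, q, ?_⟩
    change (pb r' b).d (n + 1) n q = _
    refine pb_ext (pb_ext ?_ ?_) ?_
    · change app (prdFst Y E) n (app (pbFst r' b) n _) = app (prdFst Y E) n (app (pbFst r' b) n _)
      rw [app_d, app_d, hq1, hp1, map_sub, map_sub, hu1, h1]
      abel
    · change app (prdSnd Y E) n (app (pbFst r' b) n _) = app (prdSnd Y E) n (app (pbFst r' b) n _)
      rw [app_d, app_d, hq1, hp2, map_sub, map_sub, map_sub, hu2, map_neg, hε',
        show E.d (n + 1) n (E.d (n + 2) (n + 1) v) = 0 from dgd_dgd E.X _ _ _ v]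
      abel
    · rw [app_d, hq2, map_sub, hu3, h2]
      abel

theorem preservesModelSquares_of_preservesHomotopyFiberSequences {F : DGMod A ⥤ DGMod A}
    (hw : PreservesWeakEquivalences F) (hF : PreservesHomotopyFiberSequences F) :
    PreservesModelSquares F := fun _ _ _ _ _ _ _ _ h =>
  (isHomotopyCartesian_map_of_isModelSquare hF hw h).isModelSquare

end DGMod

end Graded

/-! ### The ring `𝒟` is projective as a left module over the functions -/

section Flat

variable {k : Type u} [Field k] {O : Type u} [CommRing O] [Algebra k O]

/-- A smooth algebra has functions `x_i` and vector fields `∂_i` such that every vector field is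
the sum of the `θ(x_i) ∂_i`. The `∂_i` need not commute, nor be linearly independent. -/
theorem exists_dual_generators (k : Type u) [Field k] (O : Type u) [CommRing O] [Algebra k O]
    [Algebra.Smooth k O] : ∃ (ι : Type u) (_ : Fintype ι) (x : ι → O)
      (δ : ι → Derivation k O O), ∀ θ : Derivation k O O, θ = ∑ i, θ (x i) • δ i := by
  classical
  have hfg : (Submodule.span O (Set.range (KaehlerDifferential.D k O))).FG := by
    rw [KaehlerDifferential.span_range_derivation]
    exact Module.Finite.fg_top
  obtain ⟨s, hs, hspan⟩ := Submodule.fg_span_iff_fg_span_finset_subset _ |>.1 hfg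
  rw [KaehlerDifferential.span_range_derivation] at hspan
  choose x hx using fun i : s => hs i.2
  have hsurj : Function.Surjective (Fintype.linearCombination O (fun i : s => (i : Ω[O⁄k]))) := by
    rw [← LinearMap.range_eq_top, Fintype.range_linearCombination, hspan]
    congr 1
    ext
    simp
  obtain ⟨σ, hσ⟩ := Module.projective_lifting_property _ (LinearMap.id (R := O) (M := Ω[O⁄k]))
    hsurj
  refine ⟨s, inferInstance, x, fun i => (LinearMap.proj i ∘ₗ σ).compDer (KaehlerDifferential.D k O),
    fun θ => ?_⟩
  ext f
  have h1 : ∑ i, σ (KaehlerDifferential.D k O f) i • (i : Ω[O⁄k]) = KaehlerDifferential.D k O f :=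
    LinearMap.congr_fun hσ (KaehlerDifferential.D k O f)
  have h2 := congrArg θ.liftKaehlerDifferential h1
  rw [Derivation.liftKaehlerDifferential_comp_D, map_sum] at h2
  have h3 : (∑ i, θ (x i) • (LinearMap.proj i ∘ₗ σ).compDer (KaehlerDifferential.D k O) :
      Derivation k O O) f = ∑ i, θ (x i) * σ (KaehlerDifferential.D k O f) i := by
    rw [← Derivation.coeFnAddMonoidHom_apply, map_sum, Finset.sum_apply]
    rfl
  rw [h3, ← h2]
  refine Finset.sum_congr rfl fun i _ => ?_
  rw [map_smul, ← hx i, Derivation.liftKaehlerDifferential_comp_D, smul_eq_mul, mul_comm]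

namespace DiffOp

/-- `OrdLT n P` says that `P` is a differential operator of order less than `n`. -/
inductive OrdLT : ℕ → DiffOp k O → Prop
  | zero (n : ℕ) : OrdLT n 0
  | add {n : ℕ} {P Q : DiffOp k O} : OrdLT n P → OrdLT n Q → OrdLT n (P + Q)
  | ofFun (n : ℕ) (f : O) : OrdLT (n + 1) (ofFun k f)
  | fun_mul {n : ℕ} (f : O) {P : DiffOp k O} : OrdLT n P → OrdLT n (DiffOp.ofFun k f * P)
  | der_mul {n : ℕ} (θ : Derivation k O O) {P : DiffOp k O} :
      OrdLT n P → OrdLT (n + 1) (ofDer θ * P)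

theorem OrdLT.eq_zero {P : DiffOp k O} (h : OrdLT 0 P) : P = 0 := by
  generalize hn : 0 = n at h
  induction h with
  | zero => rfl
  | add _ _ hP hQ => rw [hP hn, hQ hn, add_zero]
  | ofFun => omega
  | fun_mul f _ hP => rw [hP hn, mul_zero]
  | der_mul => omega

theorem OrdLT.succ {n : ℕ} {P : DiffOp k O} (h : OrdLT n P) : OrdLT (n + 1) P := by
  induction h with
  | zero => exact .zero _
  | add _ _ hP hQ => exact .add hP hQ
  | ofFun => exact .ofFun _ _
  | fun_mul f _ hP => exact .fun_mul f hP
  | der_mul θ _ hP => exact .der_mul θ hP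

theorem OrdLT.mono {m n : ℕ} (hmn : m ≤ n) {P : DiffOp k O} (h : OrdLT m P) : OrdLT n P := by
  induction hmn with
  | refl => exact h
  | step _ ih => exact ih.succ

theorem OrdLT.neg {n : ℕ} {P : DiffOp k O} (h : OrdLT n P) : OrdLT n (-P) := by
  have := OrdLT.fun_mul (-1) h
  rwa [map_neg, map_one, neg_mul, one_mul] at this

theorem OrdLT.sum {n : ℕ} {ι : Type*} (s : Finset ι) (P : ι → DiffOp k O)
    (h : ∀ i ∈ s, OrdLT n (P i)) : OrdLT n (∑ i ∈ s, P i) :=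
  Finset.sum_induction P (OrdLT n) (fun _ _ => .add) (.zero n) h

theorem exists_ordLT (P : DiffOp k O) : ∃ n, OrdLT n P := by
  have key : ∀ P Q : DiffOp k O, (∃ n, OrdLT n Q) → ∃ n, OrdLT n (P * Q) := by
    intro P
    induction P using DiffOp.induction with
    | hf f => exact fun Q ⟨n, h⟩ => ⟨n, h.fun_mul f⟩
    | hd θ => exact fun Q ⟨n, h⟩ => ⟨n + 1, h.der_mul θ⟩
    | hmul P P' hP hP' =>
      intro Q hQ
      rw [mul_assoc]
      exact hP _ (hP' _ hQ)
    | hadd P P' hP hP' =>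
      intro Q hQ
      obtain ⟨m, hm⟩ := hP Q hQ
      obtain ⟨n, hn⟩ := hP' Q hQ
      rw [add_mul]
      exact ⟨max m n, (hm.mono (le_max_left _ _)).add (hn.mono (le_max_right _ _))⟩
    | hneg P hP =>
      intro Q hQ
      obtain ⟨m, hm⟩ := hP Q hQ
      rw [neg_mul]
      exact ⟨m, hm.neg⟩
  have := key P 1 ⟨1, by simpa using OrdLT.ofFun (k := k) 0 (1 : O)⟩
  rwa [mul_one] at this

/-- The product of a list of vector fields. -/
noncomputable def listProd (l : List (Derivation k O O)) : DiffOp k O := (l.map ofDer).prod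

theorem listProd_cons (θ : Derivation k O O) (l : List (Derivation k O O)) :
    listProd (θ :: l) = ofDer θ * listProd l := by
  rw [listProd, List.map_cons, List.prod_cons]; rfl

theorem ordLT_listProd (l : List (Derivation k O O)) : OrdLT (l.length + 1) (listProd l) := by
  induction l with
  | nil => simpa [listProd] using OrdLT.ofFun (k := k) 0 (1 : O)
  | cons θ l ih =>
    rw [listProd_cons]
    exact ih.der_mul θ

/-- Up to terms of lower order, the order of the factors does not matter. -/
theorem ordLT_listProd_sub {l l' : List (Derivation k O O)} (h : l.Perm l') :
    OrdLT l.length (listProd l - listProd l') := by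
  induction h with
  | nil => rw [sub_self]; exact .zero _
  | cons θ _ ih =>
    rw [listProd_cons, listProd_cons, ← mul_sub]
    exact ih.der_mul θ
  | swap θ η l =>
    rw [listProd_cons, listProd_cons, listProd_cons, listProd_cons, ← mul_assoc, ← mul_assoc,
      ofDer_bracket η θ, add_mul, add_sub_cancel_left]
    exact (ordLT_listProd l).der_mul _
  | trans h1 h2 ih1 ih2 =>
    have := ih1.add (h1.length_eq ▸ ih2)
    rwa [sub_add_sub_cancel] at this

section Symbol

variable {ι : Type u}

variable (O ι) in
/-- The free `O`-module on the monomials in variables `ξ_i`. -/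
abbrev Sym : Type u := (ι →₀ ℕ) →₀ O

theorem sym_ext {φ ψ : AddMonoid.End (Sym O ι)}
    (h : ∀ α f, φ (Finsupp.single α f) = ψ (Finsupp.single α f)) : φ = ψ :=
  Finsupp.addHom_ext h

/-- `SymDegLT n g` says that the polynomial `g` has degree less than `n`. -/
def SymDegLT (n : ℕ) (g : Sym O ι) : Prop := ∀ α, g α ≠ 0 → α.degree < n

theorem symDegLT_single {n : ℕ} {α : ι →₀ ℕ} (h : α.degree < n) (f : O) :
    SymDegLT n (Finsupp.single α f : Sym O ι) := by
  intro β hβ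
  obtain rfl : α = β := by
    by_contra hne
    exact hβ (Finsupp.single_eq_of_ne (Ne.symm hne))
  exact h

theorem SymDegLT.add {n : ℕ} {g h : Sym O ι} (hg : SymDegLT n g) (hh : SymDegLT n h) :
    SymDegLT n (g + h) := by
  intro α hα
  by_cases h0 : g α = 0
  · exact hh α fun h1 => hα (by rw [Finsupp.add_apply, h0, h1, add_zero])
  · exact hg α h0

theorem SymDegLT.smul {n : ℕ} {g : Sym O ι} (hg : SymDegLT n g) (f : O) : SymDegLT n (f • g) :=
  fun α hα => hg α fun h => hα (by rw [Finsupp.smul_apply, h, smul_zero])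

theorem SymDegLT.induction {n : ℕ} {C : Sym O ι → Prop} (h0 : C 0)
    (hadd : ∀ g h, C g → C h → C (g + h)) (hs : ∀ α f, α.degree < n → C (Finsupp.single α f))
    {g : Sym O ι} (hg : SymDegLT n g) : C g := by
  rw [← Finsupp.sum_single g]
  exact Finset.sum_induction _ C hadd h0 fun α hα => hs α _ (hg α (Finsupp.mem_support_iff.1 hα))

theorem symDegLT_zero (n : ℕ) : SymDegLT n (0 : Sym O ι) := fun _ h => absurd rfl h

theorem SymDegLT.sum {n : ℕ} {κ : Type*} (s : Finset κ) (g : κ → Sym O ι)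
    (h : ∀ i ∈ s, SymDegLT n (g i)) : SymDegLT n (∑ i ∈ s, g i) :=
  Finset.sum_induction g (SymDegLT n) (fun _ _ => .add) (symDegLT_zero n) h

theorem degree_add_single (α : ι →₀ ℕ) (i : ι) :
    (α + Finsupp.single i 1).degree = α.degree + 1 := by
  rw [map_add, Finsupp.degree_single]

variable (δ : ι → Derivation k O O)

/-- The product of the vector fields `∂_i` with multiplicities `α`, in an arbitrary order. -/
noncomputable def monomial (α : ι →₀ ℕ) : DiffOp k O :=
  listProd ((Finsupp.toMultiset α).toList.map δ)

theorem monomial_zero : monomial δ 0 = 1 := by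
  simp [monomial, listProd]

/-- Quantization: the additive map `O[ξ] → 𝒟` that maps `f ξ^α` to `f ∂^α`. -/
noncomputable def ofSym : Sym O ι →+ DiffOp k O :=
  Finsupp.liftAddHom fun α => (AddMonoidHom.mulRight (monomial δ α)).comp
    (ofFun k (O := O)).toAddMonoidHom

theorem ofSym_single (α : ι →₀ ℕ) (f : O) :
    ofSym δ (Finsupp.single α f) = ofFun k f * monomial δ α := by
  simp [ofSym]

theorem ofSym_smul (f : O) (g : Sym O ι) : ofSym δ (f • g) = ofFun k f * ofSym δ g := by
  induction g using Finsupp.induction_linear with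
  | zero => rw [smul_zero, map_zero, mul_zero]
  | add g h hg hh => rw [smul_add, map_add, hg, hh, map_add, mul_add]
  | single α g => rw [Finsupp.smul_single, ofSym_single, ofSym_single, smul_eq_mul, map_mul,
      mul_assoc]

variable [Fintype ι] (x : ι → O)

/-- The action of a vector field `θ` on `O[ξ]`: by `θ` on the coefficients, plus multiplication by
`∑ θ(x_i) ξ_i`. -/
noncomputable def symDer (θ : Derivation k O O) : AddMonoid.End (Sym O ι) :=
  Finsupp.mapRange.addMonoidHom (θ : O →+ O) +
    ∑ i, Finsupp.liftAddHom fun α => (Finsupp.singleAddHom (α + Finsupp.single i 1)).comp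
      (AddMonoidHom.mulRight (θ (x i)))

theorem symDer_single (θ : Derivation k O O) (α : ι →₀ ℕ) (f : O) :
    symDer x θ (Finsupp.single α f) = Finsupp.single α (θ f) +
      ∑ i, Finsupp.single (α + Finsupp.single i 1) (f * θ (x i)) := by
  have e : symDer x θ (Finsupp.single α f) = Finsupp.mapRange.addMonoidHom (θ : O →+ O)
      (Finsupp.single α f) + (∑ i, Finsupp.liftAddHom fun α =>
        (Finsupp.singleAddHom (α + Finsupp.single i 1)).comp
          (AddMonoidHom.mulRight (θ (x i)))) (Finsupp.single α f) := rfl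
  rw [e, AddMonoidHom.finsetSum_apply]
  simp

/-- The action of `𝒟` on `O[ξ]`. -/
noncomputable def symAct : DiffOp k O →+* AddMonoid.End (Sym O ι) :=
  lift (Module.toAddMonoidEnd O (Sym O ι)) (symDer x)
    (fun θ η => sym_ext fun α f => by
      change _ = symDer x θ _ + symDer x η _
      simp only [symDer_single, Derivation.add_apply, mul_add, Finsupp.single_add,
        Finset.sum_add_distrib]
      abel)
    (fun g θ => sym_ext fun α f => by
      change _ = g • symDer x θ _
      simp only [symDer_single, Derivation.smul_apply, smul_add, Finset.smul_sum,
        Finsupp.smul_single, smul_eq_mul, mul_left_comm])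
    (fun θ g => sym_ext fun α f => by
      change symDer x θ (g • Finsupp.single α f) =
        g • symDer x θ (Finsupp.single α f) + θ g • Finsupp.single α f
      simp only [symDer_single, smul_add, Finset.smul_sum, Finsupp.smul_single, smul_eq_mul,
        Derivation.leibniz, Finsupp.single_add, mul_assoc, mul_comm f (θ g)]
      abel)
    (fun θ η => sym_ext fun α f => by
      change symDer x θ (symDer x η _) = symDer x η (symDer x θ _) + symDer x ⁅θ, η⁆ _
      simp only [symDer_single, map_add, map_sum, Derivation.leibniz, smul_eq_mul,
        Derivation.commutator_apply, Finsupp.single_add, Finset.sum_add_distrib,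
        Finsupp.single_sub, mul_sub, Finset.sum_sub_distrib]
      have hs : ∑ i, ∑ j, Finsupp.single (α + Finsupp.single i 1 + Finsupp.single j 1)
          (f * η (x i) * θ (x j)) = ∑ i, ∑ j,
          Finsupp.single (α + Finsupp.single i 1 + Finsupp.single j 1)
            (f * θ (x i) * η (x j)) := by
        rw [Finset.sum_comm]
        refine Finset.sum_congr rfl fun i _ => Finset.sum_congr rfl fun j _ => ?_
        rw [add_right_comm]
        congr 1
        ring
      rw [hs]
      simp only [mul_comm (η (x _)), mul_comm (θ (x _))]
      abel)

/-- The total symbol of a differential operator: its value on `1` in `O[ξ]`. -/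
noncomputable def toSym (P : DiffOp k O) : Sym O ι := symAct x P (Finsupp.single 0 1)

theorem symAct_ofFun (f : O) (g : Sym O ι) : symAct x (ofFun k f) g = f • g := by
  rw [symAct, lift_ofFun]; rfl

theorem symAct_ofDer (θ : Derivation k O O) (g : Sym O ι) :
    symAct x (ofDer θ) g = symDer x θ g := by
  rw [symAct, lift_ofDer]

theorem toSym_add (P Q : DiffOp k O) : toSym x (P + Q) = toSym x P + toSym x Q := by
  rw [toSym, map_add]; rfl

theorem toSym_fun_mul (f : O) (P : DiffOp k O) : toSym x (ofFun k f * P) = f • toSym x P := by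
  rw [toSym, map_mul]
  exact symAct_ofFun x f _

theorem toSym_der_mul (θ : Derivation k O O) (P : DiffOp k O) :
    toSym x (ofDer θ * P) = symDer x θ (toSym x P) := by
  rw [toSym, map_mul]
  exact symAct_ofDer x θ _

theorem ordLT_monomial_sub (α : ι →₀ ℕ) (i : ι) :
    OrdLT (α.degree + 1)
      (monomial δ (α + Finsupp.single i 1) - ofDer (δ i) * monomial δ α) := by
  have hp : ((Finsupp.toMultiset (α + Finsupp.single i 1)).toList.map δ).Perm
      (δ i :: (Finsupp.toMultiset α).toList.map δ) := by
    rw [← List.map_cons]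
    refine List.Perm.map δ ?_
    rw [← Multiset.coe_eq_coe, Multiset.coe_toList, ← Multiset.cons_coe, Multiset.coe_toList,
      map_add, Finsupp.toMultiset_single, one_smul, add_comm, Multiset.singleton_add]
  have h := ordLT_listProd_sub hp
  rw [listProd_cons] at h
  have hl : ((Finsupp.toMultiset (α + Finsupp.single i 1)).toList.map δ).length =
      α.degree + 1 := by
    rw [List.length_map, Multiset.length_toList, Finsupp.card_toMultiset, Finsupp.degree_eq_sum]
    simp [Finsupp.sum_fintype, Finset.sum_add_distrib]
  rwa [hl] at h

variable {x δ}

theorem SymDegLT.symDer {n : ℕ} {g : Sym O ι} (hg : SymDegLT n g) (θ : Derivation k O O) :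
    SymDegLT (n + 1) (symDer x θ g) := by
  refine SymDegLT.induction (C := fun g => SymDegLT (n + 1) (DiffOp.symDer x θ g)) ?_ ?_ ?_ hg
  · rw [map_zero]; exact symDegLT_zero _
  · intro g h h1 h2
    rw [map_add]; exact h1.add h2
  · intro α f hα
    rw [symDer_single]
    refine (symDegLT_single (by omega) _).add (SymDegLT.sum _ _ fun i _ => symDegLT_single ?_ _)
    rw [degree_add_single]
    omega

/-- Quantization commutes with the action of vector fields up to terms of lower order. -/
theorem ordLT_ofSym_symDer (hδ : ∀ θ : Derivation k O O, θ = ∑ i, θ (x i) • δ i) {n : ℕ}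
    {g : Sym O ι} (hg : SymDegLT n g) (θ : Derivation k O O) :
    OrdLT n (ofSym δ (symDer x θ g) - ofDer θ * ofSym δ g) := by
  refine SymDegLT.induction
    (C := fun g => OrdLT n (ofSym δ (symDer x θ g) - ofDer θ * ofSym δ g)) ?_ ?_ ?_ hg
  · rw [map_zero, map_zero, mul_zero, sub_zero]
    exact .zero n
  · intro g h h1 h2
    rw [map_add, map_add, map_add, mul_add, add_sub_add_comm]
    exact h1.add h2
  · intro α f hα
    have hθ : ofDer θ = ∑ i, ofFun k (θ (x i)) * ofDer (δ i) := by
      conv_lhs => rw [hδ θ]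
      let φ : Derivation k O O →+ DiffOp k O := AddMonoidHom.mk' ofDer ofDer_add
      change φ _ = _
      rw [map_sum]
      exact Finset.sum_congr rfl fun i _ => ofDer_smul _ _
    have e : ofSym δ (symDer x θ (Finsupp.single α f)) -
        ofDer θ * ofSym δ (Finsupp.single α f) = ∑ i, ofFun k (f * θ (x i)) *
          (monomial δ (α + Finsupp.single i 1) - ofDer (δ i) * monomial δ α) := by
      rw [symDer_single, map_add, map_sum, ofSym_single, ofSym_single, ← mul_assoc,
        ofDer_mul_ofFun, add_mul, hθ]
      simp only [ofSym_single, mul_sub, Finset.sum_sub_distrib, map_mul, Finset.mul_sum,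
        Finset.sum_mul, mul_assoc]
      abel
    rw [e]
    exact OrdLT.sum _ _ fun i _ => ((ordLT_monomial_sub δ α i).mono hα).fun_mul _

/-- The composite `𝒟 → O[ξ] → 𝒟` is the identity up to terms of lower order. -/
theorem ordLT_ofSym_toSym (hδ : ∀ θ : Derivation k O O, θ = ∑ i, θ (x i) • δ i) {n : ℕ}
    {P : DiffOp k O} (hP : OrdLT n P) :
    SymDegLT n (toSym x P) ∧ OrdLT (n - 1) (ofSym δ (toSym x P) - P) := by
  induction hP with
  | zero n =>
    have : toSym x (0 : DiffOp k O) = 0 := by rw [toSym, map_zero]; rfl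
    rw [this, map_zero, sub_zero]
    exact ⟨symDegLT_zero n, .zero _⟩
  | add _ _ h1 h2 =>
    rw [toSym_add, map_add, add_sub_add_comm]
    exact ⟨h1.1.add h2.1, h1.2.add h2.2⟩
  | ofFun n f =>
    have e : toSym x (ofFun k f) = Finsupp.single 0 f := by
      rw [toSym, symAct_ofFun, Finsupp.smul_single, smul_eq_mul, mul_one]
    rw [e, ofSym_single, monomial_zero, mul_one, sub_self]
    exact ⟨symDegLT_single (by simp) f, .zero _⟩
  | fun_mul f _ h =>
    rw [toSym_fun_mul, ofSym_smul, ← mul_sub]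
    exact ⟨h.1.smul f, h.2.fun_mul f⟩
  | @der_mul n θ P hP h =>
    rw [toSym_der_mul]
    refine ⟨h.1.symDer θ, ?_⟩
    have h1 := ordLT_ofSym_symDer hδ h.1 θ
    have h2 : OrdLT n (ofDer θ * (ofSym δ (toSym x P) - P)) := by
      rcases n with _ | n
      · have := h.2.eq_zero
        rw [this, mul_zero]
        exact .zero _
      · exact h.2.der_mul θ
    have := h1.add h2
    rwa [mul_sub, sub_add_sub_cancel] at this

end Symbol

variable (k O) in
/-- The left action of functions on differential operators. -/
@[reducible]
noncomputable def moduleFun : Module O (DiffOp k O) :=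
  Module.compHom (DiffOp k O) (ofFun k (O := O))

/-- As a left `O`-module, `𝒟` is a direct summand of the free module `O[ξ]`: quantization followed
by the total symbol differs from the identity by a map that lowers the order. -/
theorem projective [Algebra.Smooth k O] :
    @Module.Projective O _ (DiffOp k O) _ (moduleFun k O) := by
  let _ : Module O (DiffOp k O) := moduleFun k O
  obtain ⟨ι, _, x, δ, hδ⟩ := exists_dual_generators k O
  let i : DiffOp k O →ₗ[O] Sym O ι :=
    { toFun := toSym x, map_add' := toSym_add x, map_smul' := toSym_fun_mul x }
  let s : Sym O ι →ₗ[O] DiffOp k O :=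
    { toFun := ofSym δ, map_add' := map_add _, map_smul' := ofSym_smul δ }
  have key : ∀ {n P}, OrdLT n P → OrdLT (n - 1) (s (i P) - P) :=
    fun h => (ordLT_ofSym_toSym hδ h).2
  have hinj : Function.Injective (s ∘ₗ i) := by
    rw [injective_iff_map_eq_zero]
    intro P hP
    obtain ⟨n, hn⟩ := exists_ordLT P
    induction n with
    | zero => exact hn.eq_zero
    | succ n ih =>
      refine ih ?_
      have := (key hn).neg
      rwa [show s (i P) = 0 from hP, zero_sub, neg_neg] at this
  have hsurj : Function.Surjective (s ∘ₗ i) := by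
    intro P
    obtain ⟨n, hn⟩ := exists_ordLT P
    induction n generalizing P with
    | zero => exact ⟨0, by rw [map_zero, hn.eq_zero]⟩
    | succ n ih =>
      obtain ⟨Q, hQ⟩ := ih _ (key hn)
      exact ⟨P - Q, by rw [map_sub, hQ, LinearMap.comp_apply, sub_sub_cancel]⟩
  let e := LinearEquiv.ofBijective (s ∘ₗ i) ⟨hinj, hsurj⟩
  exact Module.Projective.of_split i (e.symm.toLinearMap ∘ₗ s)
    (LinearMap.ext fun P => e.symm_apply_apply P)

end DiffOp

variable (k O) in
/-- The free left `𝒟`-module on a set. -/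
noncomputable def freeD (S : Type u) : ModuleCat.{u} (DiffOp k O) :=
  ModuleCat.of (DiffOp k O) (S →₀ DiffOp k O)

/-- Free left `𝒟`-modules are flat over the functions. -/
theorem flat_freeD [Algebra.Smooth k O] (S : Type u) : Module.Flat O (freeD k O S) := by
  let _ : Module O (DiffOp k O) := DiffOp.moduleFun k O
  have h : Module.Projective O (DiffOp k O) := DiffOp.projective
  have : Module.Flat O (S →₀ DiffOp k O) := by
    classical exact Module.Flat.of_linearEquiv (finsuppLEquivDirectSum O (DiffOp k O) S)
  exact this

end Flat

/-! ### Tensor products with contractible modules, and weak equivalences of cofibrant modules -/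

namespace DGMod

open GrMod

variable {k : Type u} [Field k] {O : Type u} [CommRing O] [Algebra k O] {A : DGAlg k O}

section Contraction

variable (Y : GrMod A) (M : DGMod A)

/-- The contraction `coneH`, as a map on the components of the `A`-module `coneObj Y`. -/
noncomputable def contraction (n : ℕ) :
    (coneObj Y).X.X n →ₗ[DiffOp k O] (coneObj Y).X.X (n + 1) := coneH Y n

theorem contraction_act (r p s : ℕ) (h : r + p = s) (a : A.X.X r) (x : (coneObj Y).X.X p) :
    contraction Y s ((coneObj Y).act r p s a x) =
      (-1 : ℤ) ^ r • (coneObj Y).act r (p + 1) (s + 1) a (contraction Y p x) :=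
  coneH_coneAct r p s h a x

theorem d_contraction_zero (x : (coneObj Y).X.X 0) :
    (coneObj Y).d 1 0 (contraction Y 0 x) = x := coneD_coneH_zero x

theorem d_contraction (n : ℕ) (x : (coneObj Y).X.X (n + 1)) :
    (coneObj Y).d (n + 2) (n + 1) (contraction Y (n + 1) x) +
      contraction Y n ((coneObj Y).d (n + 1) n x) = x := coneD_coneH n x

/-- The contraction `x ⊗ m ↦ h x ⊗ m` of `coneObj Y ⊗_A M`, where `h` is the contraction
of `coneObj Y`. It is nonzero only for `t = s + 1`. -/
noncomputable def taContraction (s t : ℕ) : TensA (coneObj Y) M s →+ TensA (coneObj Y) M t :=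
  taLift s
    (fun p q => biadd (fun x m => ta (p + 1) q t (contraction Y p x) m)
      (fun x y m => by rw [map_add, add_ta]) (fun x m m' => ta_add _ _ _ _ _ _))
    (fun p q f x m => by rw [biadd_apply, biadd_apply, map_smul, ta_fun])
    (fun p r q _ x a m => by
      rw [biadd_apply, biadd_apply, contraction_act Y r p (r + p) rfl, zsmul_ta, smul_smul,
        ← pow_add, ← ta_balanced (p + 1) r q (r + p + 1) (r + q) t (by omega) rfl]
      rfl)

theorem taContraction_ta (s t p q : ℕ) (h : p + q = s) (x : (coneObj Y).X.X p) (m : M.X.X q) :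
    taContraction Y M s t (ta p q s x m) = ta (p + 1) q t (contraction Y p x) m :=
  taLift_ta s _ _ _ p q h x m

theorem taDiff_taContraction (n : ℕ) (z : TensA (coneObj Y) M n) :
    taDiff (coneObj Y) M (n + 1) n (taContraction Y M n (n + 1) z) +
      taContraction Y M (n - 1) n (taDiff (coneObj Y) M n (n - 1) z) = z := by
  induction z using ta_induction with
  | h0 => simp only [map_zero, add_zero]
  | hadd x y hx hy =>
    simp only [map_add]
    rw [add_add_add_comm, hx, hy]
  | ht p q h x m =>
    rw [taContraction_ta Y M n (n + 1) p q h x m, taDiff_ta (n + 1) n (p + 1) q (by omega),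
      taDiff_ta n (n - 1) p q h, map_add, map_zsmul]
    have e1 : ta (M := M) (p + 1 - 1) q n
          (((coneObj Y).X.d (p + 1) (p + 1 - 1)).hom (contraction Y p x)) m +
        taContraction Y M (n - 1) n
          (ta (p - 1) q (n - 1) (((coneObj Y).X.d p (p - 1)).hom x) m) =
        ta p q n x m := by
      rcases p with _ | p
      · rw [dgd_zero, zero_ta, map_zero, add_zero]
        exact congrArg (fun y => ta 0 q n y m) (d_contraction_zero Y x)
      · refine (congrArg (_ + ·) (taContraction_ta Y M (n - 1) n p q (by omega) _ m)).trans ?_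
        refine (add_ta (p + 1) q n _ _ m).symm.trans ?_
        exact congrArg (fun y => ta (p + 1) q n y m) (d_contraction Y p x)
    have e2 : taContraction Y M (n - 1) n (ta p (q - 1) (n - 1) x ((M.X.d q (q - 1)).hom m)) =
        ta (p + 1) (q - 1) n (contraction Y p x) ((M.X.d q (q - 1)).hom m) := by
      rcases q with _ | q
      · rw [dgd_zero, ta_zero, ta_zero, map_zero]
      · exact taContraction_ta Y M (n - 1) n p _ (by omega) x _
    rw [e2, add_add_add_comm, e1, pow_succ, mul_neg, mul_one, neg_smul, neg_add_cancel, add_zero]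

theorem acyclic_tensorObj_coneObj : Acyclic (tensorObj (coneObj Y) M).X := by
  intro n z hz
  have hz' : taDiff (coneObj Y) M n (n - 1) z = 0 := hz
  have := taDiff_taContraction Y M n z
  rw [hz', map_zero, add_zero] at this
  exact ⟨_, this⟩

end Contraction

variable {M N N' : DGMod A}

theorem exists_lift_of_isCofibrant {C X Y : DGMod A} (hC : IsCofibrant C) (p : X ⟶ Y)
    (hp : Fibration p) (hw : WeakEquivalence p) (g : C ⟶ Y) : ∃ s : C ⟶ X, s ≫ p = g := by
  have hc : (trivialFibrations (DGMod A)).llp (initial.to C) :=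
    ((isCofibrant_iff C).1 hC).mem
  have := hc p ⟨hp.mem, hw.mem⟩
  have sq : CommSq (initial.to X) (initial.to C) p g := ⟨initial.hom_ext _ _⟩
  exact ⟨sq.lift, sq.fac_right⟩

theorem weakEquivalence_prdFst (hN : Acyclic N.X) : WeakEquivalence (prdFst M N) := by
  rw [← weakEquivalence_comp_iff' (prdInl M N) _ (weakEquivalence_prdInl hN)]
  exact weakEquivalence_of_isIso (𝟙 M)

theorem weakEquivalence_prdDesc_pathEval {f : N ⟶ N'} (hf : WeakEquivalence f) :
    WeakEquivalence (prdDesc f (pathEval N')) := by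
  rw [← weakEquivalence_comp_iff' (prdInl N _) _ (weakEquivalence_prdInl (acyclic_pathObj N')),
    inl_prdDesc]
  exact hf

/-- A weak equivalence with cofibrant target has a weak equivalence as right inverse, up to
a summand that factors through a contractible module and that all functors `- ⊗_A M` neglect. -/
theorem exists_homotopy_section (hN' : IsCofibrant N') {f : N ⟶ N'} (hf : WeakEquivalence f) :
    ∃ g : N' ⟶ N, WeakEquivalence g ∧ ∀ (M : DGMod A) n z, IsCycle (tensorObj N' M).X n z →
      IsBoundary (tensorObj N' M).X n
        (z - app (tensorObjMap f M) n (app (tensorObjMap g M) n z)) := by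
  have hw := weakEquivalence_prdDesc_pathEval hf
  obtain ⟨s, hs⟩ := exists_lift_of_isCofibrant hN' _ (fibration_prdDesc_pathEval f) hw (𝟙 N')
  have hs' : WeakEquivalence s := by
    rw [← weakEquivalence_comp_iff s _ hw, hs]
    exact weakEquivalence_of_isIso _
  refine ⟨s ≫ prdFst _ _, ?_, fun M n z hz => ?_⟩
  · rw [weakEquivalence_comp_iff' _ _ hs']
    exact weakEquivalence_prdFst (acyclic_pathObj N')
  · set e := s ≫ prdSnd _ _
    have key : ∀ z : TensA N' M n, taMap f M n (taMap (s ≫ prdFst _ _) M n z) +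
        taMap (pathEval N') M n (taMap e M n z) = z := by
      intro z
      induction z using ta_induction with
      | h0 => simp only [map_zero, add_zero]
      | hadd x y hx hy =>
        simp only [map_add]
        rw [add_add_add_comm, hx, hy]
      | ht p q h x m =>
        rw [taMap_ta _ n p q h, taMap_ta _ n p q h, taMap_ta _ n p q h, taMap_ta _ n p q h,
          ← add_ta]
        exact congrArg (fun y => ta p q n y m) (app_app_of_comp_eq hs p x)
    have hb := (acyclic_tensorObj_coneObj _ M n _ (hz.map (tensorObjMap e M).hom)).map
      (tensorObjMap (pathEval N') M).hom
    convert hb using 1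
    exact sub_eq_of_eq_add' (key z).symm

/-- The functors `- ⊗_A M` preserve weak equivalences between cofibrant modules. -/
theorem weakEquivalence_tensorObjMap_of_isCofibrant (hN : IsCofibrant N) (hN' : IsCofibrant N')
    {f : N ⟶ N'} (hf : WeakEquivalence f) (M : DGMod A) :
    WeakEquivalence (tensorObjMap f M) := by
  obtain ⟨g, hg, hfg⟩ := exists_homotopy_section hN' hf
  obtain ⟨g', -, hgg⟩ := exists_homotopy_section hN hg
  rw [weakEquivalence_iff_elements]
  refine fun n => ⟨fun x hx hb => ?_, fun y hy => ⟨_, hy.map (tensorObjMap g M).hom, ?_⟩⟩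
  · -- In homology `x = g (g' x)`, and `g' x = f (g (g' x)) = f x = 0`.
    have h1 := hgg M n x hx
    have hy := hx.map (tensorObjMap g' M).hom
    have h2 := ((hfg M n _ hy).add hb).sub (h1.map (tensorObjMap f M).hom)
    rw [map_sub, add_sub_assoc, sub_sub_cancel, sub_add_cancel] at h2
    have h3 := (h2.map (tensorObjMap g M).hom).add h1
    rwa [add_sub_cancel] at h3
  · have := (hfg M n y hy).neg
    rwa [neg_sub] at this

end DGMod

/-! ### Free graded modules -/

section Free

variable {k : Type u} [Field k] {O : Type u} [CommRing O] [Algebra k O] {A : DGAlg k O}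

theorem zsmul_tt {X Y : DGDM k O} (p q n : ℕ) (c : ℤ) (x : X.X p) (y : Y.X q) :
    tt p q n (c • x) y = c • tt p q n x y :=
  congrArg (fun φ => φ y) (map_zsmul (ttHom X Y p q n) c x)

section Act

variable (A) (V : DGDM k O)

/-- The action `a (b ⊗ v) = a b ⊗ v` of an element of `A` on `A ⊗_O V`. -/
noncomputable def freeActElt (p q n : ℕ) (a : A.X.X p) : Tot A.X V q →+ Tot A.X V n :=
  totLift q
    (fun i j => biadd (fun b v => tt (p + i) j n (A.mul p i (p + i) a b) v)
      (fun b c v => by rw [map_add, add_tt]) (fun b v w => tt_add _ _ _ _ _ _))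
    (fun i j f b v => by rw [biadd_apply, biadd_apply, A.mul_fun, tt_fun])

variable {A V}

theorem freeActElt_tt {p q n i j s : ℕ} (h : i + j = q) (hs : p + i = s) (a : A.X.X p)
    (b : A.X.X i) (v : V.X j) :
    freeActElt A V p q n a (tt i j q b v) = tt s j n (A.mul p i s a b) v := by
  subst hs
  exact totLift_tt q _ _ i j h b v

variable (A V)

/-- The action of `A` on `A ⊗_O V`. -/
noncomputable def freeAct (p q n : ℕ) : A.X.X p →+ Tot A.X V q →+ Tot A.X V n :=
  biadd (fun a z => freeActElt A V p q n a z)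
    (fun a b z => by
      induction z using tot_induction with
      | h0 => simp only [map_zero, add_zero]
      | hadd x y hx hy =>
        simp only [map_add, hx, hy]
        abel
      | ht i j h c v =>
        rw [freeActElt_tt h rfl, freeActElt_tt h rfl, freeActElt_tt h rfl, map_add,
          AddMonoidHom.add_apply, add_tt])
    (fun a x y => map_add _ x y)

variable {A V}

theorem freeAct_tt {p q n i j s : ℕ} (h : i + j = q) (hs : p + i = s) (a : A.X.X p)
    (b : A.X.X i) (v : V.X j) :
    freeAct A V p q n a (tt i j q b v) = tt s j n (A.mul p i s a b) v :=
  freeActElt_tt h hs a b v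

variable (A V)

/-- The graded `A`-module `A ⊗_O V`; the differential of `V` plays no role. -/
noncomputable def freeGr : GrMod A where
  X n := ModuleCat.of (DiffOp k O) (Tot A.X V n)
  act := freeAct A V
  act_shape p q n h := by
    refine AddMonoidHom.ext fun a => AddMonoidHom.ext fun (z : Tot A.X V q) => ?_
    change freeAct A V p q n a z = 0
    induction z using tot_induction with
    | h0 => rw [map_zero]
    | hadd x y hx hy => rw [map_add, hx, hy, add_zero]
    | ht i j hij b v =>
      rw [freeAct_tt hij rfl]
      exact tt_shape _ _ _ (by omega) _ _
  fun_act p q n f a (z : Tot A.X V q) := by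
    change freeAct A V p q n _ z = DiffOp.ofFun k f • freeAct A V p q n a z
    induction z using tot_induction with
    | h0 => simp only [map_zero, smul_zero]
    | hadd x y hx hy => rw [map_add, map_add, hx, hy, smul_add]
    | ht i j h b v => rw [freeAct_tt h rfl, freeAct_tt h rfl, A.fun_mul, fun_tt]
  act_fun p q n f a (z : Tot A.X V q) := by
    change freeAct A V p q n a (DiffOp.ofFun k f • z) = DiffOp.ofFun k f • freeAct A V p q n a z
    induction z using tot_induction with
    | h0 => simp only [map_zero, smul_zero]
    | hadd x y hx hy => rw [smul_add, map_add, map_add, hx, hy, smul_add]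
    | ht i j h b v => rw [fun_tt, freeAct_tt h rfl, freeAct_tt h rfl, A.mul_fun, fun_tt]
  der_act p q n θ a (z : Tot A.X V q) := by
    change DiffOp.ofDer θ • freeAct A V p q n a z =
      freeAct A V p q n _ z + freeAct A V p q n a (DiffOp.ofDer θ • z)
    induction z using tot_induction with
    | h0 => simp only [map_zero, smul_zero, add_zero]
    | hadd x y hx hy =>
      simp only [map_add, smul_add, hx, hy]
      abel
    | ht i j h b v =>
      rw [der_tt, map_add, freeAct_tt h rfl, freeAct_tt h rfl, freeAct_tt h rfl,
        freeAct_tt h rfl, der_tt, A.der_mul, add_tt, add_assoc]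
  one_act n (z : Tot A.X V n) := by
    change freeAct A V 0 n n A.one z = z
    induction z using tot_induction with
    | h0 => simp only [map_zero]
    | hadd x y hx hy => rw [map_add, hx, hy]
    | ht i j h b v => rw [freeAct_tt h (zero_add i), A.one_mul]
  act_act p q r s t n hs ht hn a b (z : Tot A.X V r) := by
    change freeAct A V s r n _ z = freeAct A V p t n a (freeAct A V q r t b z)
    induction z using tot_induction with
    | h0 => simp only [map_zero]
    | hadd x y hx hy => simp only [map_add, hx, hy]
    | ht i j h c v =>
      rw [freeAct_tt h rfl, freeAct_tt h rfl, freeAct_tt (s := s + i) (by omega) (by omega),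
        A.mul_assoc p q i s (q + i) (s + i) hs rfl rfl]

end Act

open GrMod DGMod

variable {V : DGDM k O} {C : DGMod A}

/-- The map `a ⊗ v ↦ a φ(v)`. -/
noncomputable def freeDescAdd (φ : ∀ q, V.X q →ₗ[DiffOp k O] C.X.X q) (n : ℕ) :
    Tot A.X V n →+ C.X.X n :=
  totLift n
    (fun p q => biadd (fun a v => C.act p q n a (φ q v))
      (fun a b v => by rw [map_add, AddMonoidHom.add_apply])
      (fun a v w => by rw [map_add, map_add]))
    (fun p q f a v => by rw [biadd_apply, biadd_apply, (φ q).map_smul, C.fun_act, C.act_fun])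

theorem freeDescAdd_tt (φ : ∀ q, V.X q →ₗ[DiffOp k O] C.X.X q) {p q n : ℕ} (h : p + q = n)
    (a : A.X.X p) (v : V.X q) : freeDescAdd φ n (tt p q n a v) = C.act p q n a (φ q v) :=
  totLift_tt n _ _ p q h a v

/-- `freeDescAdd` is `𝒟`-linear. -/
noncomputable def freeDescLin (φ : ∀ q, V.X q →ₗ[DiffOp k O] C.X.X q) (n : ℕ) :
    Tot A.X V n →ₗ[DiffOp k O] C.X.X n :=
  linD (freeDescAdd φ n)
    (fun f z => by
      induction z using tot_induction with
      | h0 => simp only [map_zero, smul_zero]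
      | hadd x y hx hy => rw [smul_add, map_add, map_add, hx, hy, smul_add]
      | ht p q h a v => rw [fun_tt, freeDescAdd_tt φ h, freeDescAdd_tt φ h, C.fun_act])
    (fun θ z => by
      induction z using tot_induction with
      | h0 => simp only [map_zero, smul_zero]
      | hadd x y hx hy => rw [smul_add, map_add, map_add, hx, hy, smul_add]
      | ht p q h a v =>
        rw [der_tt, map_add, freeDescAdd_tt φ h, freeDescAdd_tt φ h, freeDescAdd_tt φ h, C.der_act,
          (φ q).map_smul])

/-- The morphism of graded `A`-modules out of `A ⊗_O V` given by a family of `𝒟`-linear maps. -/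
noncomputable def freeDesc (φ : ∀ q, V.X q →ₗ[DiffOp k O] C.X.X q) :
    Hom (freeGr A V) C.toGr where
  app := freeDescLin φ
  map_act p q n h a (z : Tot A.X V q) := by
    change freeDescAdd φ n (freeAct A V p q n a z) = C.act p q n a (freeDescAdd φ q z)
    induction z using tot_induction with
    | h0 => simp only [map_zero]
    | hadd x y hx hy => simp only [map_add, hx, hy]
    | ht i j hij b v =>
      rw [freeAct_tt hij rfl, freeDescAdd_tt φ (by omega : p + i + j = n), freeDescAdd_tt φ hij,
        C.act_act p i j (p + i) q n rfl hij (by omega)]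

variable (C) in
/-- The free `𝒟`-modules on the components of `C`, as a complex with zero differential. -/
noncomputable def freeCx : DGDM k O where
  X n := freeD k O (C.X.X n)
  d _ _ := 0

variable (C) in
/-- The canonical map from the free `𝒟`-module on `C_q` to `C_q`. -/
noncomputable def freeCounit (q : ℕ) : (freeCx C).X q →ₗ[DiffOp k O] C.X.X q :=
  Finsupp.linearCombination (DiffOp k O) (M := C.X.X q) id

theorem freeCounit_surjective (q : ℕ) : Function.Surjective (freeCounit C q) :=
  Finsupp.linearCombination_surjective (DiffOp k O) (M := C.X.X q) Function.surjective_id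

theorem freeDesc_freeCounit_surjective (n : ℕ) :
    Function.Surjective ((freeDesc (freeCounit C)).app n) := by
  intro (c : C.X.X n)
  obtain ⟨v, hv⟩ := freeCounit_surjective n c
  refine ⟨tt (X := A.X) (Y := freeCx C) 0 n n A.one v, ?_⟩
  refine (freeDescAdd_tt (freeCounit C) (zero_add n) A.one v).trans ?_
  rw [hv, C.one_act]

/-- As a graded module, a cofibrant module is a retract of a free one: the trivial fibration
`coneObj (A ⊗ V) ⟶ coneObj C` has the lifting property with respect to the canonical morphism
`C ⟶ coneObj C`. -/
theorem exists_section_of_isCofibrant (hC : IsCofibrant C) :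
    ∃ s : ∀ n, C.X.X n →ₗ[DiffOp k O] Tot A.X (freeCx C) n,
      (∀ p q n, p + q = n → ∀ (a : A.X.X p) (c : C.X.X q),
        s n (C.act p q n a c) = freeAct A (freeCx C) p q n a (s q c)) ∧
      ∀ n c, freeDescAdd (freeCounit C) n (s n c) = c := by
  let i : Hom C.toGr C.toGr := ⟨fun _ => LinearMap.id, fun _ _ _ _ _ _ => rfl⟩
  have hp : Fibration (coneMap (freeDesc (freeCounit C))) :=
    (fibration_iff_surjective _).2 fun n _ =>
      coneMap_surjective _ freeDesc_freeCounit_surjective n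
  have hw : WeakEquivalence (coneMap (freeDesc (freeCounit C))) := by
    rw [weakEquivalence_iff_elements]
    exact fun n => ⟨fun x hx _ => acyclic_coneObj n x hx, fun y hy => ⟨0, isCycle_zero n, by
      rw [map_zero, zero_sub]
      exact (acyclic_coneObj n y hy).neg⟩⟩
  obtain ⟨φ, hφ⟩ := exists_lift_of_isCofibrant hC _ hp hw (toCone i)
  exact ⟨(fromCone φ).app, (fromCone φ).map_act,
    fun n c => congrArg Prod.fst (app_app_of_comp_eq hφ n c)⟩

end Free

/-! ### Exactness of the tensor product with a cofibrant module -/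

section Exact

open GrMod DGMod

variable {k : Type u} [Field k] {O : Type u} [CommRing O] [Algebra k O] {A : DGAlg k O}
  {N N' N'' : DGMod A} {V : DGDM k O} {C : DGMod A}

variable (N V) in
/-- The map `a ⊗ v ↦ (-1)^(|a||x|) a x ⊗ v`. -/
noncomputable def freeContractElt (p q n : ℕ) (x : N.X.X p) : Tot A.X V q →+ Tot N.X V n :=
  totLift q
    (fun r j => biadd (fun a v => (-1 : ℤ) ^ (r * p) • tt (r + p) j n (N.act r p (r + p) a x) v)
      (fun a b v => by rw [map_add, AddMonoidHom.add_apply, add_tt, smul_add])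
      (fun a v w => by rw [tt_add, smul_add]))
    (fun r j f a v => by rw [biadd_apply, biadd_apply, N.fun_act, tt_fun])

theorem freeContractElt_tt {p q n r j s : ℕ} (h : r + j = q) (hs : r + p = s) (x : N.X.X p)
    (a : A.X.X r) (v : V.X j) :
    freeContractElt N V p q n x (tt r j q a v) =
      (-1 : ℤ) ^ (r * p) • tt s j n (N.act r p s a x) v := by
  subst hs
  exact totLift_tt q _ _ r j h a v

variable (N V) in
/-- The map `x ⊗ (a ⊗ v) ↦ (x ◁ a) ⊗ v`, which identifies `N ⊗_A (A ⊗_O V)` with `N ⊗_O V`. -/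
noncomputable def freeContract (p q n : ℕ) : N.X.X p →+ Tot A.X V q →+ Tot N.X V n :=
  biadd (fun x z => freeContractElt N V p q n x z)
    (fun x y z => by
      induction z using tot_induction with
      | h0 => simp only [map_zero, add_zero]
      | hadd z w hz hw =>
        simp only [map_add, hz, hw]
        abel
      | ht i j h c v =>
        rw [freeContractElt_tt h rfl, freeContractElt_tt h rfl, freeContractElt_tt h rfl, map_add,
          add_tt, smul_add])
    (fun a x y => map_add _ x y)

theorem freeContract_tt {p q n r j s : ℕ} (h : r + j = q) (hs : r + p = s) (x : N.X.X p)
    (a : A.X.X r) (v : V.X j) :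
    freeContract N V p q n x (tt r j q a v) =
      (-1 : ℤ) ^ (r * p) • tt s j n (N.act r p s a x) v := freeContractElt_tt h hs x a v

theorem freeContract_fun (p q n : ℕ) (f : O) (x : N.X.X p) (z : Tot A.X V q) :
    freeContract N V p q n (DiffOp.ofFun k f • x) z =
      freeContract N V p q n x (DiffOp.ofFun k f • z) := by
  induction z using tot_induction with
  | h0 => simp only [map_zero, smul_zero]
  | hadd z w hz hw => rw [smul_add, map_add, map_add, hz, hw]
  | ht i j h c v => rw [fun_tt, freeContract_tt h rfl, freeContract_tt h rfl, N.fun_act, N.act_fun]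

theorem freeContract_balanced (p r q n : ℕ) (x : N.X.X p) (a : A.X.X r) (z : Tot A.X V q) :
    (-1 : ℤ) ^ (r * p) • freeContract N V (r + p) q n (N.act r p (r + p) a x) z =
      freeContract N V p (r + q) n x (freeAct A V r q (r + q) a z) := by
  induction z using tot_induction with
  | h0 => simp only [map_zero, smul_zero]
  | hadd z w hz hw => simp only [map_add, smul_add, hz, hw]
  | ht i j h b v =>
    rw [freeContract_tt h rfl, freeAct_tt (s := i + r) h (add_comm r i),
      freeContract_tt (s := i + (r + p)) (by omega) (by omega),
      ← N.act_act i r p (i + r) (r + p) (i + (r + p)) rfl rfl (by omega),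
      A.mul_comm r i (i + r) (add_comm r i), map_zsmul, AddMonoidHom.zsmul_apply, zsmul_tt,
      smul_smul, smul_smul, ← pow_add, ← pow_add]
    congr 2
    ring

variable (N) in
/-- The map `N ⊗_A C → N ⊗_O V` induced by a morphism `C → A ⊗_O V` of graded modules. -/
noncomputable def taToTot (s : ∀ q, C.X.X q →ₗ[DiffOp k O] Tot A.X V q)
    (hs : ∀ p q n, p + q = n → ∀ (a : A.X.X p) (c : C.X.X q),
      s n (C.act p q n a c) = freeAct A V p q n a (s q c)) (n : ℕ) :
    TensA N C n →+ Tot N.X V n :=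
  taLift n
    (fun p q => biadd (fun x c => freeContract N V p q n x (s q c))
      (fun x y c => by rw [map_add, AddMonoidHom.add_apply])
      (fun x c c' => by rw [map_add, map_add]))
    (fun p q f x c => by
      rw [biadd_apply, biadd_apply, (s q).map_smul, freeContract_fun])
    (fun p r q _ x a c => by
      rw [biadd_apply, biadd_apply, freeContract_balanced, hs r q (r + q) rfl])

section

variable {s : ∀ q, C.X.X q →ₗ[DiffOp k O] Tot A.X V q}
  {hs : ∀ p q n, p + q = n → ∀ (a : A.X.X p) (c : C.X.X q),
    s n (C.act p q n a c) = freeAct A V p q n a (s q c)}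

theorem taToTot_ta {p q n : ℕ} (h : p + q = n) (x : N.X.X p) (c : C.X.X q) :
    taToTot N s hs n (ta p q n x c) = freeContract N V p q n x (s q c) :=
  taLift_ta n _ _ _ p q h x c

variable (N) in
/-- The map `N ⊗_O V → N ⊗_A C` induced by a family of maps `V → C`. -/
noncomputable def totToTa (φ : ∀ q, V.X q →ₗ[DiffOp k O] C.X.X q) (n : ℕ) :
    Tot N.X V n →+ TensA N C n :=
  totLift n
    (fun p q => biadd (fun x v => ta p q n x (φ q v))
      (fun x y v => add_ta _ _ _ _ _ _)
      (fun x v w => by rw [map_add, ta_add]))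
    (fun p q f x v => by rw [biadd_apply, biadd_apply, (φ q).map_smul, ta_fun])

theorem totToTa_tt (φ : ∀ q, V.X q →ₗ[DiffOp k O] C.X.X q) {p q n : ℕ} (h : p + q = n)
    (x : N.X.X p) (v : V.X q) : totToTa N φ n (tt p q n x v) = ta p q n x (φ q v) :=
  totLift_tt n _ _ p q h x v

theorem totToTa_freeContract (φ : ∀ q, V.X q →ₗ[DiffOp k O] C.X.X q) {p q n : ℕ} (h : p + q = n)
    (x : N.X.X p) (z : Tot A.X V q) :
    totToTa N φ n (freeContract N V p q n x z) = ta p q n x (freeDescAdd φ q z) := by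
  induction z using tot_induction with
  | h0 => simp only [map_zero, ta_zero]
  | hadd z w hz hw => rw [map_add, map_add, map_add, hz, hw, ta_add]
  | ht r j hrj a v =>
    rw [freeContract_tt hrj rfl, map_zsmul, totToTa_tt φ (by omega), freeDescAdd_tt φ hrj,
      ta_balanced p r j (r + p) q n rfl hrj]

/-- If `φ` and `s` present `C` as a retract of `A ⊗_O V`, then `N ⊗_A C` is a retract of
`N ⊗_O V`, naturally in `N`. -/
theorem totToTa_taToTot {φ : ∀ q, V.X q →ₗ[DiffOp k O] C.X.X q}
    (hφ : ∀ n c, freeDescAdd φ n (s n c) = c) (n : ℕ) (z : TensA N C n) :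
    totToTa N φ n (taToTot N s hs n z) = z := by
  induction z using ta_induction with
  | h0 => simp only [map_zero]
  | hadd x y hx hy => rw [map_add, map_add, hx, hy]
  | ht p q h x c => rw [taToTot_ta h, totToTa_freeContract φ h, hφ]

/-- The map `f ⊗_O V`. -/
noncomputable def totMap (f : N ⟶ N') (V : DGDM k O) (n : ℕ) : Tot N.X V n →+ Tot N'.X V n :=
  DirectSum.map fun i : Idx n =>
    (tensorMap (N := V.X i.1.2) (app f i.1.1) LinearMap.id).toAddMonoidHom

theorem totMap_tt (f : N ⟶ N') {p q n : ℕ} (h : p + q = n) (x : N.X.X p) (v : V.X q) :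
    totMap f V n (tt p q n x v) = tt p q n (app f p x) v := by
  rw [tt, tt, totι, totι, dif_pos h, dif_pos h]
  exact DirectSum.map_of _ _ _

theorem totMap_freeContract (f : N ⟶ N') (p q n : ℕ) (x : N.X.X p) (z : Tot A.X V q) :
    totMap f V n (freeContract N V p q n x z) = freeContract N' V p q n (app f p x) z := by
  induction z using tot_induction with
  | h0 => simp only [map_zero]
  | hadd z w hz hw => simp only [map_add, hz, hw]
  | ht r j h a v =>
    rw [freeContract_tt h rfl, freeContract_tt h rfl, map_zsmul]
    congr 1
    by_cases hn : r + p + j = n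
    · rw [totMap_tt f hn]
      congr 1
      exact f.map_act r p (r + p) a x
    · rw [tt_shape _ _ _ hn, tt_shape _ _ _ hn, map_zero]

theorem taToTot_taMap (f : N ⟶ N') (n : ℕ) (z : TensA N C n) :
    taToTot N' s hs n (taMap f C n z) = totMap f V n (taToTot N s hs n z) := by
  induction z using ta_induction with
  | h0 => simp only [map_zero]
  | hadd x y hx hy => simp only [map_add, hx, hy]
  | ht p q h x c => rw [taMap_ta f n p q h, taToTot_ta h, taToTot_ta h, totMap_freeContract]

end

theorem totToTa_totMap (φ : ∀ q, V.X q →ₗ[DiffOp k O] C.X.X q) (f : N ⟶ N') (n : ℕ)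
    (z : Tot N.X V n) : totToTa N' φ n (totMap f V n z) = taMap f C n (totToTa N φ n z) := by
  induction z using tot_induction with
  | h0 => simp only [map_zero]
  | hadd x y hx hy => simp only [map_add, hx, hy]
  | ht p q h x v => rw [totMap_tt f h, totToTa_tt φ h, totToTa_tt φ h, taMap_ta f n p q h]

/-- A `𝒟`-linear map is linear over the functions. -/
noncomputable def linO {M M' : ModuleCat.{u} (DiffOp k O)} (φ : M →ₗ[DiffOp k O] M') :
    M →ₗ[O] M' where
  toFun := φ
  map_add' := φ.map_add
  map_smul' f m := φ.map_smul (DiffOp.ofFun k f) m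

theorem tensorMap_id_apply {M M' P : ModuleCat.{u} (DiffOp k O)} (φ : M →ₗ[DiffOp k O] M')
    (z : tensor M P) : tensorMap φ (LinearMap.id (M := P)) z = (linO φ).rTensor P z := by
  induction z using tensor_induction with
  | h0 => exact (map_zero _).trans (map_zero ((linO φ).rTensor P)).symm
  | ht m p => rfl
  | hadd x y hx hy =>
    rw [map_add, hx, hy]
    exact (map_add ((linO φ).rTensor P) x y).symm

theorem totMap_injective (hV : ∀ q, Module.Flat O (V.X q)) {f : N ⟶ N'}
    (hf : ∀ n, Function.Injective (app f n)) (n : ℕ) : Function.Injective (totMap f V n) := by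
  refine (DirectSum.map_injective _).2 fun i => ?_
  have := hV i.1.2
  have h : Function.Injective ((linO (app f i.1.1)).rTensor (V.X i.1.2)) :=
    Module.Flat.rTensor_preserves_injective_linearMap _ (hf i.1.1)
  intro x y hxy
  refine h ?_
  rw [← tensorMap_id_apply, ← tensorMap_id_apply]
  exact hxy

theorem totMap_exact {f : N ⟶ N'} {g : N' ⟶ N''} (hg : ∀ n, Function.Surjective (app g n))
    (h : ∀ n x, app g n x = 0 → ∃ y, app f n y = x) (h0 : ∀ n x, app g n (app f n x) = 0)
    (n : ℕ) (z : Tot N'.X V n) (hz : totMap g V n z = 0) : ∃ w, totMap f V n w = z := by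
  classical
  have key : ∀ i : Idx n, ∃ w : tensor (N.X.X i.1.1) (V.X i.1.2),
      tensorMap (app f i.1.1) (LinearMap.id (M := V.X i.1.2)) w = z i := by
    intro i
    have hex : Function.Exact (linO (app f i.1.1)) (linO (app g i.1.1)) :=
      fun x => ⟨h i.1.1 x, fun ⟨y, hy⟩ => hy ▸ h0 _ y⟩
    have := rTensor_exact (V.X i.1.2) hex (hg i.1.1) (z i)
    obtain ⟨w, hw⟩ := this.1 (by
      rw [← tensorMap_id_apply]
      exact congrArg (fun z : Tot N''.X V n => z i) hz)
    exact ⟨w, (tensorMap_id_apply _ w).trans hw⟩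
  choose w hw using key
  refine ⟨∑ i ∈ z.support, DirectSum.of (fun i : Idx n => tensor (N.X.X i.1.1) (V.X i.1.2)) i (w i),
    ?_⟩
  rw [map_sum]
  conv_rhs => rw [← DirectSum.sum_support_of z]
  refine Finset.sum_congr rfl fun i _ => ?_
  rw [totMap, DirectSum.map_of]
  congr 1
  exact hw i

end Exact

namespace DGMod

variable {k : Type u} [Field k] {O : Type u} [CommRing O] [Algebra k O] {A : DGAlg k O}
  {N N' N'' C : DGMod A}

/-- Left exactness of `- ⊗_A C`; this is where smoothness enters, through the flatness of free
`𝒟`-modules over `O`. -/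
theorem taMap_injective [Algebra.Smooth k O] (hC : IsCofibrant C) {f : N ⟶ N'}
    (hf : ∀ n, Function.Injective (app f n)) (n : ℕ) : Function.Injective (taMap f C n) := by
  obtain ⟨s, hs, hφ⟩ := exists_section_of_isCofibrant hC
  intro x y hxy
  rw [← totToTa_taToTot (hs := hs) hφ n x, ← totToTa_taToTot (hs := hs) hφ n y]
  congr 1
  refine totMap_injective (fun q => flat_freeD _) hf n ?_
  rw [← taToTot_taMap, ← taToTot_taMap, hxy]

/-- Right exactness of `- ⊗_A C`, deduced by naturality from that of `- ⊗_O V`. -/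
theorem taMap_exact (hC : IsCofibrant C) {f : N ⟶ N'} {g : N' ⟶ N''}
    (hg : ∀ n, Function.Surjective (app g n))
    (h : ∀ n x, app g n x = 0 → ∃ y, app f n y = x) (h0 : ∀ n x, app g n (app f n x) = 0)
    (n : ℕ) (z : TensA N' C n) (hz : taMap g C n z = 0) : ∃ w, taMap f C n w = z := by
  obtain ⟨s, hs, hφ⟩ := exists_section_of_isCofibrant hC
  obtain ⟨w, hw⟩ := totMap_exact hg h h0 n (taToTot N' s hs n z) (by
    rw [← taToTot_taMap, hz, map_zero])
  refine ⟨totToTa N (freeCounit C) n w, ?_⟩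
  rw [← totToTa_totMap, hw, totToTa_taToTot hφ]

theorem taMap_surjective {g : N ⟶ N'} (hg : ∀ n, Function.Surjective (app g n)) (n : ℕ) :
    Function.Surjective (taMap g C n) := by
  intro z
  induction z using ta_induction with
  | h0 => exact ⟨0, map_zero _⟩
  | hadd x y hx hy =>
    obtain ⟨a, rfl⟩ := hx
    obtain ⟨b, rfl⟩ := hy
    exact ⟨a + b, map_add _ _ _⟩
  | ht p q h x c =>
    obtain ⟨y, rfl⟩ := hg p x
    exact ⟨ta p q n y c, taMap_ta g n p q h y c⟩

/-- The kernel of a morphism. -/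
noncomputable abbrev ker (g : N ⟶ N') : DGMod A := pb g (zeroHom (zeroMod A) N')

/-- The inclusion of the kernel. -/
noncomputable abbrev kerι (g : N ⟶ N') : ker g ⟶ N := pbFst g _

theorem kerι_injective (g : N ⟶ N') (n : ℕ) : Function.Injective (app (kerι g) n) :=
  fun _ _ h => pb_ext h (Subsingleton.elim _ _)

theorem app_kerι (g : N ⟶ N') (n : ℕ) (x : (ker g).X.X n) : app g n (app (kerι g) n x) = 0 :=
  app_congr (isPullback_pb g (zeroHom (zeroMod A) N')).w n x

theorem exists_ker {g : N ⟶ N'} (n : ℕ) (x : N.X.X n) (h : app g n x = 0) :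
    ∃ y, app (kerι g) n y = x := by
  obtain ⟨y, hy, -⟩ := exists_pb (f := g) (g := zeroHom (zeroMod A) N') x 0 h
  exact ⟨y, hy⟩

theorem acyclic_ker {g : N ⟶ N'} (hg : ∀ n, Function.Surjective (app g n))
    (hw : WeakEquivalence g) : Acyclic (ker g).X := by
  rw [weakEquivalence_iff_elements] at hw
  intro n x hx
  obtain ⟨y, hy⟩ := (hw n).1 _ (hx.map (kerι g).hom) (by
    refine ⟨0, ?_⟩
    rw [map_zero]
    exact (app_kerι g n x).symm)
  have hgy : IsCycle N'.X (n + 1) (app g (n + 1) y) := by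
    change N'.d (n + 1) n _ = 0
    rw [← app_d, show N.d (n + 1) n y = app (kerι g) n x from hy, app_kerι]
  obtain ⟨z, hz, ⟨v, hv⟩⟩ := (hw (n + 1)).2 _ hgy
  obtain ⟨v', rfl⟩ := hg (n + 2) v
  obtain ⟨w, hw'⟩ := exists_ker (g := g) (n + 1) (y - z + N.d (n + 2) (n + 1) v') (by
    have hv' : app g (n + 1) (N.d (n + 2) (n + 1) v') = app g (n + 1) z - app g (n + 1) y :=
      (app_d g _ _ v').trans hv
    rw [map_add, map_sub, hv']
    abel)
  refine ⟨w, kerι_injective g n ?_⟩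
  change app (kerι g) n ((ker g).d (n + 1) n w) = _
  have hz' : N.d (n + 1) n z = 0 := hz
  rw [app_d, hw', map_add, map_sub, hz', show N.d (n + 1) n y = app (kerι g) n x from hy,
    show N.d (n + 1) n (N.d (n + 2) (n + 1) v') = 0 from dgd_dgd N.X _ _ _ v', sub_zero, add_zero]

theorem surjective_of_trivialFibration {g : N ⟶ N'} (hf : Fibration g) (hw : WeakEquivalence g)
    (n : ℕ) : Function.Surjective (app g n) := by
  rw [fibration_iff_surjective] at hf
  rcases n with _ | n
  · intro y
    obtain ⟨x, -, ⟨v, hv⟩⟩ := ((weakEquivalence_iff_elements g).1 hw 0).2 y (dgd_zero N'.X y)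
    obtain ⟨v', rfl⟩ := hf 1 one_pos v
    refine ⟨x - N.d 1 0 v', ?_⟩
    rw [map_sub, app_d]
    refine (congrArg (app g 0 x - ·) hv).trans ?_
    rw [sub_sub_cancel]
  · exact hf (n + 1) n.succ_pos

theorem taMap_kerι (g : N ⟶ N') (n : ℕ) (z : TensA (ker g) C n) :
    taMap g C n (taMap (kerι g) C n z) = 0 := by
  induction z using ta_induction with
  | h0 => simp only [map_zero]
  | hadd x y hx hy => rw [map_add, map_add, hx, hy, add_zero]
  | ht p q h x c => rw [taMap_ta _ _ _ _ h, taMap_ta _ _ _ _ h, app_kerι, zero_ta]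

variable [Algebra.Smooth k O]

/-- For `g` surjective, cycles of `N' ⊗_A C` lift to cycles of `N ⊗_A C`, provided that one degree
below the cycles of `ker g ⊗_A C` are boundaries. -/
theorem exists_cycle_lift {C : DGMod A} (hC : IsCofibrant C) {g : N ⟶ N'}
    (hg : ∀ n, Function.Surjective (app g n)) (n : ℕ)
    (hK : ∀ m, m + 1 = n → ∀ u, IsCycle (tensorObj (ker g) C).X m u →
      IsBoundary (tensorObj (ker g) C).X m u)
    (z : TensA N' C n) (hz : IsCycle (tensorObj N' C).X n z) :
    ∃ w : TensA N C n, IsCycle (tensorObj N C).X n w ∧ taMap g C n w = z := by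
  obtain ⟨w, rfl⟩ := taMap_surjective hg n z
  rcases n with _ | n
  · exact ⟨w, dgd_zero (tensorObj N C).X w, rfl⟩
  · have hz' : taDiff N' C (n + 1) n (taMap g C (n + 1) w) = 0 := hz
    obtain ⟨u, hu⟩ := taMap_exact hC hg exists_ker (app_kerι g) n (taDiff N C (n + 1) n w) (by
      rw [← taMap_taDiff, hz'])
    have huc : taDiff (ker g) C n (n - 1) u = 0 := by
      refine taMap_injective hC (kerι_injective g) (n - 1) ?_
      rw [← taMap_taDiff, hu, map_zero]
      exact dgd_dgd (tensorObj N C).X (n + 1) n (n - 1) w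
    obtain ⟨v, hv'⟩ : ∃ v : TensA (ker g) C (n + 1), taDiff (ker g) C (n + 1) n v = u :=
      hK n rfl u huc
    refine ⟨w - taMap (kerι g) C (n + 1) v, ?_, ?_⟩
    · change taDiff N C (n + 1) n _ = 0
      rw [map_sub, taMap_taDiff, hv', hu, sub_self]
    · rw [map_sub, taMap_kerι, sub_zero]

/-- By induction on the degree: `L` is a quotient of the contractible module `pathObj L`, and the
kernel is again acyclic. -/
theorem acyclic_tensorObj {L C : DGMod A} (hC : IsCofibrant C) (hL : Acyclic L.X) :
    Acyclic (tensorObj L C).X := by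
  intro n
  induction n using Nat.strong_induction_on generalizing L with
  | _ n ih =>
    intro z hz
    have hw : WeakEquivalence (pathEval L) := by
      rw [weakEquivalence_iff_elements]
      exact fun n => ⟨fun x hx _ => acyclic_pathObj L n x hx, fun y hy => ⟨0, isCycle_zero n, by
        rw [map_zero, zero_sub]
        exact (hL n y hy).neg⟩⟩
    have hg := surjective_of_trivialFibration (fibration_pathEval L) hw
    obtain ⟨w, hw, rfl⟩ := exists_cycle_lift hC hg n
      (fun m hm => ih m (by omega) (acyclic_ker hg hw)) z hz
    exact (acyclic_tensorObj_coneObj _ C n w hw).map (tensorObjMap (pathEval L) C).hom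

theorem weakEquivalence_tensorObjMap_of_surjective {C : DGMod A} (hC : IsCofibrant C) {g : N ⟶ N'}
    (hg : ∀ n, Function.Surjective (app g n)) (hw : WeakEquivalence g) :
    WeakEquivalence (tensorObjMap g C) := by
  have hK := acyclic_tensorObj hC (acyclic_ker hg hw)
  rw [weakEquivalence_iff_elements]
  refine fun n => ⟨fun (x : TensA N C n) hx hb => ?_, fun y hy => ?_⟩
  · obtain ⟨y, hy⟩ : ∃ y : TensA N' C (n + 1), taDiff N' C (n + 1) n y = taMap g C n x := hb
    obtain ⟨y, rfl⟩ := taMap_surjective hg (n + 1) y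
    obtain ⟨u, hu⟩ := taMap_exact hC hg exists_ker (app_kerι g) n (x - taDiff N C (n + 1) n y) (by
      rw [map_sub, ← taMap_taDiff, hy, sub_self])
    have hu' : IsCycle (tensorObj (ker g) C).X n u := by
      refine taMap_injective hC (kerι_injective g) (n - 1) ?_
      change taMap (kerι g) C (n - 1) (taDiff (ker g) C n (n - 1) u) = _
      rw [← taMap_taDiff, hu]
      exact (hx.sub (isBoundary_d (X := (tensorObj N C).X) n y).isCycle).trans (map_zero _).symm
    have := (hK n u hu').map (tensorObjMap (kerι g) C).hom
    have := (hu ▸ this : IsBoundary (tensorObj N C).X n (x - taDiff N C (n + 1) n y)).add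
      (isBoundary_d (X := (tensorObj N C).X) n y)
    exact (sub_add_cancel x (taDiff N C (n + 1) n y)) ▸ this
  · obtain ⟨w, hw, rfl⟩ := exists_cycle_lift hC hg n (fun m _ => hK m) y hy
    refine ⟨w, hw, 0, ?_⟩
    exact (map_zero _).trans (sub_self _).symm

/-- If `C` is cofibrant, `- ⊗_A C` preserves weak equivalences. The factorization
`N ⟶ N × pathObj N' ⟶ N'` reduces this to surjective morphisms, as the inclusion of `N` has the
surjective left inverse `N × pathObj N' ⟶ N`. -/
theorem weakEquivalence_tensorObjMap {C : DGMod A} (hC : IsCofibrant C) {f : N ⟶ N'}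
    (hf : WeakEquivalence f) : WeakEquivalence ((tensorFunctor C).map f) := by
  have h1 : WeakEquivalence ((tensorFunctor C).map (prdFst N (pathObj N'))) :=
    weakEquivalence_tensorObjMap_of_surjective hC
      (fun n x => ⟨app (prdInl N _) n x, rfl⟩) (weakEquivalence_prdFst (acyclic_pathObj N'))
  have h2 : WeakEquivalence ((tensorFunctor C).map (prdInl N (pathObj N'))) := by
    rw [← weakEquivalence_comp_iff _ _ h1, ← Functor.map_comp,
      show prdInl N (pathObj N') ≫ prdFst N (pathObj N') = 𝟙 N from rfl,
      CategoryTheory.Functor.map_id]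
    exact weakEquivalence_of_isIso _
  have h3 := weakEquivalence_prdDesc_pathEval hf
  rw [← inl_prdDesc f (pathEval N'), Functor.map_comp, weakEquivalence_comp_iff' _ _ h2]
  exact weakEquivalence_tensorObjMap_of_surjective hC
    (surjective_of_trivialFibration (fibration_prdDesc_pathEval f) h3) h3

end DGMod

/-! ### The functors that represent the derived tensor product -/

namespace DGMod

variable {k : Type u} [Field k] {O : Type u} [CommRing O] [Algebra k O] {A : DGAlg k O}

theorem isCofibrant_zeroMod : IsCofibrant (zeroMod A) := by
  rw [isCofibrant_iff, cofibration_iff]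
  have : IsIso (initial.to (zeroMod A)) :=
    (initialIsInitial.uniqueUpToIso zeroMod_isZero.isInitial).isIso_hom
  exact MorphismProperty.llp_of_isIso _ _

/-- A functor that preserves weak equivalences and model squares, and the zero object up to weak
equivalence, preserves homotopy fiber sequences. -/
theorem preservesHomotopyFiberSequences_of_preservesModelSquares {F : DGMod A ⥤ DGMod A}
    (hw : PreservesWeakEquivalences F) (h0 : Acyclic (F.obj (⊤_ (DGMod A))).X)
    (hF : PreservesModelSquares F) : PreservesHomotopyFiberSequences F := by
  intro X Y Z W t l r b ⟨h, hZ⟩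
  refine ⟨hF _ _ _ _ h, ?_⟩
  rw [← weakEquivalence_terminal_iff] at h0
  have := (weakEquivalence_comp_iff (F.map (terminal.from Z)) _ h0).2 (hw _ hZ)
  rwa [Subsingleton.elim (terminal.from (F.obj Z)) (_ ≫ _)]

theorem acyclic_tensorObj_of_subsingleton {N : DGMod A} (hN : ∀ n, Subsingleton (N.X.X n))
    (M : DGMod A) : Acyclic (tensorObj N M).X := by
  intro n z _
  have hz : ∀ z : TensA N M n, z = 0 := by
    intro z
    induction z using ta_induction with
    | h0 => rfl
    | hadd x y hx hy => rw [hx, hy, add_zero]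
    | ht p q h x m => rw [Subsingleton.elim x 0, zero_ta]
  exact (hz z).symm ▸ isBoundary_zero n

theorem acyclic_of_weakEquivalence {M N : DGMod A} {f : M ⟶ N} (hf : WeakEquivalence f)
    (hM : Acyclic M.X) : Acyclic N.X := by
  rw [← weakEquivalence_terminal_iff] at hM ⊢
  rw [← weakEquivalence_comp_iff' f _ hf]
  rwa [Subsingleton.elim (f ≫ terminal.from N) (terminal.from M)]

variable (Q : CofibrantReplacementFunctor (DGMod A))

theorem weakEquivalence_replacement {M N : DGMod A} {f : M ⟶ N} (hf : WeakEquivalence f) :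
    WeakEquivalence (Q.Q.map f) := by
  rw [← weakEquivalence_comp_iff _ _ (Q.weakEquivalence N)]
  have := Q.q.naturality f
  rw [this, weakEquivalence_comp_iff' _ _ (Q.weakEquivalence M)]
  exact hf

theorem preservesWeakEquivalences_replacement_tensor (M : DGMod A) :
    PreservesWeakEquivalences (Q.Q ⋙ tensorFunctor M) := fun X Y _ hf =>
  weakEquivalence_tensorObjMap_of_isCofibrant (Q.cofibrant X) (Q.cofibrant Y)
    (weakEquivalence_replacement Q hf) M

/-- The zero module is a cofibrant replacement of itself, and has zero tensor products. -/
theorem acyclic_replacement_tensor_terminal (M : DGMod A) :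
    Acyclic ((Q.Q ⋙ tensorFunctor M).obj (⊤_ (DGMod A))).X := by
  have hs : ∀ n, Subsingleton (((𝟭 (DGMod A)).obj (⊤_ (DGMod A))).X.X n) := fun n =>
    inferInstanceAs (Subsingleton ((⊤_ (DGMod A)).X.X n))
  have hw : WeakEquivalence (zeroHom (zeroMod A) (Q.Q.obj (⊤_ (DGMod A)))) := by
    rw [← weakEquivalence_comp_iff _ _ (Q.weakEquivalence _), weakEquivalence_iff_elements]
    refine fun n => ⟨fun x _ _ => ?_, fun y _ => ⟨0, isCycle_zero n, 0, Subsingleton.elim _ _⟩⟩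
    exact acyclic_zeroMod n x (by rw [Subsingleton.elim x 0]; exact isCycle_zero n)
  exact acyclic_of_weakEquivalence
    (weakEquivalence_tensorObjMap_of_isCofibrant isCofibrant_zeroMod (Q.cofibrant _) hw M)
    (acyclic_tensorObj_of_subsingleton inferInstance M)

/-- The functors that represent a derived tensor product preserve weak equivalences and, up to
weak equivalence, the zero object. -/
theorem preserves_of_representsDerivedTensor [Algebra.Smooth k O] {M : DGMod A}
    {F : DGMod A ⥤ DGMod A} (hF : RepresentsDerivedTensor M F) :
    PreservesWeakEquivalences F ∧ Acyclic (F.obj (⊤_ (DGMod A))).X := by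
  cases hF with
  | both Q CM c hC hc =>
    exact ⟨preservesWeakEquivalences_replacement_tensor Q CM,
      acyclic_replacement_tensor_terminal Q CM⟩
  | left Q =>
    exact ⟨preservesWeakEquivalences_replacement_tensor Q M,
      acyclic_replacement_tensor_terminal Q M⟩
  | right CM c hC hc =>
    exact ⟨fun _ _ _ hf => weakEquivalence_tensorObjMap hC hf,
      acyclic_tensorObj_of_subsingleton inferInstance CM⟩

theorem preservesModelSquares_iff [Algebra.Smooth k O] {M : DGMod A} {F : DGMod A ⥤ DGMod A}
    (hF : RepresentsDerivedTensor M F) :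
    PreservesModelSquares F ↔ PreservesHomotopyFiberSequences F := by
  obtain ⟨hw, h0⟩ := preserves_of_representsDerivedTensor hF
  exact ⟨preservesHomotopyFiberSequences_of_preservesModelSquares hw h0,
    preservesModelSquares_of_preservesHomotopyFiberSequences hw⟩

end DGMod

end DGeom

theorem mainTheorem5 {k : Type u} [Field k] [CharZero k] {O : Type u} [CommRing O] [Algebra k O]
    [Algebra.Smooth k O] (A : DGeom.DGAlg k O) :
    (∀ F : DGeom.DGMod A ⥤ DGeom.DGMod A, DGeom.PreservesWeakEquivalences F →
      DGeom.PreservesHomotopyFiberSequences F → DGeom.PreservesModelSquares F) ∧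
    (∀ (M : DGeom.DGMod A) (F : DGeom.DGMod A ⥤ DGeom.DGMod A),
      DGeom.RepresentsDerivedTensor M F →
        (DGeom.PreservesModelSquares F ↔ DGeom.PreservesHomotopyFiberSequences F)) ∧
    (∀ M : DGeom.DGMod A,
      DGeom.IsFlat M ↔ DGeom.DerivedTensorPreservesHomotopyFiberSequences M) :=
  ⟨fun _ => DGeom.DGMod.preservesModelSquares_of_preservesHomotopyFiberSequences,
    fun _ _ => DGeom.DGMod.preservesModelSquares_iff,
    fun _ => forall₂_congr fun _ => DGeom.DGMod.preservesModelSquares_iff⟩
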